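/- Let $0\le c\le 0.43$, and let $\mathcal C=\{x\in\mathbb R^4: x_4=c\sqrt{x_1^2+x_2^2+x_3^2}\}$ with the metric inherited from $\mathbb R^4$. Use on it the coordinates $y=(x_1,x_2,x_3)$, $r=|y|$, $t=\cos\phi=y_3/r$. Write $\nabla_c$, $\Delta_c$ for the gradient and the Laplace--Beltrami operator of $\mathcal C$, and $B_1=\{r<1\}$. For real $\beta$ let $F_\beta(t)=\sum_{n\ge 0}b_n(1-t)^n$ for $-1<t\le 1$, where $b_0=1$ and $b_{n+1}=\frac{b_n}{2}\,\frac{n^2+n-\beta}{(n+1)^2}$. This is the solution of $(1-t^2)F''-2tF'+\beta F=0$ that is regular at $t=1$ and satisfies $F(1)=1$. Let $t_c$ be the unique zero of $F_{2/(1+c^2)}$ in $(-1,1)$. Let $f_c$ be the positive multiple of $F_{2/(1+c^2)}$ with $\sqrt{1-t_c^2}\,|f_c'(t_c)|=1$, and let $g_c=F_{-1/(4(1+c^2))}$. Let $h_n$ be the Legendre polynomial of degree $n$ with $h_n(1)=1$, and let $\alpha_n\ge 0$ be the root of $\alpha_n(\alpha_n+1)=n(n+1)(1+c^2)$. Then there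 exist $\varepsilon>0$, $N\in\mathbb N$ and real coefficients $a_0,\dots,a_N$ such that the functions $$v_c(r,t)=r f_c(t)+\varepsilon r^{-1/2}g_c(t),\qquad w_c(r,t)=\sum_{n=0}^N a_n r^{\alpha_n}h_n(t),\qquad p_c=\max\{\min\{v_c,w_c\},0\}$$ have the following properties. On the ray $t=-1$ and at the vertex, where $v_c$ is singular, $p_c$ is given its lower limit from the points off that ray. (0) $w_c(1,t)>0$ for every $t\in(-1,1]$ with $f_c(t)\ge 0$. (1) $w_c(1,t)>f_c(t)+\varepsilon g_c(t)$ for every $t\in(-1,1]$ with $w_c(1,t)>0$. (2) $\Delta_c p_c\le 0$ in $\{p_c>0\}\cap B_1$ in the sense of distributions. (3) For every $x\in\partial\{p_c>0\}\cap B_1$, the function $p_c$ is Lipschitz near $x$ and $\lim_{\rho\to0}\sup_{B_\rho(x)}|\nabla_c p_c|<1$, the supremum being over the points other than the vertex at which $p_c$ is differentiable. -/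

import Mathlib

open Set Filter Topology MeasureTheory
open scoped NNReal ENNReal ContDiff

noncomputable section

namespace ConeFB

/-! ### Legendre functions -/

/-- Coefficients of the Legendre function of the first kind, expanded about `t = 1`. -/
def legendreCoeff (β : ℝ) : ℕ → ℝ
  | 0 => 1
  | n + 1 => legendreCoeff β n / 2 * (((n : ℝ) ^ 2 + n - β) / ((n : ℝ) + 1) ^ 2)

/-- The solution of `(1 - t²) f'' - 2 t f' + β f = 0` on `-1 < t` that is regular at `t = 1`,
with value `1` there. -/
def legendreFn (β t : ℝ) : ℝ := ∑' n : ℕ, legendreCoeff β n * (1 - t) ^ n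

/-- `t_c`: the zero in `(-1, 1)` of the Legendre function with `β = 2 / (1 + c²)`. -/
def tZero (c : ℝ) : ℝ := sSup {t : ℝ | t ∈ Ioo (-1 : ℝ) 1 ∧ legendreFn (2 / (1 + c ^ 2)) t = 0}

/-- `f_c`: the Legendre function with `β = 2 / (1 + c²)`, positive at `t = 1`, normalized by
`√(1 - t_c²) * |f_c'(t_c)| = 1`, that is, `φ ↦ f_c (cos φ)` has slope of modulus `1` at its zero. -/
def fProfile (c t : ℝ) : ℝ :=
  legendreFn (2 / (1 + c ^ 2)) t /
    (Real.sqrt (1 - tZero c ^ 2) * |deriv (legendreFn (2 / (1 + c ^ 2))) (tZero c)|)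

/-- `g_c`: the Legendre function with `β = -(1/4) / (1 + c²)`. -/
def gProfile (c t : ℝ) : ℝ := legendreFn (-(1 / 4) / (1 + c ^ 2)) t

/-- The Legendre polynomial `h_n` of degree `n`, with `h_n 1 = 1`. -/
def legendreP (n : ℕ) (t : ℝ) : ℝ :=
  Polynomial.aeval ((1 - t) / 2) (Polynomial.shiftedLegendre n)

/-- The nonnegative root `α_n` of `α (α + 1) = n (n + 1) (1 + c²)`. -/
def expo (c : ℝ) (n : ℕ) : ℝ :=
  (-1 + Real.sqrt (1 + 4 * n * (n + 1) * (1 + c ^ 2))) / 2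

/-- `w_c (r, t) = ∑_{n ≤ N} a_n r^{α_n} h_n(t)`. -/
def wPolar (c : ℝ) (N : ℕ) (a : ℕ → ℝ) (r t : ℝ) : ℝ :=
  ∑ n ∈ Finset.range (N + 1), a n * r ^ expo c n * legendreP n t

/-- `v_c (r, t) = r f_c(t) + ε r^{-1/2} g_c(t)`. -/
def vPolar (c ε r t : ℝ) : ℝ :=
  r * fProfile c t + ε * r ^ (-(1 / 2) : ℝ) * gProfile c t

/-! ### The cone

The cone `{x ∈ ℝ⁴ | x₄ = c √(x₁² + x₂² + x₃²)}` is described in the global coordinates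
`y = (x₁, x₂, x₃)`. With `r = ‖y‖` and `ŷ = y / r`, the metric inherited from `ℝ⁴` is
`I + c² ŷ ŷᵀ`, its inverse is `I - (c² / (1 + c²)) ŷ ŷᵀ`, and its volume is the constant
`√(1 + c²)` times Lebesgue measure. -/

/-- The coordinate space of the cone. -/
abbrev E3 : Type := EuclideanSpace ℝ (Fin 3)

/-- `t = cos φ`, where `φ` is the angle of `y` with the third coordinate axis. -/
def cosAngle (y : E3) : ℝ := y 2 / ‖y‖

/-- The ray `φ = π` together with the vertex: the set where `f_c(cos φ)`, `g_c(cos φ)` or a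
negative power of `r` is singular. -/
def singularRay : Set E3 := {y | y 2 = -‖y‖}

/-- `max {min {v_c, w_c}, 0}` by its formula, meaningful off the singular ray. -/
def pRaw (c ε : ℝ) (N : ℕ) (a : ℕ → ℝ) (y : E3) : ℝ :=
  max (min (vPolar c ε ‖y‖ (cosAngle y)) (wPolar c N a ‖y‖ (cosAngle y))) 0

open Classical in
/-- `p_c = max {min {v_c, w_c}, 0}` as a function on the cone. On the singular ray, where `v_c` is
infinite (`+∞` at the vertex), its value is the lower limit from the points off the ray. -/
def pCone (c ε : ℝ) (N : ℕ) (a : ℕ → ℝ) (y : E3) : ℝ :=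
  if y ∈ singularRay then liminf (pRaw c ε N a) (𝓝[singularRayᶜ] y) else pRaw c ε N a y

/-- The unit vector `y / ‖y‖`. -/
def radial (y : E3) : E3 := ‖y‖⁻¹ • y

/-- `|∇_c u|² = |∇u|² - (c² / (1 + c²)) u_r²`, which in polar coordinates is
`u_r² / (1 + c²) + u_φ² / r²` for `u = u(r, φ)`. -/
def gradSq (c : ℝ) (u : E3 → ℝ) (y : E3) : ℝ :=
  ‖gradient u y‖ ^ 2 - c ^ 2 / (1 + c ^ 2) * (inner ℝ (gradient u y) (radial y)) ^ 2

/-- The Laplace-Beltrami operator of the cone: `Δ_c u = Δu - (c² / (1 + c²)) (u_rr + (2 / r) u_r)`,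
that is, `(u_rr + (2 / r) u_r) / (1 + c²)` plus the spherical Laplacian of `u` over `r²`. -/
def coneLaplacian (c : ℝ) (u : E3 → ℝ) (y : E3) : ℝ :=
  Laplacian.laplacian u y -
    c ^ 2 / (1 + c ^ 2) *
      (iteratedFDeriv ℝ 2 u y ![radial y, radial y] + 2 / ‖y‖ * fderiv ℝ u y (radial y))

/-- `Δ_c u ≤ 0` in `U` in the sense of distributions. The constant volume density is omitted. -/
def DistribSuperharmonicOn (c : ℝ) (u : E3 → ℝ) (U : Set E3) : Prop :=
  ∀ ψ : E3 → ℝ, ContDiff ℝ ∞ ψ → HasCompactSupport ψ → tsupport ψ ⊆ U → (∀ y, 0 ≤ ψ y) →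
    Integrable (fun y => u y * coneLaplacian c ψ y) ∧ ∫ y, u y * coneLaplacian c ψ y ≤ 0

open Classical in
/-- `|∇_c u| (y)` at the points away from the vertex where `u` is differentiable; the value `0`
elsewhere makes the other points irrelevant in a supremum. -/
def gradNorm (c : ℝ) (u : E3 → ℝ) (y : E3) : ℝ≥0∞ :=
  if y ≠ 0 ∧ DifferentiableAt ℝ u y then ENNReal.ofReal (Real.sqrt (gradSq c u y)) else 0

/-- `lim_{ρ → 0} sup_{B_ρ(x)} |∇_c u| < 1`, for a function that is Lipschitz near `x` (so that its
almost everywhere defined gradient controls it). -/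
def GradLimsupLtOne (c : ℝ) (u : E3 → ℝ) (x : E3) : Prop :=
  (∃ K : ℝ≥0, ∃ s ∈ 𝓝 x, LipschitzOnWith K u s) ∧ limsup (gradNorm c u) (𝓝 x) < 1

end ConeFB

end

open Set Filter Topology MeasureTheory
open scoped NNReal ENNReal ContDiff

set_option linter.unusedSimpArgs false

noncomputable section

namespace ConeFB

/-! Put z = c²/(1+c²), so that 1/(1+c²) = 1 - z and z ∈ [0, 0.15605], and let F and g be the
Legendre functions with parameters 2(1-z) and -(1-z)/4. Off the ray t = -1 the functions r F and
r^{-1/2} g are harmonic on the cone; off the vertex so is each r^{α_n} h_n (`divergence_polarTerm`).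
Up to the normalizing factor L = 1/(√(1-t_c²) F'(t_c)), the witnesses are N = 3, ε = 0.17 - 0.3z and
w = 0.235 - 0.045z + (0.965 + 0.066z) r^{α₁}h₁ - 0.37z r^{α₂}h₂ + 0.233z r^{α₃}h₃. What remains is a
finite set of strict inequalities, uniform in z.

Superharmonicity: a minimum of two harmonic functions is superharmonic. The singularities of v do no
harm, because v - w tends to +∞ at each point of the ray in the ball where w ≥ 0
(`tendsto_sub_waveCone`), so that p = max {w, 0} nearby. This rests on F + 0.65 g > 0
(`legendreFn_add_pos`), on g → ∞ at t = -1, and on the smallness of r at the points near the axis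
with w ≥ 0 (`axis_bound`). At the vertex w has a bounded gradient, and a point is negligible for
integration by parts in dimension three. `IsMinPair` collects what this argument needs.

Gradient bound: at a free boundary point it suffices that |∇v| < 1 where v = 0 ≤ w and |∇w| < 1
where w = 0. Both squared gradients, without the factor L², are compared with k₀(z) = 0.9996 -
0.409z + 0.18z², a lower bound of (1-t_c²)F'(t_c)² (`slope_lower_bound`). On {v = 0} one has ε
r^{-3/2} = -F/g, so the squared gradient of v depends on t alone; it is `energy`. Its derivative has
the sign of the increasing function `energyFactor`, so on [T, t_c] with T = -0.44 + 0.705z it is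
largest at an end point. At t_c its value is the normalization, at T it is below k₀
(`energy_cut_lt`). Below the angle T there is nothing to show, because v > 0 wherever w ≥ 0
(`below_cut_pos`). For w the bound is `wave_grad_lt`.

The numerical inequalities are certified by bisection of boxes with affine arithmetic. Quantities
that are not polynomial, such as tails of series, powers r^{α_n} and exponents, enter as parameters
known up to an interval. An implication "w ≥ 0 implies A > 0" is tested as: on each small box, -w or
A is positive. -/

/-! ### A verified positivity test for polynomials on boxes, by affine arithmetic -/

/-- A fixed-point affine form in three noise symbols, in units of `2⁻⁴⁰`, with error radius `e`. -/
structure Aff where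
  c : ℤ
  a : ℤ
  b : ℤ
  d : ℤ
  e : ℕ

namespace Aff

/-- The real number `v` is enclosed by the form `X` at the noise values `p`, `q`, `r`. -/
def Encl (p q r : ℝ) (X : Aff) (v : ℝ) : Prop :=
  |1099511627776 * v - (X.c + X.a * p + X.b * q + X.d * r)| ≤ X.e

/-- `forceNat n k = k n`; reduction evaluates `n` first. -/
def forceNat {α : Type} (n : ℕ) (k : ℕ → α) : α := Nat.rec (k 0) (fun j _ => k (Nat.succ j)) n

/-- `forceInt n k = k n`; reduction evaluates `n` first. -/
def forceInt {α : Type} (n : ℤ) (k : ℤ → α) : α :=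
  Int.rec (fun m => forceNat m fun j => k (Int.ofNat j))
    (fun m => forceNat m fun j => k (Int.negSucc j)) n

theorem forceNat_eq {α : Type} (n : ℕ) (k : ℕ → α) : forceNat n k = k n := by
  cases n <;> rfl

theorem forceInt_eq {α : Type} (n : ℤ) (k : ℤ → α) : forceInt n k = k n := by
  cases n with
  | ofNat m => exact forceNat_eq m fun j => k (Int.ofNat j)
  | negSucc m => exact forceNat_eq m fun j => k (Int.negSucc j)

/-- The form with the given data, evaluated. -/
def build (c a b d : ℤ) (e : ℕ) : Aff :=
  forceInt c fun c => forceInt a fun a => forceInt b fun b => forceInt d fun d =>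
    forceNat e fun e => ⟨c, a, b, d, e⟩

theorem build_eq (c a b d : ℤ) (e : ℕ) : build c a b d e = ⟨c, a, b, d, e⟩ := by
  simp only [build, forceInt_eq, forceNat_eq]

/-- Recursors replace pattern matching here and in the rest of the checker, which is meant to be run
by kernel reduction; `add_eq` and its companions give the usable forms. -/
def add (X Y : Aff) : Aff :=
  Aff.rec (fun c a b d e => Aff.rec (fun c' a' b' d' e' =>
    build (Int.add c c') (Int.add a a') (Int.add b b') (Int.add d d') (Nat.add e e')) Y) X

def neg (X : Aff) : Aff :=
  Aff.rec (fun c a b d e => build (Int.neg c) (Int.neg a) (Int.neg b) (Int.neg d) e) X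

def rad (X : Aff) : ℕ :=
  Aff.rec (fun _ a b d e =>
    Nat.add (Nat.add (Int.natAbs a) (Int.natAbs b)) (Nat.add (Int.natAbs d) e)) X

/-- Only the terms linear in the noise are kept as symbols. Products of two noise parts are absorbed
in the radius by `rad X * rad Y`, next to the errors multiplied by the centres. The final 5 pays for
five roundings: those of the four coefficients and that of the radius. -/
def mul (X Y : Aff) : Aff :=
  Aff.rec (fun c a b d e => Aff.rec (fun c' a' b' d' e' =>
    build (Int.ediv (Int.mul c c') 1099511627776)
      (Int.ediv (Int.add (Int.mul c a') (Int.mul c' a)) 1099511627776)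
      (Int.ediv (Int.add (Int.mul c b') (Int.mul c' b)) 1099511627776)
      (Int.ediv (Int.add (Int.mul c d') (Int.mul c' d)) 1099511627776)
      (Nat.add (Nat.div (Nat.add (Nat.add (Nat.mul (Int.natAbs c) e') (Nat.mul (Int.natAbs c') e))
        (Nat.mul (rad ⟨c, a, b, d, e⟩) (rad ⟨c', a', b', d', e'⟩))) 1099511627776) 5)) Y) X

theorem add_eq (X Y : Aff) :
    X.add Y = ⟨X.c + Y.c, X.a + Y.a, X.b + Y.b, X.d + Y.d, X.e + Y.e⟩ := build_eq _ _ _ _ _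

theorem neg_eq (X : Aff) : X.neg = ⟨-X.c, -X.a, -X.b, -X.d, X.e⟩ := build_eq _ _ _ _ _

theorem rad_eq (X : Aff) : X.rad = X.a.natAbs + X.b.natAbs + (X.d.natAbs + X.e) := rfl

theorem mul_eq (X Y : Aff) : X.mul Y =
    ⟨X.c * Y.c / 1099511627776, (X.c * Y.a + Y.c * X.a) / 1099511627776,
      (X.c * Y.b + Y.c * X.b) / 1099511627776, (X.c * Y.d + Y.c * X.d) / 1099511627776,
      (X.c.natAbs * Y.e + Y.c.natAbs * X.e + X.rad * Y.rad) / 1099511627776 + 5⟩ :=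
  build_eq _ _ _ _ _

def const (n : ℤ) (m : ℕ) : Aff :=
  build (Int.ediv (Int.mul n 1099511627776) (Int.ofNat m)) 0 0 0 1

theorem const_eq (n : ℤ) (m : ℕ) : const n m = ⟨n * 1099511627776 / m, 0, 0, 0, 1⟩ :=
  build_eq _ _ _ _ _

def pos (X : Aff) : Bool := Nat.ble (Nat.add X.rad 1) X.c.toNat

theorem Encl.add {p q r v w : ℝ} {X Y : Aff} (hX : X.Encl p q r v) (hY : Y.Encl p q r w) :
    (X.add Y).Encl p q r (v + w) := by
  rw [add_eq]
  unfold Encl at *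
  push_cast
  refine le_trans (le_of_eq_of_le ?_ (abs_add_le _ _)) (add_le_add hX hY)
  congr 1
  ring

theorem Encl.neg {p q r v : ℝ} {X : Aff} (hX : X.Encl p q r v) : X.neg.Encl p q r (-v) := by
  rw [neg_eq]
  unfold Encl at *
  push_cast
  rw [← abs_neg]
  refine le_of_eq_of_le ?_ hX
  congr 1
  ring

theorem abs_noise_le {p q r : ℝ} (hp : |p| ≤ 1) (hq : |q| ≤ 1) (hr : |r| ≤ 1) (a b d : ℝ) :
    |a * p + b * q + d * r| ≤ |a| + |b| + |d| := by
  refine (abs_add_three _ _ _).trans ?_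
  simp only [abs_mul]
  gcongr <;> exact mul_le_of_le_one_right (abs_nonneg _) ‹_›

theorem abs_intFloor_sub_le (n : ℤ) (m : ℕ) (hm : 0 < m) :
    |(n : ℝ) / m - ((n / m : ℤ) : ℝ)| ≤ 1 := by
  have hm' : (0 : ℝ) < m := by exact_mod_cast hm
  have h : ((n / m : ℤ) : ℝ) * m + ((n % m : ℤ) : ℝ) = n := by
    exact_mod_cast Int.ediv_mul_add_emod n m
  have h0 : (0 : ℝ) ≤ ((n % m : ℤ) : ℝ) := by
    exact_mod_cast Int.emod_nonneg n (by omega)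
  have h1 : ((n % m : ℤ) : ℝ) ≤ m := by
    exact_mod_cast (Int.emod_lt_of_pos n (by omega : (0 : ℤ) < m)).le
  have : (n : ℝ) / m - ((n / m : ℤ) : ℝ) = ((n % m : ℤ) : ℝ) / m := by
    rw [eq_div_iff hm'.ne', sub_mul, div_mul_cancel₀ _ hm'.ne']
    linarith
  rw [this, abs_of_nonneg (by positivity)]
  exact (div_le_one hm').2 h1

theorem Encl.const {p q r : ℝ} (n : ℤ) (m : ℕ) (hm : 0 < m) :
    (const n m).Encl p q r ((n : ℝ) / m) := by
  rw [const_eq]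
  unfold Encl
  have := abs_intFloor_sub_le (n * 1099511627776) m hm
  push_cast at this ⊢
  refine le_of_eq_of_le ?_ this
  congr 1
  ring

theorem cast_natAbs_real (n : ℤ) : ((n.natAbs : ℕ) : ℝ) = |(n : ℝ)| := by
  rw [← Int.cast_abs, Nat.cast_natAbs]

theorem Encl.mul {p q r v w : ℝ} {X Y : Aff} (hp : |p| ≤ 1) (hq : |q| ≤ 1) (hr : |r| ≤ 1)
    (hX : X.Encl p q r v) (hY : Y.Encl p q r w) : (X.mul Y).Encl p q r (v * w) := by
  rw [mul_eq]
  unfold Encl at *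
  have hradX : |1099511627776 * v - X.c| ≤ X.rad := by
    have h := abs_noise_le hp hq hr (X.a : ℝ) X.b X.d
    have := abs_add_le (1099511627776 * v - (X.c + X.a * p + X.b * q + X.d * r))
      (X.a * p + X.b * q + X.d * r)
    simp only [rad_eq, Nat.cast_add, cast_natAbs_real]
    calc _ = |1099511627776 * v - (X.c + X.a * p + X.b * q + X.d * r) +
          (X.a * p + X.b * q + X.d * r)| := by congr 1; ring
      _ ≤ _ := by linarith
  have hradY : |1099511627776 * w - Y.c| ≤ Y.rad := by
    have h := abs_noise_le hp hq hr (Y.a : ℝ) Y.b Y.d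
    have := abs_add_le (1099511627776 * w - (Y.c + Y.a * p + Y.b * q + Y.d * r))
      (Y.a * p + Y.b * q + Y.d * r)
    simp only [rad_eq, Nat.cast_add, cast_natAbs_real]
    calc _ = |1099511627776 * w - (Y.c + Y.a * p + Y.b * q + Y.d * r) +
          (Y.a * p + Y.b * q + Y.d * r)| := by congr 1; ring
      _ ≤ _ := by linarith
  have f1 := abs_intFloor_sub_le (X.c * Y.c) 1099511627776 (by norm_num)
  have f2 := abs_intFloor_sub_le (X.c * Y.a + Y.c * X.a) 1099511627776 (by norm_num)
  have f3 := abs_intFloor_sub_le (X.c * Y.b + Y.c * X.b) 1099511627776 (by norm_num)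
  have f4 := abs_intFloor_sub_le (X.c * Y.d + Y.c * X.d) 1099511627776 (by norm_num)
  have f5 := abs_intFloor_sub_le
    ((X.c.natAbs * Y.e + Y.c.natAbs * X.e + X.rad * Y.rad : ℕ) : ℤ) 1099511627776 (by norm_num)
  have e5 : ((((X.c.natAbs * Y.e + Y.c.natAbs * X.e + X.rad * Y.rad : ℕ) : ℤ) /
      ((1099511627776 : ℕ) : ℤ) : ℤ) : ℝ) =
      (((X.c.natAbs * Y.e + Y.c.natAbs * X.e + X.rad * Y.rad) / 1099511627776 : ℕ) : ℝ) := by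
    norm_cast
  rw [e5] at f5
  have e0 : (((1099511627776 : ℕ) : ℤ)) = 1099511627776 := by norm_num
  rw [e0] at f1 f2 f3 f4
  set C : ℤ := X.c * Y.c / 1099511627776
  set A : ℤ := (X.c * Y.a + Y.c * X.a) / 1099511627776
  set B : ℤ := (X.c * Y.b + Y.c * X.b) / 1099511627776
  set D : ℤ := (X.c * Y.d + Y.c * X.d) / 1099511627776
  set E : ℕ := (X.c.natAbs * Y.e + Y.c.natAbs * X.e + X.rad * Y.rad) / 1099511627776
  push_cast [cast_natAbs_real] at f1 f2 f3 f4 f5 ⊢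
  -- With V = 2⁴⁰v and W = 2⁴⁰w this is VW = cc' + c(W - c') + c'(V - c) + (V - c)(W - c'), after
  -- the linear noise has been moved to the coefficients; the last group consists of the rounding
  -- errors.
  have key : 1099511627776 * (v * w) - (C + A * p + B * q + D * r) =
      (X.c * (1099511627776 * w - (Y.c + Y.a * p + Y.b * q + Y.d * r)) +
        Y.c * (1099511627776 * v - (X.c + X.a * p + X.b * q + X.d * r)) +
        (1099511627776 * v - X.c) * (1099511627776 * w - Y.c)) / 1099511627776 +
      (((X.c * Y.c : ℝ) / 1099511627776 - C) + (((X.c * Y.a + Y.c * X.a : ℝ) / 1099511627776 - A) * p +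
      ((X.c * Y.b + Y.c * X.b : ℝ) / 1099511627776 - B) * q +
      ((X.c * Y.d + Y.c * X.d : ℝ) / 1099511627776 - D) * r)) := by
    ring
  rw [key]
  have g1 : |(X.c : ℝ) * (1099511627776 * w - (Y.c + Y.a * p + Y.b * q + Y.d * r))| ≤
      |(X.c : ℝ)| * Y.e := by
    rw [abs_mul]; gcongr
  have g2 : |(Y.c : ℝ) * (1099511627776 * v - (X.c + X.a * p + X.b * q + X.d * r))| ≤
      |(Y.c : ℝ)| * X.e := by
    rw [abs_mul]; gcongr
  have g3 : |(1099511627776 * v - X.c) * (1099511627776 * w - Y.c)| ≤ (X.rad : ℝ) * Y.rad := by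
    rw [abs_mul]; gcongr
  have g4 := abs_noise_le hp hq hr ((X.c * Y.a + Y.c * X.a : ℝ) / 1099511627776 - A)
    ((X.c * Y.b + Y.c * X.b : ℝ) / 1099511627776 - B)
    ((X.c * Y.d + Y.c * X.d : ℝ) / 1099511627776 - D)
  refine (abs_add_le _ _).trans ?_
  have h1 : |((X.c : ℝ) * (1099511627776 * w - (Y.c + Y.a * p + Y.b * q + Y.d * r)) +
        Y.c * (1099511627776 * v - (X.c + X.a * p + X.b * q + X.d * r)) +
        (1099511627776 * v - X.c) * (1099511627776 * w - Y.c)) / 1099511627776| ≤ E + 1 := by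
    rw [abs_div, abs_of_pos (by norm_num : (0 : ℝ) < 1099511627776)]
    have := (abs_le.1 f5).2
    have h2 := abs_add_three ((X.c : ℝ) * (1099511627776 * w - (Y.c + Y.a * p + Y.b * q + Y.d * r)))
        (Y.c * (1099511627776 * v - (X.c + X.a * p + X.b * q + X.d * r)))
        ((1099511627776 * v - X.c) * (1099511627776 * w - Y.c))
    have h3 : |((X.c : ℝ) * (1099511627776 * w - (Y.c + Y.a * p + Y.b * q + Y.d * r)) +
        Y.c * (1099511627776 * v - (X.c + X.a * p + X.b * q + X.d * r)) +
        (1099511627776 * v - X.c) * (1099511627776 * w - Y.c))| / 1099511627776 ≤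
        (|(X.c : ℝ)| * Y.e + |(Y.c : ℝ)| * X.e + X.rad * Y.rad) / 1099511627776 := by
      gcongr
      linarith
    linarith
  have h2 := abs_add_le ((X.c * Y.c : ℝ) / 1099511627776 - C)
    (((X.c * Y.a + Y.c * X.a : ℝ) / 1099511627776 - A) * p +
      ((X.c * Y.b + Y.c * X.b : ℝ) / 1099511627776 - B) * q +
      ((X.c * Y.d + Y.c * X.d : ℝ) / 1099511627776 - D) * r)
  linarith

theorem Encl.pos_of_pos {p q r v : ℝ} {X : Aff} (hp : |p| ≤ 1) (hq : |q| ≤ 1) (hr : |r| ≤ 1)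
    (hX : X.Encl p q r v) (h : X.pos = true) : 0 < v := by
  unfold Encl at hX
  have h1 : X.rad < X.c.toNat := Nat.le_of_ble_eq_true h
  have h2 : (X.rad : ℤ) < X.c := by omega
  have h3 : (X.rad : ℝ) < X.c := by exact_mod_cast h2
  simp only [rad_eq, Nat.cast_add, cast_natAbs_real] at h3
  have h4 := (abs_le.1 (abs_noise_le hp hq hr (X.a : ℝ) X.b X.d)).1
  have h5 := (abs_le.1 hX).1
  linarith

end Aff

/-- Polynomial expressions in three subdivided variables and a list of further parameters. -/
inductive PolyExpr where
  | x : PolyExpr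
  | y : PolyExpr
  | z : PolyExpr
  | par : ℕ → PolyExpr
  | rat : ℤ → ℕ → PolyExpr
  | add : PolyExpr → PolyExpr → PolyExpr
  | neg : PolyExpr → PolyExpr
  | mul : PolyExpr → PolyExpr → PolyExpr
  | letIn : PolyExpr → PolyExpr → PolyExpr

namespace PolyExpr

instance : Add PolyExpr := ⟨add⟩
instance : Mul PolyExpr := ⟨mul⟩
instance : Neg PolyExpr := ⟨neg⟩
instance : Sub PolyExpr := ⟨fun p q => add p (neg q)⟩

/-- The value of an expression at a point. -/
def eval (v₀ v₁ v₂ : ℝ) : PolyExpr → List ℝ → ℝ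
  | x, _ => v₀
  | y, _ => v₁
  | z, _ => v₂
  | par i, w => w.getD i 0
  | rat n m, _ => (n : ℝ) / m
  | add p q, w => eval v₀ v₁ v₂ p w + eval v₀ v₁ v₂ q w
  | neg p, w => -eval v₀ v₁ v₂ p w
  | mul p q, w => eval v₀ v₁ v₂ p w * eval v₀ v₁ v₂ q w
  -- Bindings are counted from the innermost: `par 0` is the latest value, and each new binding
  -- shifts the older indices by one.
  | letIn p q, w => eval v₀ v₁ v₂ q (eval v₀ v₁ v₂ p w :: w)

section

variable (v₀ v₁ v₂ : ℝ) (w : List ℝ) (p q : PolyExpr)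

@[simp] theorem eval_x : eval v₀ v₁ v₂ x w = v₀ := rfl
@[simp] theorem eval_y : eval v₀ v₁ v₂ y w = v₁ := rfl
@[simp] theorem eval_z : eval v₀ v₁ v₂ z w = v₂ := rfl
@[simp] theorem eval_par (i : ℕ) : eval v₀ v₁ v₂ (par i) w = w.getD i 0 := rfl
@[simp] theorem eval_rat (n : ℤ) (m : ℕ) : eval v₀ v₁ v₂ (rat n m) w = (n : ℝ) / m := rfl
@[simp] theorem eval_add : eval v₀ v₁ v₂ (p + q) w = eval v₀ v₁ v₂ p w + eval v₀ v₁ v₂ q w := rfl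
@[simp] theorem eval_mul : eval v₀ v₁ v₂ (p * q) w = eval v₀ v₁ v₂ p w * eval v₀ v₁ v₂ q w := rfl
@[simp] theorem eval_neg : eval v₀ v₁ v₂ (-p) w = -eval v₀ v₁ v₂ p w := rfl
@[simp] theorem eval_sub : eval v₀ v₁ v₂ (p - q) w = eval v₀ v₁ v₂ p w - eval v₀ v₁ v₂ q w :=
  (sub_eq_add_neg _ _).symm
@[simp] theorem eval_letIn :
    eval v₀ v₁ v₂ (letIn p q) w = eval v₀ v₁ v₂ q (eval v₀ v₁ v₂ p w :: w) := rfl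

end

/-- All denominators are positive. -/
def good : PolyExpr → Bool
  | x => true
  | y => true
  | z => true
  | par _ => true
  | rat _ m => Nat.ble 1 m
  | add p q => p.good && q.good
  | neg p => p.good
  | mul p q => p.good && q.good
  | letIn p q => p.good && q.good

/-- The entry of a list at an index, or `0`. -/
def look (W : List Aff) : ℕ → Aff :=
  List.rec (fun _ => ⟨0, 0, 0, 0, 0⟩)
    (fun X _ ih i => Nat.rec X (fun j _ => ih j) i) W

/-- The affine form of an expression. -/
def aff (X Y Z : Aff) (t : PolyExpr) : List Aff → Aff :=
  PolyExpr.rec (fun _ => X) (fun _ => Y) (fun _ => Z) (fun i W => look W i)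
    (fun n m _ => Aff.const n m) (fun _ _ f g W => (f W).add (g W)) (fun _ f W => (f W).neg)
    (fun _ _ f g W => (f W).mul (g W))
    -- Taking the form apart before it is put on the list has it evaluated once, not at each use.
    (fun _ _ f g W => Aff.rec (fun c a b d e => g (⟨c, a, b, d, e⟩ :: W)) (f W)) t

theorem encl_aff {p q r v₀ v₁ v₂ : ℝ} {w : List ℝ} {X Y Z : Aff} {W : List Aff}
    (hp : |p| ≤ 1) (hq : |q| ≤ 1) (hr : |r| ≤ 1)
    (hX : X.Encl p q r v₀) (hY : Y.Encl p q r v₁) (hZ : Z.Encl p q r v₂)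
    (hW : ∀ i, (look W i).Encl p q r (w.getD i 0)) (t : PolyExpr)
    (ht : t.good = true) : (t.aff X Y Z W).Encl p q r (t.eval v₀ v₁ v₂ w) := by
  induction t generalizing W w with
  | x => exact hX
  | y => exact hY
  | z => exact hZ
  | par i => exact hW i
  | rat n m => exact Aff.Encl.const n m (Nat.le_of_ble_eq_true ht)
  | add s t hs ht' =>
    rw [good, Bool.and_eq_true] at ht
    exact (hs hW ht.1).add (ht' hW ht.2)
  | neg s hs => exact (hs hW ht).neg
  | mul s t hs ht' =>
    rw [good, Bool.and_eq_true] at ht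
    exact (hs hW ht.1).mul hp hq hr (ht' hW ht.2)
  | letIn s t hs ht' =>
    rw [good, Bool.and_eq_true] at ht
    refine ht' (W := s.aff X Y Z W :: W) (fun i => ?_) ht.2
    cases i with
    | zero => exact hs hW ht.1
    | succ i => exact hW i

end PolyExpr

/-- Some member of the list is found positive. -/
def anyPos (X Y Z : Aff) (W : List Aff) (l : List PolyExpr) : Bool :=
  List.rec false (fun t _ ih => Bool.rec ih true (t.aff X Y Z W).pos) l

/-- Bisection of the box with centre `(m₀, m₁, m₂)` and half-widths `(h₀, h₁, h₂)`. The weights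
`k₀`, `k₁`, `k₂` steer the choice of the side to bisect. -/
def boxCheck (k₀ k₁ k₂ : ℕ) (W : List Aff) (l : List PolyExpr) (n : ℕ) :
    ℤ → ℤ → ℤ → ℕ → ℕ → ℕ → Bool :=
  Nat.rec
    (fun m₀ m₁ m₂ h₀ h₁ h₂ =>
      anyPos ⟨m₀, Int.ofNat h₀, 0, 0, 0⟩ ⟨m₁, 0, Int.ofNat h₁, 0, 0⟩ ⟨m₂, 0, 0, Int.ofNat h₂, 0⟩ W l)
    (fun _ ih m₀ m₁ m₂ h₀ h₁ h₂ =>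
      Bool.rec
        (Bool.rec
          (Bool.rec
            (Aff.forceNat (Nat.div (Nat.add h₂ 1) 2) fun h => Bool.rec false
              (Aff.forceInt (Int.add m₂ (Int.ofNat h)) fun m => ih m₀ m₁ m h₀ h₁ h)
              (Aff.forceInt (Int.sub m₂ (Int.ofNat h)) fun m => ih m₀ m₁ m h₀ h₁ h))
            (Aff.forceNat (Nat.div (Nat.add h₁ 1) 2) fun h => Bool.rec false
              (Aff.forceInt (Int.add m₁ (Int.ofNat h)) fun m => ih m₀ m m₂ h₀ h h₂)
              (Aff.forceInt (Int.sub m₁ (Int.ofNat h)) fun m => ih m₀ m m₂ h₀ h h₂))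
            (Nat.ble (Nat.mul k₂ h₂) (Nat.mul k₁ h₁)))
          (Aff.forceNat (Nat.div (Nat.add h₀ 1) 2) fun h => Bool.rec false
            (Aff.forceInt (Int.add m₀ (Int.ofNat h)) fun m => ih m m₁ m₂ h h₁ h₂)
            (Aff.forceInt (Int.sub m₀ (Int.ofNat h)) fun m => ih m m₁ m₂ h h₁ h₂))
          (Bool.and (Nat.ble (Nat.mul k₁ h₁) (Nat.mul k₀ h₀)) (Nat.ble (Nat.mul k₂ h₂) (Nat.mul k₀ h₀))))
        true
        (anyPos ⟨m₀, Int.ofNat h₀, 0, 0, 0⟩ ⟨m₁, 0, Int.ofNat h₁, 0, 0⟩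
          ⟨m₂, 0, 0, Int.ofNat h₂, 0⟩ W l)) n

theorem exists_noise (v : ℝ) (m : ℤ) (h : ℕ) (hv : |1099511627776 * v - m| ≤ h) :
    ∃ p : ℝ, |p| ≤ 1 ∧ 1099511627776 * v = m + h * p := by
  rcases Nat.eq_zero_or_pos h with rfl | hh
  · refine ⟨0, by simp, ?_⟩
    rw [Nat.cast_zero, abs_nonpos_iff] at hv
    simp only [Nat.cast_zero, zero_mul, add_zero]
    linarith
  · have hh' : (0 : ℝ) < h := by exact_mod_cast hh
    refine ⟨(1099511627776 * v - m) / h, ?_, ?_⟩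
    · rwa [abs_div, abs_of_pos hh', div_le_one hh']
    · field_simp; ring

/-- The half-width is rounded up, so the two halves cover the interval also when `h` is odd. -/
theorem abs_half (v : ℝ) (m : ℤ) (h : ℕ) (hv : |1099511627776 * v - m| ≤ h) :
    |1099511627776 * v - ((m - (((h + 1) / 2 : ℕ) : ℤ) : ℤ) : ℝ)| ≤ (((h + 1) / 2 : ℕ) : ℝ) ∨
    |1099511627776 * v - ((m + (((h + 1) / 2 : ℕ) : ℤ) : ℤ) : ℝ)| ≤ (((h + 1) / 2 : ℕ) : ℝ) := by
  set k := (h + 1) / 2 with hk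
  have h2 : (h : ℝ) ≤ 2 * k := by
    have : h ≤ 2 * k := by omega
    exact_mod_cast this
  push_cast
  rw [abs_le] at hv
  rcases le_total (1099511627776 * v) m with hc | hc
  · left; rw [abs_le]; constructor <;> linarith
  · right; rw [abs_le]; constructor <;> linarith

section

variable {v₀ v₁ v₂ : ℝ} {w : List ℝ} {W : List Aff} {l : List PolyExpr}

theorem exists_pos_of_anyPos (hW : ∀ p q r : ℝ,
      ∀ i, (PolyExpr.look W i).Encl p q r (w.getD i 0)) {m₀ m₁ m₂ : ℤ} {h₀ h₁ h₂ : ℕ}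
    (hl : ∀ t ∈ l, PolyExpr.good t = true)
    (hv₀ : |1099511627776 * v₀ - m₀| ≤ h₀) (hv₁ : |1099511627776 * v₁ - m₁| ≤ h₁)
    (hv₂ : |1099511627776 * v₂ - m₂| ≤ h₂)
    (h : anyPos ⟨m₀, h₀, 0, 0, 0⟩ ⟨m₁, 0, h₁, 0, 0⟩ ⟨m₂, 0, 0, h₂, 0⟩ W l = true) :
    ∃ t ∈ l, 0 < t.eval v₀ v₁ v₂ w := by
  obtain ⟨p, hp, ep⟩ := exists_noise _ _ _ hv₀
  obtain ⟨q, hq, eq⟩ := exists_noise _ _ _ hv₁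
  obtain ⟨r, hr, er⟩ := exists_noise _ _ _ hv₂
  induction l with
  | nil => exact absurd h Bool.false_ne_true
  | cons t l ih =>
    by_cases ht : (t.aff ⟨m₀, h₀, 0, 0, 0⟩ ⟨m₁, 0, h₁, 0, 0⟩ ⟨m₂, 0, 0, h₂, 0⟩ W).pos = true
    · refine ⟨t, List.mem_cons_self, ?_⟩
      refine Aff.Encl.pos_of_pos hp hq hr (PolyExpr.encl_aff hp hq hr ?_ ?_ ?_ (hW p q r) t
        (hl t List.mem_cons_self)) ht
      · simp [Aff.Encl, ep]
      · simp [Aff.Encl, eq]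
      · simp [Aff.Encl, er]
    · rw [Bool.not_eq_true] at ht
      have h' : anyPos ⟨m₀, h₀, 0, 0, 0⟩ ⟨m₁, 0, h₁, 0, 0⟩ ⟨m₂, 0, 0, h₂, 0⟩ W l = true := by
        simp only [anyPos, ht] at h
        exact h
      obtain ⟨s, hs, hs'⟩ := ih (fun t ht => hl t (List.mem_cons_of_mem _ ht)) h'
      exact ⟨s, List.mem_cons_of_mem _ hs, hs'⟩

theorem and_of_boolRec {a b : Bool} (h : Bool.rec (motive := fun _ => Bool) false b a = true) :
    a = true ∧ b = true := by
  cases a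
  · exact absurd h Bool.false_ne_true
  · exact ⟨rfl, h⟩

theorem or_of_boolRec {a b : Bool} (h : Bool.rec (motive := fun _ => Bool) b true a = true) :
    a = true ∨ b = true := by
  cases a
  · exact Or.inr h
  · exact Or.inl rfl

theorem either_of_boolRec {a b c : Bool} (h : Bool.rec (motive := fun _ => Bool) b c a = true) :
    c = true ∨ b = true := by
  cases a
  · exact Or.inr h
  · exact Or.inl h

/-- Whichever side is bisected, the point lies in one of the two halves; hence neither the weights
nor the depth matter for soundness. Different boxes may be settled by different members of the list,
which is how implications are tested. -/
theorem exists_pos_of_boxCheck {k₀ k₁ k₂ : ℕ} (hW : ∀ p q r : ℝ,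
      ∀ i, (PolyExpr.look W i).Encl p q r (w.getD i 0))
    (hl : ∀ t ∈ l, PolyExpr.good t = true) (n : ℕ) {m₀ m₁ m₂ : ℤ} {h₀ h₁ h₂ : ℕ}
    (hv₀ : |1099511627776 * v₀ - m₀| ≤ h₀) (hv₁ : |1099511627776 * v₁ - m₁| ≤ h₁)
    (hv₂ : |1099511627776 * v₂ - m₂| ≤ h₂)
    (h : boxCheck k₀ k₁ k₂ W l n m₀ m₁ m₂ h₀ h₁ h₂ = true) :
    ∃ t ∈ l, 0 < t.eval v₀ v₁ v₂ w := by
  induction n generalizing m₀ m₁ m₂ h₀ h₁ h₂ with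
  | zero => exact exists_pos_of_anyPos hW hl hv₀ hv₁ hv₂ h
  | succ n ih =>
    rcases or_of_boolRec h with h | h
    · exact exists_pos_of_anyPos hW hl hv₀ hv₁ hv₂ h
    rcases either_of_boolRec h with h | h
    · rw [Aff.forceNat_eq, Aff.forceInt_eq, Aff.forceInt_eq] at h
      have h := and_of_boolRec h
      rcases abs_half _ _ _ hv₀ with h' | h'
      · exact ih h' hv₁ hv₂ h.1
      · exact ih h' hv₁ hv₂ h.2
    rcases either_of_boolRec h with h | h
    · rw [Aff.forceNat_eq, Aff.forceInt_eq, Aff.forceInt_eq] at h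
      have h := and_of_boolRec h
      rcases abs_half _ _ _ hv₁ with h' | h'
      · exact ih hv₀ h' hv₂ h.1
      · exact ih hv₀ h' hv₂ h.2
    · rw [Aff.forceNat_eq, Aff.forceInt_eq, Aff.forceInt_eq] at h
      have h := and_of_boolRec h
      rcases abs_half _ _ _ hv₂ with h' | h'
      · exact ih hv₀ hv₁ h' h.1
      · exact ih hv₀ hv₁ h' h.2

end

/-! ### Power series of radius two -/

/-- The coefficients grow at most like a polynomial times `2⁻ⁿ`. -/
def TwoRadius (b : ℕ → ℝ) : Prop :=
  ∃ (C : ℝ) (k : ℕ), ∀ n : ℕ, |b n| ≤ C * ((n : ℝ) + 1) ^ k * (1 / 2) ^ n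

/-- The sum of the power series. -/
def psum (b : ℕ → ℝ) (x : ℝ) : ℝ := ∑' n : ℕ, b n * x ^ n

theorem hasSum_of_eq {f g : ℕ → ℝ} {a : ℝ} (h : HasSum f a) (hfg : ∀ n, g n = f n) :
    HasSum g a := (funext hfg : g = f) ▸ h

theorem summable_poly_geom (k : ℕ) {q : ℝ} (hq0 : 0 ≤ q) (hq : q < 1) :
    Summable fun n : ℕ => ((n : ℝ) + 1) ^ k * q ^ n := by
  rcases hq0.eq_or_lt with rfl | hq0
  · refine summable_of_ne_finset_zero (s := {0}) fun n hn => ?_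
    rw [zero_pow (by simpa using hn), mul_zero]
  have h := (summable_pow_mul_geometric_of_norm_lt_one (R := ℝ) k (r := q)
    (by rwa [Real.norm_of_nonneg hq0.le]))
  have h2 := ((summable_nat_add_iff 1).2 h).mul_right q⁻¹
  refine h2.congr fun n => ?_
  push_cast
  field_simp
  ring

namespace TwoRadius

variable {b : ℕ → ℝ}

theorem const_nonneg {C : ℝ} {k : ℕ}
    (h : ∀ n : ℕ, |b n| ≤ C * ((n : ℝ) + 1) ^ k * (1 / 2) ^ n) : 0 ≤ C := by
  have := (abs_nonneg _).trans (h 0)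
  simpa using this

theorem summable_abs (hb : TwoRadius b) {r : ℝ} (hr0 : 0 ≤ r) (hr : r < 2) :
    Summable fun n : ℕ => |b n| * r ^ n := by
  obtain ⟨C, k, h⟩ := hb
  refine Summable.of_nonneg_of_le (fun n => by positivity) (fun n => ?_)
    ((summable_poly_geom k (q := r / 2) (by positivity) (by linarith)).mul_left C)
  calc |b n| * r ^ n ≤ C * ((n : ℝ) + 1) ^ k * (1 / 2) ^ n * r ^ n := by gcongr; exact h n
    _ = _ := by rw [div_pow, div_pow]; ring

theorem summable (hb : TwoRadius b) {x : ℝ} (hx : |x| < 2) : Summable fun n : ℕ => b n * x ^ n := by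
  refine Summable.of_norm ((hb.summable_abs (abs_nonneg x) hx).congr fun n => ?_)
  rw [Real.norm_eq_abs, abs_mul, abs_pow]

theorem hasSum (hb : TwoRadius b) {x : ℝ} (hx : |x| < 2) :
    HasSum (fun n : ℕ => b n * x ^ n) (psum b x) := (hb.summable hx).hasSum

/-- The factor n + 1 raises the polynomial degree by one and the shift of the index costs 2ᵏ. Since
the class is stable under termwise differentiation, smoothness follows by induction. -/
theorem deriv (hb : TwoRadius b) : TwoRadius fun n => ((n : ℝ) + 1) * b (n + 1) := by
  obtain ⟨C, k, h⟩ := hb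
  have hC := const_nonneg h
  refine ⟨C * 2 ^ k, k + 1, fun n => ?_⟩
  rw [abs_mul, abs_of_nonneg (by positivity : (0 : ℝ) ≤ (n : ℝ) + 1)]
  have h1 := h (n + 1)
  push_cast at h1
  have h2 : ((n : ℝ) + 1 + 1) ^ k ≤ 2 ^ k * ((n : ℝ) + 1) ^ k := by
    rw [← mul_pow]; gcongr; linarith
  calc ((n : ℝ) + 1) * |b (n + 1)| ≤
      ((n : ℝ) + 1) * (C * (2 ^ k * ((n : ℝ) + 1) ^ k) * (1 / 2) ^ n) := by
        gcongr
        refine h1.trans ?_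
        have h3 : (1 / 2 : ℝ) ^ (n + 1) ≤ (1 / 2) ^ n :=
          pow_le_pow_of_le_one (by norm_num) (by norm_num) n.le_succ
        exact mul_le_mul (mul_le_mul_of_nonneg_left h2 hC) h3 (by positivity) (by positivity)
    _ = _ := by ring

theorem hasDerivAt (hb : TwoRadius b) {x : ℝ} (hx : |x| < 2) :
    HasDerivAt (psum b) (psum (fun n => ((n : ℝ) + 1) * b (n + 1)) x) x := by
  obtain ⟨r, hxr, hr⟩ := exists_between hx
  have hr0 : 0 ≤ r := (abs_nonneg x).trans hxr.le
  have hs := hb.deriv.summable_abs hr0 hr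
  have hu : Summable fun n : ℕ => |(n : ℝ) * b n| * r ^ (n - 1) := by
    rw [← summable_nat_add_iff 1]
    refine hs.congr fun n => ?_
    simp
  have key := hasDerivAt_tsum_of_isPreconnected (𝕜 := ℝ) (F := ℝ) (t := Ioo (-r) r)
    (g := fun n x => b n * x ^ n) (g' := fun n x => b n * ((n : ℝ) * x ^ (n - 1)))
    (y₀ := 0) (y := x) hu isOpen_Ioo isPreconnected_Ioo
    (fun n y _ => (hasDerivAt_pow n y).const_mul _) (fun n y hy => ?_) ?_
    (hb.summable (by simp)) (abs_lt.1 hxr)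
  · have h0 : (∑' n : ℕ, b n * ((n : ℝ) * x ^ (n - 1))) =
        psum (fun n => ((n : ℝ) + 1) * b (n + 1)) x := by
      have hsum : Summable fun n : ℕ => b n * ((n : ℝ) * x ^ (n - 1)) := by
        rw [← summable_nat_add_iff 1]
        refine (hb.deriv.summable hx).congr fun n => ?_
        push_cast
        ring
      rw [hsum.tsum_eq_zero_add]
      simp only [Nat.cast_zero, zero_mul, mul_zero, zero_add, psum]
      refine tsum_congr fun n => ?_
      push_cast
      ring
    rw [h0] at key
    exact key
  · rw [Real.norm_eq_abs, abs_mul, abs_mul, abs_pow, abs_mul]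
    have : |y| ≤ r := (abs_lt.2 hy).le
    calc |b n| * (|(n : ℝ)| * |y| ^ (n - 1)) = |(n : ℝ)| * |b n| * |y| ^ (n - 1) := by ring
      _ ≤ _ := by gcongr
  · have : 0 < r := (abs_nonneg x).trans_lt hxr
    constructor <;> linarith

theorem hasSum_nat_mul (hb : TwoRadius b) {x : ℝ} (hx : |x| < 2) :
    HasSum (fun n : ℕ => n * b n * x ^ n) (x * psum (fun n => ((n : ℝ) + 1) * b (n + 1)) x) := by
  have h := (hb.deriv.hasSum hx).mul_left x
  rw [← hasSum_nat_add_iff' 1]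
  simp only [Finset.range_one, Finset.sum_singleton, Nat.cast_zero, zero_mul, sub_zero]
  refine hasSum_of_eq h fun n => ?_
  push_cast
  ring

theorem contDiffOn (hb : TwoRadius b) : ContDiffOn ℝ ∞ (psum b) (Ioo (-2) 2) := by
  rw [contDiffOn_infty]
  intro n
  induction n generalizing b with
  | zero =>
    exact contDiffOn_zero.2 fun x hx =>
      (hb.hasDerivAt (abs_lt.2 hx)).continuousAt.continuousWithinAt
  | succ n ih =>
    have h1 := (contDiffOn_succ_iff_deriv_of_isOpen (𝕜 := ℝ) (n := n) (f := psum b)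
      (isOpen_Ioo (a := (-2 : ℝ)) (b := 2))).2
      ⟨fun x hx => (hb.hasDerivAt (abs_lt.2 hx)).differentiableAt.differentiableWithinAt,
        fun h => absurd h (by simp), (ih hb.deriv).congr fun x hx =>
          (hb.hasDerivAt (abs_lt.2 hx)).deriv⟩
    exact_mod_cast h1

end TwoRadius

/-! ### Legendre functions -/

/-- The coefficients of the derivative in the variable `1 - t`, up to sign. -/
def legendreCoeff' (β : ℝ) (n : ℕ) : ℝ := ((n : ℝ) + 1) * legendreCoeff β (n + 1)

/-- The derivative of `legendreFn β`. -/
def legendreFn' (β t : ℝ) : ℝ := -psum (legendreCoeff' β) (1 - t)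

theorem legendreFn_eq_psum (β t : ℝ) : legendreFn β t = psum (legendreCoeff β) (1 - t) := rfl

theorem legendreCoeff_succ (β : ℝ) (n : ℕ) : legendreCoeff β (n + 1) =
    legendreCoeff β n * (((n : ℝ) ^ 2 + n - β) / (2 * ((n : ℝ) + 1) ^ 2)) := by
  rw [legendreCoeff, mul_comm (2 : ℝ), ← div_div, div_mul_div_comm, div_div, mul_div_assoc, mul_comm (((n:ℝ)+1)^2)]

section

variable {β : ℝ}

/-- From index 1 on the ratio of successive coefficients lies in [0, 1/2]: β ≤ 2 ≤ n² + n gives the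
sign, and -β ≤ 1 ≤ n + 1 the bound. The coefficient of index 1 is -β/2, of modulus at most 1. -/
theorem abs_legendreCoeff_le (h1 : -1 ≤ β) (h2 : β ≤ 2) (n : ℕ) : |legendreCoeff β n| ≤ 2 * (1 / 2) ^ n := by
  have hβ : |β| ≤ 2 := abs_le.2 ⟨by linarith, h2⟩
  rcases Nat.eq_zero_or_pos n with rfl | hn
  · simp [legendreCoeff]
  induction n, hn using Nat.le_induction with
  | base =>
    rw [legendreCoeff_succ, legendreCoeff]
    norm_num
    rw [abs_div]
    norm_num
    linarith
  | succ n hn ih =>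
    have hn' : (1 : ℝ) ≤ n := by exact_mod_cast hn
    rw [legendreCoeff_succ, abs_mul, pow_succ (1 / 2 : ℝ) n, ← mul_assoc]
    refine mul_le_mul ih ?_ (abs_nonneg _) (by positivity)
    rw [abs_of_nonneg (div_nonneg (by nlinarith) (by positivity)), div_le_div_iff₀ (by positivity)
      (by norm_num)]
    nlinarith

theorem twoRadius_legendreCoeff (h1 : -1 ≤ β) (h2 : β ≤ 2) : TwoRadius (legendreCoeff β) :=
  ⟨2, 0, fun n => by simpa using abs_legendreCoeff_le h1 h2 n⟩

theorem twoRadius_legendreCoeff' (h1 : -1 ≤ β) (h2 : β ≤ 2) : TwoRadius (legendreCoeff' β) :=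
  (twoRadius_legendreCoeff h1 h2).deriv

theorem hasDerivAt_legendreFn (h1 : -1 ≤ β) (h2 : β ≤ 2) {t : ℝ} (ht : |1 - t| < 2) :
    HasDerivAt (legendreFn β) (legendreFn' β t) t := by
  have := ((twoRadius_legendreCoeff h1 h2).hasDerivAt ht).scomp t
    ((hasDerivAt_const t (1 : ℝ)).sub (hasDerivAt_id t))
  simpa [legendreFn', legendreCoeff', Function.comp_def] using! this

theorem contDiffOn_legendreFn (h1 : -1 ≤ β) (h2 : β ≤ 2) : ContDiffOn ℝ ∞ (legendreFn β) (Ioo (-1) 3) := by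
  refine (twoRadius_legendreCoeff h1 h2).contDiffOn.comp
    ((contDiff_const (c := (1 : ℝ))).sub contDiff_id).contDiffOn fun t ht => ?_
  show 1 - t ∈ Ioo (-2 : ℝ) 2
  constructor <;> linarith [ht.1, ht.2]

theorem contDiffOn_legendreFn' (h1 : -1 ≤ β) (h2 : β ≤ 2) : ContDiffOn ℝ ∞ (legendreFn' β) (Ioo (-1) 3) := by
  refine ((twoRadius_legendreCoeff' h1 h2).contDiffOn.comp
    ((contDiff_const (c := (1 : ℝ))).sub contDiff_id).contDiffOn fun t ht => ?_).neg
  show 1 - t ∈ Ioo (-2 : ℝ) 2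
  constructor <;> linarith [ht.1, ht.2]

/-- The Legendre equation in divergence form. -/
theorem hasDerivAt_flux_legendreFn (h1 : -1 ≤ β) (h2 : β ≤ 2) {t : ℝ} (ht : |1 - t| < 2) :
    HasDerivAt (fun t => (1 - t ^ 2) * legendreFn' β t) (-β * legendreFn β t) t := by
  set b := legendreCoeff β with hb
  have hb0 := twoRadius_legendreCoeff h1 h2
  have hb1 := twoRadius_legendreCoeff' h1 h2
  set φ₂ := psum (fun n => ((n : ℝ) + 1) * legendreCoeff' β (n + 1)) (1 - t)
  set x := 1 - t with hx
  have e1 := hb1.hasSum_nat_mul ht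
  have e2 := hb0.hasSum_nat_mul ht
  have e3 : HasSum (fun n : ℕ => n * (n - 1) * b n * x ^ n) (x * (x * φ₂)) := by
    rw [← hasSum_nat_add_iff' 1]
    simp only [Finset.range_one, Finset.sum_singleton, Nat.cast_zero, zero_mul, sub_zero]
    refine hasSum_of_eq (e1.mul_left x) fun n => ?_
    simp only [legendreCoeff']
    push_cast
    ring
  have e4 := hb1.hasSum ht
  have e5 := hb0.hasSum ht
  -- In the variable x = 1 - t the equation reads x(2 - x)φ'' + 2(1 - x)φ' + βφ = 0. This
  -- combination is its left side, and the recursion annihilates every coefficient.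
  have key := ((((e1.mul_left 2).sub e3).add (e4.mul_left 2)).sub (e2.mul_left 2)).add
    (e5.mul_left β)
  have hz : (fun n : ℕ => 2 * (n * legendreCoeff' β n * x ^ n) - n * (n - 1) * b n * x ^ n +
      2 * (legendreCoeff' β n * x ^ n) - 2 * (n * b n * x ^ n) + β * (b n * x ^ n)) =
      fun _ => 0 := by
    funext n
    simp only [legendreCoeff', legendreCoeff_succ, hb]
    field_simp
    ring
  have hzero := key.unique (hz ▸ hasSum_zero)
  have hd : HasDerivAt (legendreFn' β) φ₂ t := by
    have := ((hb1.hasDerivAt ht).scomp t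
      ((hasDerivAt_const t (1 : ℝ)).sub (hasDerivAt_id t))).neg
    simpa [legendreFn', Function.comp_def] using! this
  have := (((hasDerivAt_const t (1 : ℝ)).sub (hasDerivAt_pow 2 t))).mul hd
  refine this.congr_deriv ?_
  have e6 : psum (fun n => ((n : ℝ) + 1) * legendreCoeff β (n + 1)) x = psum (legendreCoeff' β) x :=
    rfl
  rw [e6] at hzero
  simp only [legendreFn', legendreFn_eq_psum, ← hx, Pi.sub_apply]
  have : t = 1 - x := by rw [hx]; ring
  rw [this]
  norm_num
  linear_combination hzero

end

/-! ### Series given by the ratios of successive terms -/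

/-- `1 + ρ_m x + ρ_m ρ_{m+1} x² + ⋯`. -/
def ratioSeries (ρ : ℕ → ℝ) (m : ℕ) (x : ℝ) : ℝ :=
  ∑' j : ℕ, (∏ i ∈ Finset.range j, ρ (m + i)) * x ^ j

section

variable {ρ : ℕ → ℝ} {m : ℕ} {q x : ℝ}

theorem prod_ratio_nonneg (h0 : ∀ j, m ≤ j → 0 ≤ ρ j) (j : ℕ) :
    0 ≤ ∏ i ∈ Finset.range j, ρ (m + i) :=
  Finset.prod_nonneg fun i _ => h0 _ (Nat.le_add_right m i)

theorem prod_ratio_le (h0 : ∀ j, m ≤ j → 0 ≤ ρ j) (h1 : ∀ j, m ≤ j → ρ j ≤ q) (j : ℕ) :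
    ∏ i ∈ Finset.range j, ρ (m + i) ≤ q ^ j := by
  have := Finset.prod_le_prod (s := Finset.range j) (f := fun i => ρ (m + i)) (g := fun _ => q)
    (fun i _ => h0 _ (Nat.le_add_right m i)) (fun i _ => h1 _ (Nat.le_add_right m i))
  simpa using this

theorem summable_ratioSeries (h0 : ∀ j, m ≤ j → 0 ≤ ρ j) (h1 : ∀ j, m ≤ j → ρ j ≤ q)
    (hx : 0 ≤ x) (hq : q * x < 1) :
    Summable fun j : ℕ => (∏ i ∈ Finset.range j, ρ (m + i)) * x ^ j := by
  have hq0 : 0 ≤ q := (h0 m le_rfl).trans (h1 m le_rfl)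
  refine Summable.of_nonneg_of_le (fun j => mul_nonneg (prod_ratio_nonneg h0 j) (by positivity))
    (fun j => ?_) (summable_geometric_of_lt_one (mul_nonneg hq0 hx) hq)
  rw [mul_pow]
  exact mul_le_mul_of_nonneg_right (prod_ratio_le h0 h1 j) (by positivity)

theorem ratioSeries_eq (h0 : ∀ j, m ≤ j → 0 ≤ ρ j) (h1 : ∀ j, m ≤ j → ρ j ≤ q)
    (hx : 0 ≤ x) (hq : q * x < 1) :
    ratioSeries ρ m x = 1 + ρ m * x * ratioSeries ρ (m + 1) x := by
  rw [ratioSeries, (summable_ratioSeries h0 h1 hx hq).tsum_eq_zero_add, ratioSeries,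
    ← tsum_mul_left]
  simp only [Finset.range_zero, Finset.prod_empty, pow_zero, mul_one]
  congr 1
  refine tsum_congr fun j => ?_
  rw [Finset.prod_range_succ', pow_succ, add_zero]
  rw [Finset.prod_congr rfl fun i _ => by rw [show m + (i + 1) = m + 1 + i by ring]]
  ring

theorem one_le_ratioSeries (h0 : ∀ j, m ≤ j → 0 ≤ ρ j) (h1 : ∀ j, m ≤ j → ρ j ≤ q)
    (hx : 0 ≤ x) (hq : q * x < 1) : 1 ≤ ratioSeries ρ m x := by
  have := (summable_ratioSeries h0 h1 hx hq).le_tsum 0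
    (fun j _ => mul_nonneg (prod_ratio_nonneg h0 j) (by positivity))
  simpa [ratioSeries] using this

theorem ratioSeries_le (h0 : ∀ j, m ≤ j → 0 ≤ ρ j) (h1 : ∀ j, m ≤ j → ρ j ≤ q)
    (hx : 0 ≤ x) (hq : q * x < 1) : ratioSeries ρ m x ≤ (1 - q * x)⁻¹ := by
  have hq0 : 0 ≤ q := (h0 m le_rfl).trans (h1 m le_rfl)
  rw [← tsum_geometric_of_lt_one (mul_nonneg hq0 hx) hq]
  refine (summable_ratioSeries h0 h1 hx hq).tsum_le_tsum (fun j => ?_)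
    (summable_geometric_of_lt_one (mul_nonneg hq0 hx) hq)
  rw [mul_pow]
  exact mul_le_mul_of_nonneg_right (prod_ratio_le h0 h1 j) (by positivity)

end

/-- The ratio of the coefficients of `legendreFn β` of index `m` and `m - 1`. -/
def legendreRatio (β : ℝ) (m : ℕ) : ℝ := ((m : ℝ) * (m - 1) - β) / (2 * (m : ℝ) ^ 2)

/-- The ratio of successive coefficients of `legendreFn' β`. -/
def legendreRatio' (β : ℝ) (m : ℕ) : ℝ := ((m : ℝ) * (m - 1) - β) / (2 * ((m : ℝ) * (m - 1)))

section

variable {β : ℝ} {m : ℕ}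

theorem legendreRatio_nonneg (h2 : β ≤ 2) (hm : 2 ≤ m) : 0 ≤ legendreRatio β m := by
  have : (2 : ℝ) ≤ m := by exact_mod_cast hm
  exact div_nonneg (by nlinarith) (by positivity)

theorem legendreRatio_le (h1 : -1 ≤ β) (hm : 2 ≤ m) : legendreRatio β m ≤ 1 / 2 := by
  have : (2 : ℝ) ≤ m := by exact_mod_cast hm
  rw [legendreRatio, div_le_div_iff₀ (by positivity) (by norm_num)]
  nlinarith

theorem legendreRatio'_nonneg (h2 : β ≤ 2) (hm : 2 ≤ m) : 0 ≤ legendreRatio' β m := by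
  have : (2 : ℝ) ≤ m := by exact_mod_cast hm
  exact div_nonneg (by nlinarith) (by nlinarith)

/-- The ratio equals 1/2 - β/(2m(m-1)). A negative β, as for g, pushes it above 1/2, by an amount
that shrinks as more terms of the series are kept. -/
theorem legendreRatio'_le {k : ℕ} (h1 : -(1 / 4) ≤ β) (hk : 2 ≤ k) (hm : k ≤ m) :
    legendreRatio' β m ≤ 1 / 2 + 1 / (8 * ((k : ℝ) * (k - 1))) := by
  have hk' : (2 : ℝ) ≤ k := by exact_mod_cast hk
  have hm' : (k : ℝ) ≤ m := by exact_mod_cast hm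
  have e0 : (k : ℝ) * (k - 1) ≤ m * (m - 1) := by nlinarith
  have e1 : 0 < (k : ℝ) * (k - 1) := by nlinarith
  have e2 : 0 < (m : ℝ) * (m - 1) := by linarith
  rw [legendreRatio']
  calc ((m : ℝ) * (m - 1) - β) / (2 * ((m : ℝ) * (m - 1)))
      = 1 / 2 + -β / (2 * ((m : ℝ) * (m - 1))) := by
        rw [sub_div, mul_comm (2 : ℝ), ← div_div, div_self e2.ne', neg_div, sub_eq_add_neg]
    _ ≤ 1 / 2 + (1 / 4) / (2 * ((k : ℝ) * (k - 1))) := by gcongr; linarith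
    _ = _ := by rw [div_div]; congr 2; ring

theorem legendreRatio'_le_half (h1 : 0 ≤ β) (hm : 2 ≤ m) : legendreRatio' β m ≤ 1 / 2 := by
  have hm' : (2 : ℝ) ≤ m := by exact_mod_cast hm
  rw [legendreRatio', div_le_div_iff₀ (by nlinarith) (by norm_num)]
  nlinarith

theorem legendreCoeff_eq_prod (β : ℝ) (j : ℕ) : legendreCoeff β (j + 1) =
    -(β / 2) * ∏ i ∈ Finset.range j, legendreRatio β (2 + i) := by
  induction j with
  | zero => simp [legendreCoeff]; ring
  | succ j ih =>
    rw [legendreCoeff_succ, ih, Finset.prod_range_succ, mul_assoc]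
    congr 2
    simp only [legendreRatio]
    push_cast
    congr 1 <;> ring

theorem legendreCoeff'_eq_prod (β : ℝ) (j : ℕ) : legendreCoeff' β j =
    -(β / 2) * ∏ i ∈ Finset.range j, legendreRatio' β (2 + i) := by
  induction j with
  | zero => simp [legendreCoeff', legendreCoeff]; ring
  | succ j ih =>
    rw [Finset.prod_range_succ, ← mul_assoc, ← ih, legendreCoeff', legendreCoeff',
      legendreCoeff_succ β (j + 1)]
    simp only [legendreRatio']
    push_cast
    have : (2 + (j : ℝ)) ≠ 0 := by positivity
    have : (2 + (j : ℝ)) - 1 ≠ 0 := by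
      have : (0 : ℝ) ≤ j := by positivity
      linarith
    field_simp
    ring

/-- Once the constant and the factor -β/2 are split off, the remaining ratios all lie in [0, 1/2].
Truncation errors then have a known sign and a geometric bound. -/
theorem legendreFn_eq (h1 : -1 ≤ β) (h2 : β ≤ 2) {t : ℝ} (ht : |1 - t| < 2) :
    legendreFn β t = 1 - β / 2 * (1 - t) * ratioSeries (legendreRatio β) 2 (1 - t) := by
  rw [legendreFn, ((twoRadius_legendreCoeff h1 h2).summable ht).tsum_eq_zero_add, ratioSeries,
    ← tsum_mul_left, sub_eq_add_neg (1 : ℝ) (∑' x, _), ← tsum_neg]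
  congr 1
  · simp [legendreCoeff]
  · refine tsum_congr fun j => ?_
    rw [legendreCoeff_eq_prod]
    ring

theorem legendreFn'_eq (β t : ℝ) :
    legendreFn' β t = β / 2 * ratioSeries (legendreRatio' β) 2 (1 - t) := by
  rw [legendreFn', psum, ratioSeries, ← tsum_mul_left, ← tsum_neg]
  refine tsum_congr fun j => ?_
  rw [legendreCoeff'_eq_prod]
  ring

end

/-! ### Enclosures of the Legendre functions -/

/-- The parameters `w` are enclosed by the forms `W`, whatever the noise. -/
def AllEncl (W : List Aff) (w : List ℝ) : Prop :=
  ∀ p q r i, (PolyExpr.look W i).Encl p q r (w.getD i 0)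

theorem allEncl_nil : AllEncl [] [] := fun p q r i => by simp [Aff.Encl, PolyExpr.look]

theorem AllEncl.cons {W : List Aff} {w : List ℝ} (hW : AllEncl W w) {v : ℝ} (c : ℤ) (e : ℕ)
    (h : |1099511627776 * v - c| ≤ e) : AllEncl (⟨c, 0, 0, 0, e⟩ :: W) (v :: w) := by
  intro p q r i
  cases i with
  | zero => simpa [Aff.Encl, PolyExpr.look] using h
  | succ i => exact hW p q r i

theorem abs_scaled_sub_le {v : ℝ} {c : ℤ} {e : ℕ} (h1 : (c : ℝ) - e ≤ 1099511627776 * v)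
    (h2 : 1099511627776 * v ≤ c + e) : |1099511627776 * v - c| ≤ e :=
  abs_le.2 ⟨by linarith, by linarith⟩

/-- The nested form of `k` terms of a ratio series, closed by `T`. -/
def nested (ρ : ℕ → ℝ) (x T : ℝ) : ℕ → ℕ → ℝ
  | 0, _ => T
  | k + 1, m => 1 + ρ m * x * nested ρ x T k (m + 1)

theorem nested_ratioSeries {ρ : ℕ → ℝ} {q x : ℝ} {m : ℕ} (h0 : ∀ j, m ≤ j → 0 ≤ ρ j)
    (h1 : ∀ j, m ≤ j → ρ j ≤ q) (hx : 0 ≤ x) (hq : q * x < 1) (k : ℕ) :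
    nested ρ x (ratioSeries ρ (m + k) x) k m = ratioSeries ρ m x := by
  induction k generalizing m with
  | zero => rfl
  | succ k ih =>
    have := ih (m := m + 1) (fun j hj => h0 j (by omega)) (fun j hj => h1 j (by omega))
    rw [show m + 1 + k = m + (k + 1) by ring] at this
    rw [nested, ratioSeries_eq h0 h1 hx hq, this]

theorem nested_mono {ρ : ℕ → ℝ} {x T T' : ℝ} {m : ℕ} (h0 : ∀ j, m ≤ j → 0 ≤ ρ j) (hx : 0 ≤ x)
    (hT : T ≤ T') (k : ℕ) : nested ρ x T k m ≤ nested ρ x T' k m := by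
  induction k generalizing m with
  | zero => exact hT
  | succ k ih =>
    have := ih (m := m + 1) fun j hj => h0 j (by omega)
    rw [nested, nested]
    have := mul_le_mul_of_nonneg_left this (mul_nonneg (h0 m le_rfl) hx)
    linarith

theorem nested_congr {ρ ρ' : ℕ → ℝ} {x T : ℝ} {m : ℕ} (h : ∀ j, m ≤ j → ρ j = ρ' j) (k : ℕ) :
    nested ρ x T k m = nested ρ' x T k m := by
  induction k generalizing m with
  | zero => rfl
  | succ k ih => rw [nested, nested, h m le_rfl, ih fun j hj => h j (by omega)]

namespace PolyExpr

/-- The nested form of a ratio series as an expression. -/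
def nest (ρ : ℕ → PolyExpr) (X T : PolyExpr) (k : ℕ) : ℕ → PolyExpr :=
  Nat.rec (fun _ => T) (fun _ ih m => add (rat 1 1) (mul (mul (ρ m) X) (ih (m + 1)))) k

theorem eval_nest (v₀ v₁ v₂ : ℝ) (w : List ℝ) (ρ : ℕ → PolyExpr) (X T : PolyExpr) (k m : ℕ) :
    eval v₀ v₁ v₂ (nest ρ X T k m) w =
      nested (fun j => eval v₀ v₁ v₂ (ρ j) w) (eval v₀ v₁ v₂ X w) (eval v₀ v₁ v₂ T w) k m := by
  induction k generalizing m with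
  | zero => rfl
  | succ k ih =>
    rw [nested, ← ih]
    show ((1 : ℤ) : ℝ) / ((1 : ℕ) : ℝ) + _ = _
    norm_num
    rfl

/-- `legendreRatio (p (1 - z) / 4) m`, with `z` the first variable. -/
def ratio (p : ℤ) (m : ℕ) : PolyExpr :=
  add (rat (4 * m * (m - 1) - p) (8 * m ^ 2)) (mul (rat p (8 * m ^ 2)) x)

/-- `legendreRatio' (p (1 - z) / 4) m`, with `z` the first variable. -/
def ratio' (p : ℤ) (m : ℕ) : PolyExpr :=
  add (rat (4 * m * (m - 1) - p) (8 * m * (m - 1))) (mul (rat p (8 * m * (m - 1))) x)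

theorem eval_ratio (v₀ v₁ v₂ : ℝ) (w : List ℝ) (p : ℤ) {m : ℕ} (hm : 2 ≤ m) :
    eval v₀ v₁ v₂ (ratio p m) w = legendreRatio (p * (1 - v₀) / 4) m := by
  have : (2 : ℝ) ≤ m := by exact_mod_cast hm
  simp only [ratio, eval, legendreRatio]
  push_cast
  field_simp
  ring

theorem eval_ratio' (v₀ v₁ v₂ : ℝ) (w : List ℝ) (p : ℤ) {m : ℕ} (hm : 2 ≤ m) :
    eval v₀ v₁ v₂ (ratio' p m) w = legendreRatio' (p * (1 - v₀) / 4) m := by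
  have h : (2 : ℝ) ≤ m := by exact_mod_cast hm
  have h' : (m : ℝ) - 1 ≠ 0 := by linarith
  simp only [ratio', eval, legendreRatio']
  push_cast [Nat.cast_sub (by omega : 1 ≤ m)]
  field_simp
  ring

theorem eval_nest_ratio (v₀ v₁ v₂ : ℝ) (w : List ℝ) (p : ℤ) (X T : PolyExpr) (k : ℕ) :
    eval v₀ v₁ v₂ (nest (ratio p) X T k 2) w =
      nested (legendreRatio (p * (1 - v₀) / 4)) (eval v₀ v₁ v₂ X w) (eval v₀ v₁ v₂ T w) k 2 := by
  rw [eval_nest]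
  exact nested_congr (fun j hj => eval_ratio _ _ _ _ _ hj) k

theorem eval_nest_ratio' (v₀ v₁ v₂ : ℝ) (w : List ℝ) (p : ℤ) (X T : PolyExpr) (k : ℕ) :
    eval v₀ v₁ v₂ (nest (ratio' p) X T k 2) w =
      nested (legendreRatio' (p * (1 - v₀) / 4)) (eval v₀ v₁ v₂ X w) (eval v₀ v₁ v₂ T w) k 2 := by
  rw [eval_nest]
  exact nested_congr (fun j hj => eval_ratio' _ _ _ _ _ hj) k

end PolyExpr

section

/-- `F` is a sum of its first terms and a bounded tail. -/
theorem exists_nested_legendreFn {β q : ℝ} (h1 : -1 ≤ β) (h2 : β ≤ 2) {t : ℝ} (ht : t ≤ 1)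
    (hq : 1 - t ≤ q) (hq2 : q < 2) (k : ℕ) : ∃ T : ℝ, 1 ≤ T ∧ T ≤ (1 - q / 2)⁻¹ ∧
      legendreFn β t = 1 - β / 2 * (1 - t) * nested (legendreRatio β) (1 - t) T k 2 := by
  have a0 : ∀ j, 2 ≤ j → 0 ≤ legendreRatio β j := fun j hj => legendreRatio_nonneg h2 hj
  have a1 : ∀ j, 2 ≤ j → legendreRatio β j ≤ 1 / 2 := fun j hj => legendreRatio_le h1 hj
  have hx : 0 ≤ 1 - t := by linarith
  have hq' : 1 / 2 * (1 - t) < 1 := by linarith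
  -- The tail is not estimated away but kept as an unknown real in an interval, so the identity for
  -- F stays exact and the tail can be handed to the box test as a parameter.
  refine ⟨ratioSeries (legendreRatio β) (2 + k) (1 - t),
    one_le_ratioSeries (fun j hj => a0 j (by omega)) (fun j hj => a1 j (by omega)) hx hq',
    (ratioSeries_le (fun j hj => a0 j (by omega)) (fun j hj => a1 j (by omega)) hx hq').trans ?_, ?_⟩
  · exact inv_anti₀ (by linarith) (by linarith)
  · rw [nested_ratioSeries a0 a1 hx hq', legendreFn_eq h1 h2 (by rw [abs_of_nonneg hx]; linarith)]

/-- `F'` is a sum of its first terms and a bounded tail. -/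
theorem exists_nested_legendreFn' {β q B : ℝ} (h1 : -(1 / 4) ≤ β) (h2 : β ≤ 2) {t : ℝ} (ht : t ≤ 1)
    (hq : 1 - t ≤ q) (hq2 : q ≤ 1.5) (k : ℕ)
    (hB : (1 - (1 / 2 + 1 / (8 * ((2 + k : ℝ) * (1 + k)))) * q)⁻¹ ≤ B) :
    ∃ T : ℝ, 1 ≤ T ∧ T ≤ B ∧
      legendreFn' β t = β / 2 * nested (legendreRatio' β) (1 - t) T k 2 := by
  have a0 : ∀ j, 2 ≤ j → 0 ≤ legendreRatio' β j := fun j hj => legendreRatio'_nonneg h2 hj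
  have a1 : ∀ j, 2 ≤ j → legendreRatio' β j ≤ 9 / 16 := fun j hj =>
    (legendreRatio'_le h1 le_rfl hj).trans (by norm_num)
  have a2 : ∀ j, 2 + k ≤ j → legendreRatio' β j ≤ 1 / 2 + 1 / (8 * ((2 + k : ℝ) * (1 + k))) :=
    fun j hj => (legendreRatio'_le h1 (by omega) hj).trans_eq (by push_cast; ring)
  have hx : 0 ≤ 1 - t := by linarith
  have hq' : 9 / 16 * (1 - t) < 1 := by linarith
  have hk : (1 / 2 + 1 / (8 * ((2 + k : ℝ) * (1 + k)))) ≤ 9 / 16 := by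
    have hk : (0 : ℝ) ≤ k := by positivity
    have : 1 / (8 * ((2 + k : ℝ) * (1 + k))) ≤ 1 / 16 := by
      apply one_div_le_one_div_of_le (by norm_num)
      nlinarith
    linarith
  have hq'' : (1 / 2 + 1 / (8 * ((2 + k : ℝ) * (1 + k)))) * (1 - t) < 1 :=
    (mul_le_mul_of_nonneg_right hk hx).trans_lt hq'
  refine ⟨ratioSeries (legendreRatio' β) (2 + k) (1 - t),
    one_le_ratioSeries (fun j hj => a0 j (by omega)) a2 hx hq'',
    (ratioSeries_le (fun j hj => a0 j (by omega)) a2 hx hq'').trans (le_trans ?_ hB), ?_⟩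
  · refine inv_anti₀ ?_ ?_
    · have := mul_le_mul_of_nonneg_right hk (hx.trans hq)
      linarith
    · gcongr
  · rw [nested_ratioSeries a0 a1 hx hq', legendreFn'_eq]

end

/-! ### Numerical facts -/

namespace PolyExpr

theorem eval_nest_two (v₀ v₁ v₂ : ℝ) (w : List ℝ) (X T : PolyExpr) (k : ℕ) :
    eval v₀ v₁ v₂ (nest (ratio 8) X T k 2) w =
      nested (legendreRatio (2 * (1 - v₀))) (eval v₀ v₁ v₂ X w) (eval v₀ v₁ v₂ T w) k 2 := by
  rw [eval_nest_ratio]; congr 2; push_cast; ring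

theorem eval_nest_two' (v₀ v₁ v₂ : ℝ) (w : List ℝ) (X T : PolyExpr) (k : ℕ) :
    eval v₀ v₁ v₂ (nest (ratio' 8) X T k 2) w =
      nested (legendreRatio' (2 * (1 - v₀))) (eval v₀ v₁ v₂ X w) (eval v₀ v₁ v₂ T w) k 2 := by
  rw [eval_nest_ratio']; congr 2; push_cast; ring

theorem eval_nest_quarter (v₀ v₁ v₂ : ℝ) (w : List ℝ) (X T : PolyExpr) (k : ℕ) :
    eval v₀ v₁ v₂ (nest (ratio (-1)) X T k 2) w =
      nested (legendreRatio (-(1 - v₀) / 4)) (eval v₀ v₁ v₂ X w) (eval v₀ v₁ v₂ T w) k 2 := by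
  rw [eval_nest_ratio]; congr 2; push_cast; ring

theorem eval_nest_quarter' (v₀ v₁ v₂ : ℝ) (w : List ℝ) (X T : PolyExpr) (k : ℕ) :
    eval v₀ v₁ v₂ (nest (ratio' (-1)) X T k 2) w =
      nested (legendreRatio' (-(1 - v₀) / 4)) (eval v₀ v₁ v₂ X w) (eval v₀ v₁ v₂ T w) k 2 := by
  rw [eval_nest_ratio']; congr 2; push_cast; ring

/-- `F(1 - X)` with `k` terms and tail `T`. -/
def fExpr (X T : PolyExpr) (k : ℕ) : PolyExpr :=
  rat 1 1 - (rat 1 1 - x) * X * nest (ratio 8) X T k 2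

/-- `g(1 - X)` with `k` terms and tail `T`. -/
def gExpr (X T : PolyExpr) (k : ℕ) : PolyExpr :=
  rat 1 1 + (rat 1 8 * (rat 1 1 - x)) * X * nest (ratio (-1)) X T k 2

/-- `F'(1 - X)` with `k` terms and tail `T`. -/
def fExpr' (X T : PolyExpr) (k : ℕ) : PolyExpr :=
  (rat 1 1 - x) * nest (ratio' 8) X T k 2

/-- `-g'(1 - X)` with `k` terms and tail `T`. -/
def gExpr' (X T : PolyExpr) (k : ℕ) : PolyExpr :=
  rat 1 8 * (rat 1 1 - x) * nest (ratio' (-1)) X T k 2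

/-- An affine approximation of `t_c`. -/
def zeroExpr : PolyExpr := -(rat 6664 10000 * x + rat 46 100 * (x * x))

/-- Here `par 0` is 1 - t for a point t one thousandth to the left of the approximate zero and `par
1` is the tail; the sign is reversed because F is negative there. -/
def leftZeroExpr : PolyExpr :=
  letIn (rat 1 1 - zeroExpr + rat 1 1000) (-fExpr (par 0) (par 1) 12)

def rightZeroExpr : PolyExpr :=
  letIn (rat 1 1 - zeroExpr - rat 1 1000) (fExpr (par 0) (par 1) 12)

/-- The second variable in [0, 1] moves t across the window of width 0.002 about the approximate
zero. In the last line the bindings are F'(t), 1 - t, t and the tail, latest first; the subtracted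
quadratic is k₀(z). -/
def slopeExpr : PolyExpr :=
  letIn (zeroExpr + rat 2 1000 * y - rat 1 1000) <|
  letIn (rat 1 1 - par 0) <| letIn (fExpr' (par 0) (par 2) 14) <|
  (rat 1 1 - par 2 * par 2) * (par 0 * par 0) -
    (rat 9996 10000 - rat 409 1000 * x + rat 18 100 * (x * x))

/-- The angle `T` below which `v` is shown to be positive where `w ≥ 0`. -/
def cutExpr : PolyExpr := rat (-44) 100 + rat 705 1000 * x

/-- At t = T the expression `fin` sees, latest first: F'g - Fg', -g', g, F', F, 1 - t, and then the
tails of F, F', g, g'. -/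
def crossExpr (fin : PolyExpr) : PolyExpr :=
  letIn (rat 1 1 - cutExpr) <| letIn (fExpr (par 0) (par 1) 24) <|
  letIn (fExpr' (par 1) (par 3) 24) <| letIn (gExpr (par 2) (par 5) 24) <|
  letIn (gExpr' (par 3) (par 7) 24) <| letIn (par 2 * par 1 + par 3 * par 0) fin

/-- `k₀ g² - (9u/4) F² g² - (1 - t²) (F' g - F g')²`. -/
def cutFluxExpr : PolyExpr :=
  crossExpr ((rat 9996 10000 - rat 409 1000 * x + rat 18 100 * (x * x)) * (par 2 * par 2) -
    rat 9 4 * (rat 1 1 - x) * (par 4 * par 4) * (par 2 * par 2) -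
    (par 5 * (rat 2 1 - par 5)) * (par 0 * par 0))

end PolyExpr

/-! ### The zero of F, its slope there, and the values at the cut angle T -/

section

variable {z : ℝ}

theorem abs_parameter_le (hz0 : 0 ≤ z) (hz1 : z ≤ 0.15605) :
    |1099511627776 * z - ((85800000000 : ℤ) : ℝ)| ≤ ((85800000000 : ℕ) : ℝ) := by
  apply abs_scaled_sub_le <;> push_cast <;> linarith

theorem abs_unit_le {v : ℝ} (h0 : 0 ≤ v) (h1 : v ≤ 1) :
    |1099511627776 * v - ((549755813888 : ℤ) : ℝ)| ≤ ((549755813888 : ℕ) : ℝ) := by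
  apply abs_scaled_sub_le <;> push_cast <;> linarith

theorem abs_zero_le : |1099511627776 * (0 : ℝ) - ((0 : ℤ) : ℝ)| ≤ ((0 : ℕ) : ℝ) := by simp

theorem eq_of_mem_singleton_exists {P : PolyExpr → Prop} {t : PolyExpr} (h : ∃ s ∈ [t], P s) :
    P t := by simpa using h

theorem or_of_mem_pair_exists {P : PolyExpr → Prop} {s t : PolyExpr} (h : ∃ r ∈ [s, t], P r) :
    P s ∨ P t := by simpa using h

/-- In units of 2⁻⁴⁰ the parameter is 1.65 ± 0.65, an enclosure of tails in [1, 2.3], and the first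
side is slightly longer than [0, 0.15605]. Zero widths switch off the unused variables. -/
theorem boxCheck_leftZero : boxCheck 1 1 1 [⟨1814194185830, 0, 0, 0, 714682558055⟩]
    [PolyExpr.leftZeroExpr] 20 85800000000 0 0 85800000000 0 0 = true := by
  decide +kernel

theorem boxCheck_rightZero : boxCheck 1 1 1 [⟨1814194185830, 0, 0, 0, 714682558055⟩]
    [PolyExpr.rightZeroExpr] 20 85800000000 0 0 85800000000 0 0 = true := by
  decide +kernel

theorem legendreFn_neg_of_left (hz0 : 0 ≤ z) (hz1 : z ≤ 0.15605) :
    legendreFn (2 * (1 - z)) (-(0.6664 * z + 0.46 * z ^ 2) - 0.001) < 0 := by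
  have hz2 : z ^ 2 ≤ 0.0244 := by nlinarith
  -- 1.12 bounds 1 - t over the whole range of z; the tail is then at most 1/(1 - 0.56) < 2.3.
  obtain ⟨T, hT1, hT2, hF⟩ := exists_nested_legendreFn (β := 2 * (1 - z)) (q := 1.12) (by linarith)
    (by linarith) (t := -(0.6664 * z + 0.46 * z ^ 2) - 0.001) (by nlinarith) (by linarith)
    (by norm_num) 12
  have hT3 : T ≤ 2.3 := hT2.trans (by norm_num)
  have h := eq_of_mem_singleton_exists (exists_pos_of_boxCheck
    (allEncl_nil.cons (v := T) 1814194185830 714682558055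
      (by apply abs_scaled_sub_le <;> push_cast <;> linarith)) (by decide +kernel) 20
    (abs_parameter_le hz0 hz1) abs_zero_le abs_zero_le boxCheck_leftZero)
  simp only [PolyExpr.leftZeroExpr, PolyExpr.zeroExpr, PolyExpr.fExpr, PolyExpr.eval_letIn,
    PolyExpr.eval_nest_two, PolyExpr.eval_add, PolyExpr.eval_sub, PolyExpr.eval_neg,
    PolyExpr.eval_mul, PolyExpr.eval_rat, PolyExpr.eval_x, PolyExpr.eval_par,
    List.getD_cons_zero, List.getD_cons_succ] at h
  rw [hF]
  convert neg_pos.1 h using 1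
  push_cast
  ring_nf

theorem legendreFn_pos_of_right (hz0 : 0 ≤ z) (hz1 : z ≤ 0.15605) :
    0 < legendreFn (2 * (1 - z)) (-(0.6664 * z + 0.46 * z ^ 2) + 0.001) := by
  have hz2 : z ^ 2 ≤ 0.0244 := by nlinarith
  obtain ⟨T, hT1, hT2, hF⟩ := exists_nested_legendreFn (β := 2 * (1 - z)) (q := 1.12) (by linarith)
    (by linarith) (t := -(0.6664 * z + 0.46 * z ^ 2) + 0.001) (by nlinarith) (by linarith)
    (by norm_num) 12
  have hT3 : T ≤ 2.3 := hT2.trans (by norm_num)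
  have h := eq_of_mem_singleton_exists (exists_pos_of_boxCheck
    (allEncl_nil.cons (v := T) 1814194185830 714682558055
      (by apply abs_scaled_sub_le <;> push_cast <;> linarith)) (by decide +kernel) 20
    (abs_parameter_le hz0 hz1) abs_zero_le abs_zero_le boxCheck_rightZero)
  simp only [PolyExpr.rightZeroExpr, PolyExpr.zeroExpr, PolyExpr.cutExpr, PolyExpr.fExpr,
    PolyExpr.fExpr', PolyExpr.gExpr, PolyExpr.gExpr',
    PolyExpr.eval_letIn, PolyExpr.eval_nest_two, PolyExpr.eval_nest_two',
    PolyExpr.eval_nest_quarter, PolyExpr.eval_nest_quarter', PolyExpr.eval_add,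
    PolyExpr.eval_sub, PolyExpr.eval_neg, PolyExpr.eval_mul, PolyExpr.eval_rat, PolyExpr.eval_x,
    PolyExpr.eval_y, PolyExpr.eval_z, PolyExpr.eval_par, List.getD_cons_zero,
    List.getD_cons_succ] at h
  rw [hF]
  convert h using 1
  push_cast
  ring_nf

/-- The weight 500 makes z the preferred side to bisect: the whole range of the second variable
moves t by only 0.002. -/
theorem boxCheck_slope : boxCheck 500 1 1 [⟨1814194185830, 0, 0, 0, 714682558055⟩]
    [PolyExpr.slopeExpr] 20 85800000000 549755813888 0 85800000000 549755813888 0 = true := by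
  decide +kernel

/-- A lower bound of `(1 - t²) F'²` near the zero of `F`. -/
theorem slope_lower_bound (hz0 : 0 ≤ z) (hz1 : z ≤ 0.15605) {t : ℝ}
    (ht1 : -(0.6664 * z + 0.46 * z ^ 2) - 0.001 ≤ t)
    (ht2 : t ≤ -(0.6664 * z + 0.46 * z ^ 2) + 0.001) :
    0.9996 - 0.409 * z + 0.18 * z ^ 2 < (1 - t ^ 2) * legendreFn' (2 * (1 - z)) t ^ 2 := by
  have hz2 : z ^ 2 ≤ 0.0244 := by nlinarith
  obtain ⟨T, hT1, hT2, hF⟩ := exists_nested_legendreFn' (β := 2 * (1 - z)) (q := 1.12) (B := 2.3)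
    (by linarith) (by linarith) (t := t) (by nlinarith) (by linarith)
    (by norm_num) 14 (by norm_num)
  set s : ℝ := (t + (0.6664 * z + 0.46 * z ^ 2) + 0.001) / 0.002 with hs
  have hts : t = -(0.6664 * z + 0.46 * z ^ 2) + 0.002 * s - 0.001 := by rw [hs]; ring
  have h := eq_of_mem_singleton_exists (exists_pos_of_boxCheck
    (allEncl_nil.cons (v := T) 1814194185830 714682558055
      (by apply abs_scaled_sub_le <;> push_cast <;> linarith)) (by decide +kernel) 20
    (abs_parameter_le hz0 hz1) (abs_unit_le (v := s) (by rw [hs]; apply div_nonneg <;> linarith)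
      (by rw [hs, div_le_one] <;> linarith)) abs_zero_le boxCheck_slope)
  simp only [PolyExpr.slopeExpr, PolyExpr.zeroExpr, PolyExpr.cutExpr, PolyExpr.fExpr,
    PolyExpr.fExpr', PolyExpr.gExpr, PolyExpr.gExpr',
    PolyExpr.eval_letIn, PolyExpr.eval_nest_two, PolyExpr.eval_nest_two',
    PolyExpr.eval_nest_quarter, PolyExpr.eval_nest_quarter', PolyExpr.eval_add,
    PolyExpr.eval_sub, PolyExpr.eval_neg, PolyExpr.eval_mul, PolyExpr.eval_rat, PolyExpr.eval_x,
    PolyExpr.eval_y, PolyExpr.eval_z, PolyExpr.eval_par, List.getD_cons_zero,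
    List.getD_cons_succ] at h
  push_cast at h
  have e1 : -(6664 / 10000 * z + 46 / 100 * (z * z)) + 2 / 1000 * s - 1 / 1000 = t := by
    rw [hts]; ring
  rw [e1, div_one] at h
  rw [hF]
  linarith

theorem boxCheck_cross : boxCheck 1 1 1
    [⟨2528876743885, 0, 0, 0, 1429365116109⟩, ⟨2528876743885, 0, 0, 0, 1429365116109⟩,
      ⟨2528876743885, 0, 0, 0, 1429365116109⟩, ⟨2528876743885, 0, 0, 0, 1429365116109⟩]
    [PolyExpr.crossExpr (PolyExpr.par 0)] 20 85800000000 0 0 85800000000 0 0 = true := by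
  decide +kernel

theorem boxCheck_cutFlux : boxCheck 1 1 1
    [⟨2528876743885, 0, 0, 0, 1429365116109⟩, ⟨2528876743885, 0, 0, 0, 1429365116109⟩,
      ⟨2528876743885, 0, 0, 0, 1429365116109⟩, ⟨2528876743885, 0, 0, 0, 1429365116109⟩]
    [PolyExpr.cutFluxExpr] 20 85800000000 0 0 85800000000 0 0 = true := by
  decide +kernel

/-- After multiplication by g² the second claim says that `energy` at the cut angle is below k₀(z).
The first is the starting value from which the Wronskian of F and g stays positive up to t_c. -/
theorem cut_bounds (hz0 : 0 ≤ z) (hz1 : z ≤ 0.15605) {t : ℝ} (ht : t = -0.44 + 0.705 * z) :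
    0 < legendreFn' (2 * (1 - z)) t * legendreFn (-(1 - z) / 4) t -
        legendreFn (2 * (1 - z)) t * legendreFn' (-(1 - z) / 4) t ∧
      9 / 4 * (1 - z) * legendreFn (2 * (1 - z)) t ^ 2 * legendreFn (-(1 - z) / 4) t ^ 2 +
        (1 - t ^ 2) * (legendreFn' (2 * (1 - z)) t * legendreFn (-(1 - z) / 4) t -
          legendreFn (2 * (1 - z)) t * legendreFn' (-(1 - z) / 4) t) ^ 2 <
      (0.9996 - 0.409 * z + 0.18 * z ^ 2) * legendreFn (-(1 - z) / 4) t ^ 2 := by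
  obtain ⟨T₁, a1, b1, hF⟩ := exists_nested_legendreFn (β := 2 * (1 - z)) (q := 1.44) (by linarith)
    (by linarith) (t := t) (by linarith) (by linarith) (by norm_num) 24
  obtain ⟨T₂, a2, b2, hF'⟩ := exists_nested_legendreFn' (β := 2 * (1 - z)) (q := 1.44) (B := 3.6)
    (by linarith) (by linarith) (t := t) (by linarith) (by linarith) (by norm_num) 24 (by norm_num)
  obtain ⟨T₃, a3, b3, hg⟩ := exists_nested_legendreFn (β := -(1 - z) / 4) (q := 1.44) (by linarith)
    (by linarith) (t := t) (by linarith) (by linarith) (by norm_num) 24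
  obtain ⟨T₄, a4, b4, hg'⟩ := exists_nested_legendreFn' (β := -(1 - z) / 4) (q := 1.44) (B := 3.6)
    (by linarith) (by linarith) (t := t) (by linarith) (by linarith) (by norm_num) 24 (by norm_num)
  have c1 : T₁ ≤ 3.6 := b1.trans (by norm_num)
  have c3 : T₃ ≤ 3.6 := b3.trans (by norm_num)
  have hall : AllEncl [⟨2528876743885, 0, 0, 0, 1429365116109⟩, ⟨2528876743885, 0, 0, 0, 1429365116109⟩,
      ⟨2528876743885, 0, 0, 0, 1429365116109⟩, ⟨2528876743885, 0, 0, 0, 1429365116109⟩] [T₁, T₂, T₃, T₄] :=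
    (((allEncl_nil.cons _ _ (by apply abs_scaled_sub_le <;> push_cast <;> linarith)).cons _ _
      (by apply abs_scaled_sub_le <;> push_cast <;> linarith)).cons _ _
      (by apply abs_scaled_sub_le <;> push_cast <;> linarith)).cons _ _
      (by apply abs_scaled_sub_le <;> push_cast <;> linarith)
  have e1 : 1 - (-44 / 100 + 705 / 1000 * z) = 1 - t := by rw [ht]; ring
  rw [hF, hF', hg, hg']
  constructor
  · have h := eq_of_mem_singleton_exists (exists_pos_of_boxCheck hall (by decide +kernel) 20
      (abs_parameter_le hz0 hz1) abs_zero_le abs_zero_le boxCheck_cross)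
    simp only [PolyExpr.crossExpr, PolyExpr.zeroExpr, PolyExpr.cutExpr, PolyExpr.fExpr,
      PolyExpr.fExpr', PolyExpr.gExpr, PolyExpr.gExpr',
      PolyExpr.eval_letIn, PolyExpr.eval_nest_two, PolyExpr.eval_nest_two',
      PolyExpr.eval_nest_quarter, PolyExpr.eval_nest_quarter', PolyExpr.eval_add,
      PolyExpr.eval_sub, PolyExpr.eval_neg, PolyExpr.eval_mul, PolyExpr.eval_rat, PolyExpr.eval_x,
      PolyExpr.eval_y, PolyExpr.eval_z, PolyExpr.eval_par, List.getD_cons_zero,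
      List.getD_cons_succ] at h
    push_cast at h
    rw [div_one, e1] at h
    refine h.trans_eq ?_
    ring
  · have h := eq_of_mem_singleton_exists (exists_pos_of_boxCheck hall (by decide +kernel) 20
      (abs_parameter_le hz0 hz1) abs_zero_le abs_zero_le boxCheck_cutFlux)
    simp only [PolyExpr.cutFluxExpr, PolyExpr.crossExpr, PolyExpr.zeroExpr, PolyExpr.cutExpr, PolyExpr.fExpr,
      PolyExpr.fExpr', PolyExpr.gExpr, PolyExpr.gExpr',
      PolyExpr.eval_letIn, PolyExpr.eval_nest_two, PolyExpr.eval_nest_two',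
      PolyExpr.eval_nest_quarter, PolyExpr.eval_nest_quarter', PolyExpr.eval_add,
      PolyExpr.eval_sub, PolyExpr.eval_neg, PolyExpr.eval_mul, PolyExpr.eval_rat, PolyExpr.eval_x,
      PolyExpr.eval_y, PolyExpr.eval_z, PolyExpr.eval_par, List.getD_cons_zero,
      List.getD_cons_succ] at h
    push_cast at h
    rw [div_one, e1] at h
    refine sub_pos.1 (h.trans_eq ?_)
    ring

end

/-! ### The function w: its sign on the unit sphere, and its comparison with v there and below the
cut angle -/

namespace PolyExpr

/-- The shape of `w` when `r ^ α_n = qₙ`. -/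
def wExpr (t q₁ q₂ q₃ : PolyExpr) : PolyExpr :=
  rat 235 1000 - rat 45 1000 * x + (rat 965 1000 + rat 66 1000 * x) * (q₁ * t) -
    rat 37 100 * x * (q₂ * (rat 3 2 * (t * t) - rat 1 2)) +
    rat 233 1000 * x * (q₃ * (t * (rat 5 2 * (t * t) - rat 3 2)))

/-- The shape of `w` when `r ^ α_n = qₙ`. -/
def _root_.ConeFB.profileSum (z t q₁ q₂ q₃ : ℝ) : ℝ :=
  0.235 - 0.045 * z + (0.965 + 0.066 * z) * (q₁ * t) - 0.37 * z * (q₂ * (3 / 2 * (t * t) - 1 / 2)) +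
    0.233 * z * (q₃ * (t * (5 / 2 * (t * t) - 3 / 2)))

theorem eval_wExpr (v₀ v₁ v₂ : ℝ) (w : List ℝ) (t q₁ q₂ q₃ : PolyExpr) :
    eval v₀ v₁ v₂ (wExpr t q₁ q₂ q₃) w = profileSum v₀ (eval v₀ v₁ v₂ t w)
      (eval v₀ v₁ v₂ q₁ w) (eval v₀ v₁ v₂ q₂ w) (eval v₀ v₁ v₂ q₃ w) := by
  simp only [wExpr, eval_add, eval_sub, eval_mul, eval_rat, eval_x, profileSum]
  norm_num

def epsExpr : PolyExpr := rat 17 100 - rat 3 10 * x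

/-- A lower bound of `α_n - n`. -/
def lowExpr : ℕ → PolyExpr
  | 1 => x * (rat 6666 10000 + rat 51 100 * x)
  | 2 => x * (rat 12 10 + rat 9 10 * x)
  | _ => x * (rat 17142 10000 + rat 129 100 * x)

/-- An upper bound of `α_n - n`. -/
def highExpr : ℕ → PolyExpr
  | 1 => x * (rat 6667 10000 + rat 6 10 * x)
  | 2 => x * (rat 12 10 + rat 106 100 * x)
  | _ => x * (rat 17143 10000 + rat 15 10 * x)

/-- On the unit sphere all powers of r are 1. In `fin`, `par 0` is w and `par 1` is t. -/
def unitExpr (t fin : PolyExpr) : PolyExpr :=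
  letIn t <| letIn (wExpr (par 0) (rat 1 1) (rat 1 1) (rat 1 1)) fin

def compareUnitExpr : PolyExpr :=
  unitExpr y <| letIn (rat 1 1 - par 1) <|
    par 1 - fExpr (par 0) (par 3) 7 - epsExpr * gExpr (par 0) (par 4) 7

/-- `w` at `r = y²`, for the parameters `θ₁, θ₂, θ₃` that locate the powers `r ^ α_n`. -/
def squareExpr (t fin : PolyExpr) : PolyExpr :=
  letIn (y * y) <| letIn (rat 1 1 - par 0) <|
  letIn (par 1 - y * par 0 * (lowExpr 1 * y + par 2 * (highExpr 1 - lowExpr 1 * y))) <|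
  letIn (par 2 * par 2 -
    par 2 * y * par 1 * (lowExpr 2 * y + par 4 * (highExpr 2 - lowExpr 2 * y))) <|
  letIn (par 3 * par 3 * par 3 -
    par 3 * par 3 * y * par 2 * (lowExpr 3 * y + par 6 * (highExpr 3 - lowExpr 3 * y))) <|
  letIn t <| letIn (wExpr (par 0) (par 3) (par 2) (par 1)) fin

/-- The third variable in [0, 1] moves t from T down to -0.85. -/
def middleExpr (fin : PolyExpr) : PolyExpr :=
  squareExpr (cutExpr - z * (rat 85 100 + cutExpr)) fin

/-- With r = y² and without the factor L this is a lower bound of √r (v - w) = εg + y³F - yw: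
multiplication by √r removes the negative power of r. F has its true tail, while g is truncated with
tail 1. Positivity gives v > w, hence v > 0 where w ≥ 0. -/
def middleSumExpr : PolyExpr :=
  middleExpr <| letIn (rat 1 1 - par 1) <|
    epsExpr * gExpr (par 0) (rat 1 1) 15 + y * par 7 * fExpr (par 0) (par 11) 15 - y * par 1

def axisExpr : PolyExpr := epsExpr - rat 66 100 * (y * y * y)

/-- Five nested terms closed by the tail 1 give the Taylor polynomial of degree 6 in 1 - t; here the
second variable stands for 1 - t. -/
def sumExpr : PolyExpr :=
  fExpr y (rat 1 1) 5 + rat 65 100 * gExpr y (rat 1 1) 5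

end PolyExpr

section

variable {z : ℝ}

/-- A lower bound of `α_n - n`. -/
def lowOff (z : ℝ) : ℕ → ℝ
  | 1 => z * (0.6666 + 0.51 * z)
  | 2 => z * (1.2 + 0.9 * z)
  | _ => z * (1.7142 + 1.29 * z)

/-- An upper bound of `α_n - n`. -/
def highOff (z : ℝ) : ℕ → ℝ
  | 1 => z * (0.6667 + 0.6 * z)
  | 2 => z * (1.2 + 1.06 * z)
  | _ => z * (1.7143 + 1.5 * z)

theorem boxCheck_unit_pos : boxCheck 1 1 1 [] [PolyExpr.unitExpr PolyExpr.y (PolyExpr.par 0)] 20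
    85800000000 439804651110 0 85800000000 659706976667 0 = true := by
  decide +kernel

theorem boxCheck_unit_neg : boxCheck 1 1 1 [] [PolyExpr.unitExpr PolyExpr.y (-PolyExpr.par 0)] 20
    85800000000 (-709184999915) 0 85800000000 390326627862 0 = true := by
  decide +kernel

theorem profileSum_pos (hz0 : 0 ≤ z) (hz1 : z ≤ 0.15605) {t : ℝ} (h0 : -0.2 ≤ t) (h1 : t ≤ 1) :
    0 < profileSum z t 1 1 1 := by
  have h := eq_of_mem_singleton_exists (exists_pos_of_boxCheck allEncl_nil (by decide +kernel) 20
    (abs_parameter_le hz0 hz1) (v₁ := t) (by apply abs_scaled_sub_le <;> push_cast <;> linarith)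
    abs_zero_le boxCheck_unit_pos)
  simp only [PolyExpr.unitExpr, PolyExpr.zeroExpr, PolyExpr.cutExpr, PolyExpr.fExpr,
    PolyExpr.fExpr', PolyExpr.gExpr, PolyExpr.gExpr', PolyExpr.epsExpr, PolyExpr.eval_wExpr,
    PolyExpr.lowExpr, PolyExpr.highExpr,
    PolyExpr.eval_letIn, PolyExpr.eval_nest_two, PolyExpr.eval_nest_two',
    PolyExpr.eval_nest_quarter, PolyExpr.eval_nest_quarter', PolyExpr.eval_add,
    PolyExpr.eval_sub, PolyExpr.eval_neg, PolyExpr.eval_mul, PolyExpr.eval_rat, PolyExpr.eval_x,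
    PolyExpr.eval_y, PolyExpr.eval_z, PolyExpr.eval_par, List.getD_cons_zero,
    List.getD_cons_succ] at h
  push_cast at h
  simpa using h

theorem profileSum_neg (hz0 : 0 ≤ z) (hz1 : z ≤ 0.15605) {t : ℝ} (h0 : -1 ≤ t) (h1 : t ≤ -0.29) :
    profileSum z t 1 1 1 < 0 := by
  have h := eq_of_mem_singleton_exists (exists_pos_of_boxCheck allEncl_nil (by decide +kernel) 20
    (abs_parameter_le hz0 hz1) (v₁ := t) (by apply abs_scaled_sub_le <;> push_cast <;> linarith)
    abs_zero_le boxCheck_unit_neg)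
  simp only [PolyExpr.unitExpr, PolyExpr.zeroExpr, PolyExpr.cutExpr, PolyExpr.fExpr,
    PolyExpr.fExpr', PolyExpr.gExpr, PolyExpr.gExpr', PolyExpr.epsExpr, PolyExpr.eval_wExpr,
    PolyExpr.lowExpr, PolyExpr.highExpr,
    PolyExpr.eval_letIn, PolyExpr.eval_nest_two, PolyExpr.eval_nest_two',
    PolyExpr.eval_nest_quarter, PolyExpr.eval_nest_quarter', PolyExpr.eval_add,
    PolyExpr.eval_sub, PolyExpr.eval_neg, PolyExpr.eval_mul, PolyExpr.eval_rat, PolyExpr.eval_x,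
    PolyExpr.eval_y, PolyExpr.eval_z, PolyExpr.eval_par, List.getD_cons_zero,
    List.getD_cons_succ] at h
  push_cast at h
  simpa using h

theorem boxCheck_compareUnit : boxCheck 1 1 1
    [⟨2100067209052, 0, 0, 0, 1000555581280⟩, ⟨2100067209052, 0, 0, 0, 1000555581280⟩]
    [PolyExpr.unitExpr PolyExpr.y (-PolyExpr.par 0), PolyExpr.compareUnitExpr] 20
    85800000000 390326627860 0 85800000000 709184999917 0 = true := by
  decide +kernel

/-- On the unit sphere `v < w` where `w ≥ 0`. -/
theorem lt_profileSum (hz0 : 0 ≤ z) (hz1 : z ≤ 0.15605) {t : ℝ} (h0 : -1 < t) (h1 : t ≤ 1)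
    (hw : 0 ≤ profileSum z t 1 1 1) :
    legendreFn (2 * (1 - z)) t + (0.17 - 0.3 * z) * legendreFn (-(1 - z) / 4) t <
      profileSum z t 1 1 1 := by
  have ht : -0.29 < t := by
    by_contra! hc
    exact absurd (profileSum_neg hz0 hz1 h0.le hc) (not_lt.2 hw)
  obtain ⟨T₁, a1, b1, hF⟩ := exists_nested_legendreFn (β := 2 * (1 - z)) (q := 1.29) (by linarith)
    (by linarith) (t := t) (by linarith) (by linarith) (by norm_num) 7
  obtain ⟨T₂, a2, b2, hg⟩ := exists_nested_legendreFn (β := -(1 - z) / 4) (q := 1.29) (by linarith)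
    (by linarith) (t := t) (by linarith) (by linarith) (by norm_num) 7
  have c1 : T₁ ≤ 2.82 := b1.trans (by norm_num)
  have c2 : T₂ ≤ 2.82 := b2.trans (by norm_num)
  have h := or_of_mem_pair_exists (exists_pos_of_boxCheck
    ((allEncl_nil.cons (v := T₂) _ _ (by apply abs_scaled_sub_le <;> push_cast <;> linarith)).cons
      (v := T₁) _ _ (by apply abs_scaled_sub_le <;> push_cast <;> linarith))
    (by decide +kernel) 20
    (abs_parameter_le hz0 hz1) (v₁ := t) (by apply abs_scaled_sub_le <;> push_cast <;> linarith)
    abs_zero_le boxCheck_compareUnit)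
  simp only [PolyExpr.unitExpr, PolyExpr.compareUnitExpr, PolyExpr.zeroExpr, PolyExpr.cutExpr, PolyExpr.fExpr,
    PolyExpr.fExpr', PolyExpr.gExpr, PolyExpr.gExpr', PolyExpr.epsExpr, PolyExpr.eval_wExpr,
    PolyExpr.lowExpr, PolyExpr.highExpr,
    PolyExpr.eval_letIn, PolyExpr.eval_nest_two, PolyExpr.eval_nest_two',
    PolyExpr.eval_nest_quarter, PolyExpr.eval_nest_quarter', PolyExpr.eval_add,
    PolyExpr.eval_sub, PolyExpr.eval_neg, PolyExpr.eval_mul, PolyExpr.eval_rat, PolyExpr.eval_x,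
    PolyExpr.eval_y, PolyExpr.eval_z, PolyExpr.eval_par, List.getD_cons_zero,
    List.getD_cons_succ] at h
  push_cast at h
  simp only [div_one] at h
  rcases h with h | h
  · linarith
  · rw [hF, hg]
    refine sub_pos.1 (h.trans_eq ?_)
    ring

/-- Turns a two-sided bound of a quantity that is not polynomial into an exact identity with a
parameter in [0, 1], which the box test can enclose. -/
theorem exists_convex {A D l h q : ℝ} (h1 : A - D * h ≤ q) (h2 : q ≤ A - D * l) :
    ∃ θ : ℝ, 0 ≤ θ ∧ θ ≤ 1 ∧ q = A - D * (l + θ * (h - l)) := by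
  have h3 : 0 ≤ D * (h - l) := by linarith
  rcases h3.eq_or_lt with h4 | h4
  · exact ⟨0, le_rfl, zero_le_one, by linarith⟩
  · refine ⟨(A - D * l - q) / (D * (h - l)), div_nonneg (by linarith) h4.le,
      (div_le_one h4).2 (by linarith), ?_⟩
    have : D * ((A - D * l - q) / (D * (h - l)) * (h - l)) = A - D * l - q := by
      rw [mul_left_comm, div_mul_cancel₀ _ h4.ne']
    rw [mul_add, this]
    ring

/-- Bounds of `r ^ α_n` for `r = y²`. -/
def PowerBounds (z y q₁ q₂ q₃ : ℝ) : Prop :=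
  (y * y - y * (1 - y * y) * highOff z 1 ≤ q₁ ∧
    q₁ ≤ y * y - y * (1 - y * y) * (lowOff z 1 * y)) ∧
  (y * y * (y * y) - y * y * y * (1 - y * y) * highOff z 2 ≤ q₂ ∧
    q₂ ≤ y * y * (y * y) - y * y * y * (1 - y * y) * (lowOff z 2 * y)) ∧
  (y * y * (y * y) * (y * y) - y * y * (y * y) * y * (1 - y * y) * highOff z 3 ≤ q₃ ∧
    q₃ ≤ y * y * (y * y) * (y * y) - y * y * (y * y) * y * (1 - y * y) * (lowOff z 3 * y))

/-- The alternatives are w < 0 and √r (v - w) > 0, for y ∈ [0.3, 1]. The last parameter, in [1,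
13.4], is the tail of F: for t ≥ -0.85 it is at most 1/(1 - 0.925). -/
theorem boxCheck_middle : boxCheck 10 10 5
    [⟨549755813888, 0, 0, 0, 549755813888⟩, ⟨549755813888, 0, 0, 0, 549755813888⟩,
      ⟨549755813888, 0, 0, 0, 549755813888⟩, ⟨7916483719987, 0, 0, 0, 6816972092213⟩]
    [PolyExpr.middleExpr (-PolyExpr.par 0), PolyExpr.middleSumExpr] 24
    85800000000 714682558054 549755813888 85800000000 384829069723 549755813888 = true := by
  decide +kernel

/-- Below the angle `T` the function `v` is positive where `w ≥ 0`, away from the ray. -/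
theorem middle_pos (hz0 : 0 ≤ z) (hz1 : z ≤ 0.15605) {y t q₁ q₂ q₃ : ℝ} (hy0 : 0.3 ≤ y)
    (hy1 : y ≤ 1) (ht0 : -0.85 ≤ t) (ht1 : t ≤ -0.44 + 0.705 * z)
    (hq : PowerBounds z y q₁ q₂ q₃) (hw : 0 ≤ profileSum z t q₁ q₂ q₃) :
    0 < (0.17 - 0.3 * z) * legendreFn (-(1 - z) / 4) t +
      y ^ 3 * legendreFn (2 * (1 - z)) t := by
  obtain ⟨T₁, a1, b1, hF⟩ := exists_nested_legendreFn (β := 2 * (1 - z)) (q := 1.85) (by linarith)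
    (by linarith) (t := t) (by linarith) (by linarith) (by norm_num) 15
  obtain ⟨T₂, a2, b2, hg⟩ := exists_nested_legendreFn (β := -(1 - z) / 4) (q := 1.85) (by linarith)
    (by linarith) (t := t) (by linarith) (by linarith) (by norm_num) 15
  have c1 : T₁ ≤ 13.4 := b1.trans (by norm_num)
  obtain ⟨⟨f1, f2⟩, ⟨f3, f4⟩, f5, f6⟩ := hq
  obtain ⟨θ₁, g1, g2, e1⟩ := exists_convex f1 f2
  obtain ⟨θ₂, g3, g4, e2⟩ := exists_convex f3 f4
  obtain ⟨θ₃, g5, g6, e3⟩ := exists_convex f5 f6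
  have hd : 0 < 0.85 + (-0.44 + 0.705 * z) := by linarith
  set s : ℝ := (-0.44 + 0.705 * z - t) / (0.85 + (-0.44 + 0.705 * z)) with hs
  have hst : s * (0.85 + (-0.44 + 0.705 * z)) = -0.44 + 0.705 * z - t := div_mul_cancel₀ _ hd.ne'
  have h := or_of_mem_pair_exists (exists_pos_of_boxCheck
    ((((allEncl_nil.cons (v := T₁) _ _
      (by apply abs_scaled_sub_le <;> push_cast <;> linarith)).cons _ _
      (abs_unit_le g5 g6)).cons _ _ (abs_unit_le g3 g4)).cons _ _ (abs_unit_le g1 g2))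
    (by decide +kernel) 24
    (abs_parameter_le hz0 hz1) (v₁ := y) (by apply abs_scaled_sub_le <;> push_cast <;> linarith)
    (abs_unit_le (v := s) (div_nonneg (by linarith) hd.le) ((div_le_one hd).2 (by linarith)))
    boxCheck_middle)
  simp only [PolyExpr.middleExpr, PolyExpr.middleSumExpr, PolyExpr.squareExpr, PolyExpr.zeroExpr, PolyExpr.cutExpr, PolyExpr.fExpr,
    PolyExpr.fExpr', PolyExpr.gExpr, PolyExpr.gExpr', PolyExpr.epsExpr, PolyExpr.eval_wExpr,
    PolyExpr.lowExpr, PolyExpr.highExpr,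
    PolyExpr.eval_letIn, PolyExpr.eval_nest_two, PolyExpr.eval_nest_two',
    PolyExpr.eval_nest_quarter, PolyExpr.eval_nest_quarter', PolyExpr.eval_add,
    PolyExpr.eval_sub, PolyExpr.eval_neg, PolyExpr.eval_mul, PolyExpr.eval_rat, PolyExpr.eval_x,
    PolyExpr.eval_y, PolyExpr.eval_z, PolyExpr.eval_par, List.getD_cons_zero,
    List.getD_cons_succ] at h
  push_cast at h
  simp only [div_one] at h
  have E0 : -44 / 100 + 705 / 1000 * z - s * (85 / 100 + (-44 / 100 + 705 / 1000 * z)) = t := by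
    linarith
  have E1 : y * y - y * (1 - y * y) * (z * (6666 / 10000 + 51 / 100 * z) * y +
      θ₁ * (z * (6667 / 10000 + 6 / 10 * z) - z * (6666 / 10000 + 51 / 100 * z) * y)) = q₁ := by
    rw [e1]; norm_num [lowOff, highOff]
  have E2 : y * y * (y * y) - y * y * y * (1 - y * y) * (z * (12 / 10 + 9 / 10 * z) * y +
      θ₂ * (z * (12 / 10 + 106 / 100 * z) - z * (12 / 10 + 9 / 10 * z) * y)) = q₂ := by
    rw [e2]; norm_num [lowOff, highOff]
  have E3 : y * y * (y * y) * (y * y) - y * y * (y * y) * y * (1 - y * y) *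
      (z * (17142 / 10000 + 129 / 100 * z) * y + θ₃ * (z * (17143 / 10000 + 15 / 10 * z) -
        z * (17142 / 10000 + 129 / 100 * z) * y)) = q₃ := by
    rw [e3]; norm_num [lowOff, highOff]
  rw [E0, E1, E2, E3] at h
  rcases h with h | h
  · linarith
  -- Replacing the tail of g by 1 only lowers g, because all ratios and the factor in front are
  -- nonnegative.
  · have hm := nested_mono (ρ := legendreRatio (-(1 - z) / 4)) (x := 1 - t)
      (fun j hj => legendreRatio_nonneg (by linarith) hj) (by linarith) a2 15 (m := 2)
    have hm2 := mul_le_mul_of_nonneg_left hm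
      (mul_nonneg (by linarith : 0 ≤ (1 - z) / 8) (by linarith : 0 ≤ 1 - t))
    have hm3 := mul_le_mul_of_nonneg_left hm2 (by linarith : 0 ≤ 0.17 - 0.3 * z)
    have hyw := mul_nonneg (by linarith : 0 ≤ y) hw
    rw [hF, hg]
    have : y ^ 3 = y * (y * y) := by ring
    rw [this]
    linarith

theorem boxCheck_axis : boxCheck 10 10 5
    [⟨549755813888, 0, 0, 0, 549755813888⟩, ⟨549755813888, 0, 0, 0, 549755813888⟩,
      ⟨549755813888, 0, 0, 0, 549755813888⟩]
    [PolyExpr.squareExpr PolyExpr.z (-PolyExpr.par 0), PolyExpr.axisExpr] 24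
    85800000000 549755813888 (-1017048255692) 85800000000 549755813888 82463372085 = true := by
  decide +kernel

theorem axis_bound (hz0 : 0 ≤ z) (hz1 : z ≤ 0.15605) {y t q₁ q₂ q₃ : ℝ} (hy0 : 0 ≤ y)
    (hy1 : y ≤ 1) (ht0 : -1 ≤ t) (ht1 : t ≤ -0.85)
    (hq : PowerBounds z y q₁ q₂ q₃) (hw : 0 ≤ profileSum z t q₁ q₂ q₃) :
    0.66 * y ^ 3 < 0.17 - 0.3 * z := by
  obtain ⟨⟨f1, f2⟩, ⟨f3, f4⟩, f5, f6⟩ := hq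
  obtain ⟨θ₁, g1, g2, e1⟩ := exists_convex f1 f2
  obtain ⟨θ₂, g3, g4, e2⟩ := exists_convex f3 f4
  obtain ⟨θ₃, g5, g6, e3⟩ := exists_convex f5 f6
  have h := or_of_mem_pair_exists (exists_pos_of_boxCheck
    (((allEncl_nil.cons _ _
      (abs_unit_le g5 g6)).cons _ _ (abs_unit_le g3 g4)).cons _ _ (abs_unit_le g1 g2))
    (by decide +kernel) 24
    (abs_parameter_le hz0 hz1) (abs_unit_le hy0 hy1) (v₂ := t)
    (by apply abs_scaled_sub_le <;> push_cast <;> linarith)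
    boxCheck_axis)
  simp only [PolyExpr.axisExpr, PolyExpr.squareExpr, PolyExpr.zeroExpr, PolyExpr.cutExpr, PolyExpr.fExpr,
    PolyExpr.fExpr', PolyExpr.gExpr, PolyExpr.gExpr', PolyExpr.epsExpr, PolyExpr.eval_wExpr,
    PolyExpr.lowExpr, PolyExpr.highExpr,
    PolyExpr.eval_letIn, PolyExpr.eval_nest_two, PolyExpr.eval_nest_two',
    PolyExpr.eval_nest_quarter, PolyExpr.eval_nest_quarter', PolyExpr.eval_add,
    PolyExpr.eval_sub, PolyExpr.eval_neg, PolyExpr.eval_mul, PolyExpr.eval_rat, PolyExpr.eval_x,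
    PolyExpr.eval_y, PolyExpr.eval_z, PolyExpr.eval_par, List.getD_cons_zero,
    List.getD_cons_succ] at h
  push_cast at h
  simp only [div_one] at h
  have E1 : y * y - y * (1 - y * y) * (z * (6666 / 10000 + 51 / 100 * z) * y +
      θ₁ * (z * (6667 / 10000 + 6 / 10 * z) - z * (6666 / 10000 + 51 / 100 * z) * y)) = q₁ := by
    rw [e1]; norm_num [lowOff, highOff]
  have E2 : y * y * (y * y) - y * y * y * (1 - y * y) * (z * (12 / 10 + 9 / 10 * z) * y +
      θ₂ * (z * (12 / 10 + 106 / 100 * z) - z * (12 / 10 + 9 / 10 * z) * y)) = q₂ := by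
    rw [e2]; norm_num [lowOff, highOff]
  have E3 : y * y * (y * y) * (y * y) - y * y * (y * y) * y * (1 - y * y) *
      (z * (17142 / 10000 + 129 / 100 * z) * y + θ₃ * (z * (17143 / 10000 + 15 / 10 * z) -
        z * (17142 / 10000 + 129 / 100 * z) * y)) = q₃ := by
    rw [e3]; norm_num [lowOff, highOff]
  rw [E1, E2, E3] at h
  rcases h with h | h
  · linarith
  · have : y ^ 3 = y * y * y := by ring
    rw [this]
    linarith

end

/-! ### The gradient of w on its zero set -/

namespace PolyExpr

/-- `w` in the variables `z`, `ρ = r ^ α₁`, `X = ρ t`. The parameters locate `ρ ^ (2 - δ₂)`,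
`ρ ^ (3 - δ₃)` and the exponents. -/
def waveExpr (fin : PolyExpr) : PolyExpr :=
  letIn (x * (rat 1 1 - y)) <|
  letIn (rat (-37) 100 * x * (rat 1 1 + rat 7 10 * (par 0 * par 1))) <|
  letIn (rat 233 1000 * x * (rat 1 1 + rat 15 10 * (par 1 * par 3))) <|
  letIn (y * y) <| letIn (z * z) <| letIn (rat 965 1000 + rat 66 1000 * x) <|
  letIn (par 0 * z) <|
  letIn (par 5 * (rat 3 2 * par 2 - rat 1 2 * par 3)) <|
  letIn (par 5 * (z * (rat 5 2 * par 3 - rat 3 2 * par 4))) <|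
  letIn (rat 235 1000 - rat 45 1000 * x + par 2 + par 1 + par 0) fin

/-- `k₀ ρ² - ρ ^ γ ((1 - z) S² + (ρ² - X²) T²)`. -/
def waveGradExpr : PolyExpr :=
  letIn ((rat 1 1 + lowExpr 1 + par 12 * (highExpr 1 - lowExpr 1)) * par 3 +
    (rat 2 1 + lowExpr 2 + par 13 * (highExpr 2 - lowExpr 2)) * par 2 +
    (rat 3 1 + lowExpr 3 + par 14 * (highExpr 3 - lowExpr 3)) * par 1) <|
  letIn (par 5 + par 9 * (rat 3 1 * z) + par 8 * (rat 15 2 * par 6 - rat 3 2 * par 7)) <|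
  (rat 9996 10000 - rat 409 1000 * x + rat 18 100 * (x * x)) * par 8 -
    (rat 1 1 - (rat 1333 1000 + rat 14 100 * x) * par 11 -
      rat 39 100 * ((rat 1333 1000 + rat 14 100 * x) * par 11 * (rat 1 1 - y))) *
    ((rat 1 1 - x) * (par 1 * par 1) + (par 8 - par 7) * (par 0 * par 0))

end PolyExpr

section

variable {z : ℝ}

/-- The alternatives are w > 0, w < 0, |X| > ρ, and the gradient bound. So only zeros of w with |X|
≤ ρ count, although the box is ρ ∈ [0.2, 1], X ∈ [-1, 1]. The variable X = ρt is suitable because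
each ρⁿPₙ(t) is a polynomial in ρ² and X. -/
theorem boxCheck_wave : boxCheck 2 2 3 [⟨549755813888, 0, 0, 0, 549755813888⟩,
      ⟨549755813888, 0, 0, 0, 549755813888⟩, ⟨549755813888, 0, 0, 0, 549755813888⟩,
      ⟨549755813888, 0, 0, 0, 549755813888⟩, ⟨549755813888, 0, 0, 0, 549755813888⟩]
    [PolyExpr.waveExpr (PolyExpr.par 0), PolyExpr.waveExpr (-PolyExpr.par 0),
      PolyExpr.z * PolyExpr.z - PolyExpr.y * PolyExpr.y, PolyExpr.waveExpr PolyExpr.waveGradExpr] 24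
    85800000000 659706976666 0 85800000000 439804651111 1099511627776 = true := by
  decide +kernel

theorem exists_of_four {P : PolyExpr → Prop} {s t q r : PolyExpr} (h : ∃ a ∈ [s, t, q, r], P a) :
    P s ∨ P t ∨ P q ∨ P r := by simpa using h

theorem exists_unit {a D q : ℝ} (h1 : a ≤ q) (h2 : q ≤ a + D) :
    ∃ θ : ℝ, 0 ≤ θ ∧ θ ≤ 1 ∧ q = a + D * θ := by
  obtain ⟨θ, h3, h4, h5⟩ := exists_convex (A := -a) (D := 1) (l := 0) (h := D) (q := -q)
    (by linarith) (by linarith)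
  exact ⟨θ, h3, h4, by linarith⟩

/-- The factors e₂ and e₃ measure how far r^{α₂} and r^{α₃} are from ρ² and ρ³, where ρ = r^{α₁}.
The prefactor on the left is an upper bound of ρ²/r², which turns the bound by ρ² into one by r². -/
theorem wave_grad_lt_of_scaled (hz0 : 0 ≤ z) (hz1 : z ≤ 0.15605) {ρ t e₂ e₃ α₁ α₂ α₃ : ℝ} (hρ0 : 0.2 ≤ ρ)
    (hρ1 : ρ ≤ 1) (ht0 : -1 ≤ t) (ht1 : t ≤ 1)
    (h20 : 1 ≤ e₂) (h21 : e₂ ≤ 1 + 0.7 * (z * (1 - ρ)))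
    (h30 : 1 ≤ e₃) (h31 : e₃ ≤ 1 + 1.5 * (z * (1 - ρ)))
    (ha1 : 1 + lowOff z 1 ≤ α₁) (hb1 : α₁ ≤ 1 + highOff z 1)
    (ha2 : 2 + lowOff z 2 ≤ α₂) (hb2 : α₂ ≤ 2 + highOff z 2)
    (ha3 : 3 + lowOff z 3 ≤ α₃) (hb3 : α₃ ≤ 3 + highOff z 3)
    (hw : profileSum z t ρ (ρ ^ 2 * e₂) (ρ ^ 3 * e₃) = 0) :
    (1 - (1.333 + 0.14 * z) * z * ((1 - ρ) + 0.39 * (1 - ρ) ^ 2)) *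
      ((1 - z) * ((0.965 + 0.066 * z) * (α₁ * (ρ * t)) -
          0.37 * z * (α₂ * (ρ ^ 2 * e₂ * (3 / 2 * (t * t) - 1 / 2))) +
          0.233 * z * (α₃ * (ρ ^ 3 * e₃ * (t * (5 / 2 * (t * t) - 3 / 2))))) ^ 2 +
        (1 - t ^ 2) * ((0.965 + 0.066 * z) * ρ - 0.37 * z * (ρ ^ 2 * e₂ * (3 * t)) +
          0.233 * z * (ρ ^ 3 * e₃ * (15 / 2 * (t * t) - 3 / 2))) ^ 2) <
      (0.9996 - 0.409 * z + 0.18 * z ^ 2) * ρ ^ 2 := by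
  obtain ⟨θ₂, g1, g2, f1⟩ := exists_unit h20 h21
  obtain ⟨θ₃, g3, g4, f2⟩ := exists_unit h30 h31
  obtain ⟨φ₁, g5, g6, f3⟩ := exists_unit ha1 (hb1.trans_eq
    (by ring : _ = 1 + lowOff z 1 + (highOff z 1 - lowOff z 1)))
  obtain ⟨φ₂, g7, g8, f4⟩ := exists_unit ha2 (hb2.trans_eq
    (by ring : _ = 2 + lowOff z 2 + (highOff z 2 - lowOff z 2)))
  obtain ⟨φ₃, g9, g10, f5⟩ := exists_unit ha3 (hb3.trans_eq
    (by ring : _ = 3 + lowOff z 3 + (highOff z 3 - lowOff z 3)))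
  have hX : |ρ * t| ≤ 1 := by
    rw [abs_mul, abs_of_nonneg (by linarith : 0 ≤ ρ)]
    exact mul_le_one₀ hρ1 (abs_nonneg _) (abs_le.2 ⟨ht0, ht1⟩)
  have hX := abs_le.1 hX
  have h := exists_of_four (exists_pos_of_boxCheck
    (((((allEncl_nil.cons _ _ (abs_unit_le g9 g10)).cons _ _ (abs_unit_le g7 g8)).cons _ _
      (abs_unit_le g5 g6)).cons _ _ (abs_unit_le g3 g4)).cons _ _ (abs_unit_le g1 g2))
    (by decide +kernel) 24
    (abs_parameter_le hz0 hz1) (v₁ := ρ) (by apply abs_scaled_sub_le <;> push_cast <;> linarith)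
    (v₂ := ρ * t) (by apply abs_scaled_sub_le <;> push_cast <;> linarith)
    boxCheck_wave)
  simp only [PolyExpr.waveExpr, PolyExpr.waveGradExpr,
    PolyExpr.lowExpr, PolyExpr.highExpr,
    PolyExpr.eval_letIn, PolyExpr.eval_add,
    PolyExpr.eval_sub, PolyExpr.eval_neg, PolyExpr.eval_mul, PolyExpr.eval_rat, PolyExpr.eval_x,
    PolyExpr.eval_y, PolyExpr.eval_z, PolyExpr.eval_par, List.getD_cons_zero,
    List.getD_cons_succ] at h
  push_cast at h
  simp only [div_one] at h
  have E2 : 1 + 7 / 10 * (z * (1 - ρ) * θ₂) = e₂ := by rw [f1]; ring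
  have E3 : 1 + 15 / 10 * (z * (1 - ρ) * θ₃) = e₃ := by rw [f2]; ring
  have A1 : 1 + z * (6666 / 10000 + 51 / 100 * z) + φ₁ * (z * (6667 / 10000 + 6 / 10 * z) -
      z * (6666 / 10000 + 51 / 100 * z)) = α₁ := by rw [f3]; norm_num [lowOff, highOff]; ring
  have A2 : 2 + z * (12 / 10 + 9 / 10 * z) + φ₂ * (z * (12 / 10 + 106 / 100 * z) -
      z * (12 / 10 + 9 / 10 * z)) = α₂ := by rw [f4]; norm_num [lowOff, highOff]; ring
  have A3 : 3 + z * (17142 / 10000 + 129 / 100 * z) + φ₃ * (z * (17143 / 10000 + 15 / 10 * z) -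
      z * (17142 / 10000 + 129 / 100 * z)) = α₃ := by rw [f5]; norm_num [lowOff, highOff]; ring
  rw [E2, E3, A1, A2, A3] at h
  clear E2 E3 A1 A2 A3 f1 f2 f3 f4 f5
  unfold profileSum at hw
  rcases h with h | h | h | h
  · exact absurd h (not_lt.2 (le_of_eq (by linear_combination hw)))
  · exact absurd h (not_lt.2 (le_of_eq (by linear_combination -hw)))
  · exact absurd h (not_lt.2 (by
      nlinarith [mul_nonneg (sq_nonneg ρ) (by nlinarith : 0 ≤ 1 - t ^ 2)]))
  · refine sub_pos.1 (h.trans_eq ?_)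
    ring

end

/-! ### Positivity of `F + 0.65 g` -/

theorem nested_one_eq_sum (ρ : ℕ → ℝ) (x : ℝ) (k m : ℕ) : nested ρ x 1 k m =
    ∑ j ∈ Finset.range (k + 1), (∏ i ∈ Finset.range j, ρ (m + i)) * x ^ j := by
  induction k generalizing m with
  | zero => simp [nested]
  | succ k ih =>
    rw [nested, ih, Finset.sum_range_succ' _ (k + 1), Finset.mul_sum, add_comm]
    simp only [Finset.range_zero, Finset.prod_empty, pow_zero, mul_one]
    congr 1
    refine Finset.sum_congr rfl fun j _ => ?_
    rw [Finset.prod_range_succ', pow_succ, add_zero,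
      Finset.prod_congr rfl fun i _ => by rw [show m + 1 + i = m + (i + 1) by ring]]
    ring

theorem sum_legendreCoeff_eq (β x : ℝ) (k : ℕ) :
    ∑ n ∈ Finset.range (k + 2), legendreCoeff β n * x ^ n =
      1 - β / 2 * x * nested (legendreRatio β) x 1 k 2 := by
  rw [Finset.sum_range_succ', nested_one_eq_sum, Finset.mul_sum, add_comm, sub_eq_add_neg,
    ← Finset.sum_neg_distrib]
  congr 1
  · simp [legendreCoeff]
  · refine Finset.sum_congr rfl fun j _ => ?_
    rw [legendreCoeff_eq_prod]
    ring

section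

variable {z : ℝ}

/-- This makes the coefficients of F + 0.65 g nonnegative from degree 6 on. The ratios decrease in
β, so those of g dominate and the inequality propagates from j = 5. There monotonicity in β reduces
it to fixed parameters, 1.6879 = 2(1 - 0.15605) and -0.21. -/
theorem prod_legendreRatio_le (hz0 : 0 ≤ z) (hz1 : z ≤ 0.15605) {j : ℕ} (hj : 5 ≤ j) :
    8 * ∏ i ∈ Finset.range j, legendreRatio (2 * (1 - z)) (2 + i) ≤
      0.65 * ∏ i ∈ Finset.range j, legendreRatio (-(1 - z) / 4) (2 + i) := by
  have hnn : ∀ i, 0 ≤ legendreRatio (2 * (1 - z)) (2 + i) := fun i =>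
    legendreRatio_nonneg (by linarith) (by omega)
  have mono : ∀ {β β' : ℝ} (m : ℕ), β ≤ β' → legendreRatio β' m ≤ legendreRatio β m := by
    intro β β' m h
    unfold legendreRatio
    gcongr
  induction j, hj using Nat.le_induction with
  | base =>
    have e1 : ∏ i ∈ Finset.range 5, legendreRatio (2 * (1 - z)) (2 + i) ≤
        ∏ i ∈ Finset.range 5, legendreRatio 1.6879 (2 + i) :=
      Finset.prod_le_prod (fun i _ => hnn i) fun i _ => mono _ (by linarith)
    have e2 : ∏ i ∈ Finset.range 5, legendreRatio (-0.21) (2 + i) ≤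
        ∏ i ∈ Finset.range 5, legendreRatio (-(1 - z) / 4) (2 + i) :=
      Finset.prod_le_prod (fun i _ => legendreRatio_nonneg (by norm_num) (by omega))
        fun i _ => mono _ (by linarith)
    have e3 : 8 * ∏ i ∈ Finset.range 5, legendreRatio 1.6879 (2 + i) ≤
        0.65 * ∏ i ∈ Finset.range 5, legendreRatio (-0.21) (2 + i) := by
      norm_num [Finset.prod_range_succ, legendreRatio]
    linarith
  | succ j hj ih =>
    rw [Finset.prod_range_succ, Finset.prod_range_succ, ← mul_assoc, ← mul_assoc]
    refine mul_le_mul ih (mono _ (by linarith)) (hnn j) (mul_nonneg (by norm_num) ?_)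
    exact Finset.prod_nonneg fun i _ => legendreRatio_nonneg (by linarith) (by omega)

theorem boxCheck_sum : boxCheck 1 1 1 [] [PolyExpr.sumExpr] 24
    85800000000 1099511627776 0 85800000000 1099511627776 0 = true := by
  decide +kernel

/-- The Taylor polynomial of degree 6 is positive by the box test and the further coefficients are
nonnegative. This bounds the negative singularity of F at t = -1 by that of g. -/
theorem legendreFn_add_pos (hz0 : 0 ≤ z) (hz1 : z ≤ 0.15605) {t : ℝ} (h0 : -1 < t) (h1 : t ≤ 1) :
    0 < legendreFn (2 * (1 - z)) t + 0.65 * legendreFn (-(1 - z) / 4) t := by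
  have hx : |1 - t| < 2 := abs_lt.2 ⟨by linarith, by linarith⟩
  have hx0 : 0 ≤ 1 - t := by linarith
  have s1 := (twoRadius_legendreCoeff (β := 2 * (1 - z)) (by linarith) (by linarith)).hasSum hx
  have s2 := (twoRadius_legendreCoeff (β := -(1 - z) / 4) (by linarith) (by linarith)).hasSum hx
  have s3 := s1.add (s2.mul_left 0.65)
  rw [legendreFn_eq_psum, legendreFn_eq_psum]
  refine lt_of_lt_of_le ?_ (sum_le_hasSum (Finset.range (5 + 2)) (fun n hn => ?_) s3)
  · rw [Finset.sum_add_distrib, ← Finset.mul_sum, sum_legendreCoeff_eq, sum_legendreCoeff_eq]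
    have h := eq_of_mem_singleton_exists (exists_pos_of_boxCheck allEncl_nil (by decide +kernel) 24
      (abs_parameter_le hz0 hz1) (v₁ := 1 - t)
      (by apply abs_scaled_sub_le <;> push_cast <;> linarith) abs_zero_le boxCheck_sum)
    simp only [PolyExpr.sumExpr, PolyExpr.fExpr, PolyExpr.gExpr, PolyExpr.eval_nest_two,
      PolyExpr.eval_nest_quarter, PolyExpr.eval_add, PolyExpr.eval_sub, PolyExpr.eval_mul,
      PolyExpr.eval_rat, PolyExpr.eval_x, PolyExpr.eval_y] at h
    push_cast at h
    simp only [div_one] at h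
    refine h.trans_eq ?_
    ring
  · obtain ⟨j, rfl⟩ : ∃ j, n = j + 1 := ⟨n - 1, by simp at hn; omega⟩
    have hj : 5 ≤ j := by simp at hn; omega
    have := mul_le_mul_of_nonneg_left (prod_legendreRatio_le hz0 hz1 hj)
      (by linarith : 0 ≤ (1 - z) / 8)
    rw [legendreCoeff_eq_prod, legendreCoeff_eq_prod, ← mul_assoc, ← add_mul]
    refine mul_nonneg ?_ (by positivity)
    linarith

/-! ### The exponents -/

theorem expo_nonneg (c : ℝ) (n : ℕ) : 0 ≤ expo c n := by
  have : 1 ≤ Real.sqrt (1 + 4 * n * (n + 1) * (1 + c ^ 2)) := by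
    rw [Real.one_le_sqrt]
    have : (0 : ℝ) ≤ 4 * n * (n + 1) * (1 + c ^ 2) := by positivity
    linarith
  unfold expo
  linarith

theorem expo_mul (c : ℝ) (n : ℕ) :
    expo c n * (expo c n + 1) = n * (n + 1) * (1 + c ^ 2) := by
  have := Real.sq_sqrt (show (0 : ℝ) ≤ 1 + 4 * n * (n + 1) * (1 + c ^ 2) by positivity)
  unfold expo
  linear_combination this / 4

/-- The exponents as functions of `z = c² / (1 + c²)`. -/
def IsExponent (z : ℝ) (n : ℕ) (α : ℝ) : Prop := 0 ≤ α ∧ α * (α + 1) * (1 - z) = n * (n + 1)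

theorem isExponent_expo (c : ℝ) (n : ℕ) : IsExponent (c ^ 2 / (1 + c ^ 2)) n (expo c n) := by
  refine ⟨expo_nonneg c n, ?_⟩
  rw [expo_mul]
  have : 1 + c ^ 2 ≠ 0 := by positivity
  field_simp
  ring

namespace IsExponent

variable {n : ℕ} {α a : ℝ}

/-- Since a(a+1) increases on a ≥ 0, bounds of the exponents reduce to polynomial inequalities in z.
-/
theorem le_of_le (h : IsExponent z n α) (hz : z < 1) (ha : 0 ≤ a)
    (h' : a * (a + 1) * (1 - z) ≤ n * (n + 1)) : a ≤ α := by
  by_contra! hc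
  have h0 := h.1
  have h1 : α * (α + 1) < a * (a + 1) := by nlinarith
  have h2 := h.2
  have h3 := mul_lt_mul_of_pos_right h1 (by linarith : 0 < 1 - z)
  linarith

theorem le_of_ge (h : IsExponent z n α) (hz : z < 1) (ha : 0 ≤ a)
    (h' : n * (n + 1) ≤ a * (a + 1) * (1 - z)) : α ≤ a := by
  by_contra! hc
  have h0 := h.1
  have h1 : a * (a + 1) < α * (α + 1) := by nlinarith
  have h2 := h.2
  have h3 := mul_lt_mul_of_pos_right h1 (by linarith : 0 < 1 - z)
  linarith

/-- Once the facts z^{k+1} ≤ 0.15605 z^k are supplied, the polynomial inequality becomes linear in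
the powers of z, treated as independent unknowns. The next two lemmas follow the same scheme. -/
theorem bounds_one (hz0 : 0 ≤ z) (hz1 : z ≤ 0.15605) (h : IsExponent z 1 α) :
    1 + lowOff z 1 ≤ α ∧ α ≤ 1 + highOff z 1 := by
  have h2 : z ^ 2 ≤ 0.15605 * z := by nlinarith
  have h2' : 0 ≤ z ^ 2 := sq_nonneg z
  have h3 : z ^ 3 ≤ 0.15605 * z ^ 2 := by nlinarith
  have h3' : 0 ≤ z ^ 3 := by positivity
  have h4 : z ^ 4 ≤ 0.15605 * z ^ 3 := by nlinarith
  have h4' : 0 ≤ z ^ 4 := by positivity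
  have h5 : z ^ 5 ≤ 0.15605 * z ^ 4 := by nlinarith
  have h5' : 0 ≤ z ^ 5 := by positivity
  simp only [lowOff, highOff]
  constructor
  · refine h.le_of_le (by linarith) (by positivity) ?_
    push_cast
    ring_nf
    linarith
  · refine h.le_of_ge (by linarith) (by positivity) ?_
    push_cast
    ring_nf
    linarith

theorem bounds_two (hz0 : 0 ≤ z) (hz1 : z ≤ 0.15605) (h : IsExponent z 2 α) :
    2 + lowOff z 2 ≤ α ∧ α ≤ 2 + highOff z 2 := by
  have h2 : z ^ 2 ≤ 0.15605 * z := by nlinarith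
  have h2' : 0 ≤ z ^ 2 := sq_nonneg z
  have h3 : z ^ 3 ≤ 0.15605 * z ^ 2 := by nlinarith
  have h3' : 0 ≤ z ^ 3 := by positivity
  have h4 : z ^ 4 ≤ 0.15605 * z ^ 3 := by nlinarith
  have h4' : 0 ≤ z ^ 4 := by positivity
  have h5 : z ^ 5 ≤ 0.15605 * z ^ 4 := by nlinarith
  have h5' : 0 ≤ z ^ 5 := by positivity
  simp only [lowOff, highOff]
  constructor
  · refine h.le_of_le (by linarith) (by positivity) ?_
    push_cast
    ring_nf
    linarith
  · refine h.le_of_ge (by linarith) (by positivity) ?_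
    push_cast
    ring_nf
    linarith

theorem bounds_three (hz0 : 0 ≤ z) (hz1 : z ≤ 0.15605) (h : IsExponent z 3 α) :
    3 + lowOff z 3 ≤ α ∧ α ≤ 3 + highOff z 3 := by
  have h2 : z ^ 2 ≤ 0.15605 * z := by nlinarith
  have h2' : 0 ≤ z ^ 2 := sq_nonneg z
  have h3 : z ^ 3 ≤ 0.15605 * z ^ 2 := by nlinarith
  have h3' : 0 ≤ z ^ 3 := by positivity
  have h4 : z ^ 4 ≤ 0.15605 * z ^ 3 := by nlinarith
  have h4' : 0 ≤ z ^ 4 := by positivity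
  have h5 : z ^ 5 ≤ 0.15605 * z ^ 4 := by nlinarith
  have h5' : 0 ≤ z ^ 5 := by positivity
  simp only [lowOff, highOff]
  constructor
  · refine h.le_of_le (by linarith) (by positivity) ?_
    push_cast
    ring_nf
    linarith [sq_nonneg (z - 0.01)]
  · refine h.le_of_ge (by linarith) (by positivity) ?_
    push_cast
    ring_nf
    linarith

variable {α₁ α₂ α₃ : ℝ}

/-- For the lower bound put κ = 2 - 0.14z and test κα₁ in the equation of α₂. With 6 =
3α₁(α₁+1)(1-z) the condition becomes α₁(κ² - 3) ≤ 3 - κ, to which the upper bound of α₁ applies. -/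
theorem two_ratio (hz0 : 0 ≤ z) (hz1 : z ≤ 0.15605) (h1 : IsExponent z 1 α₁)
    (h2 : IsExponent z 2 α₂) : α₂ ≤ 2 * α₁ ∧ (2 - 0.14 * z) * α₁ ≤ α₂ := by
  obtain ⟨a1, a2⟩ := h1.bounds_one hz0 hz1
  obtain ⟨b1, b2⟩ := h2.bounds_two hz0 hz1
  simp only [lowOff, highOff] at a1 a2 b1 b2
  constructor
  · nlinarith
  · refine h2.le_of_le (by linarith) (mul_nonneg (by linarith) h1.1) ?_
    have e := h1.2
    push_cast at e ⊢
    have : α₁ * ((2 - 0.14 * z) ^ 2 - 3) ≤ 3 - (2 - 0.14 * z) := by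
      have : α₁ * ((2 - 0.14 * z) ^ 2 - 3) ≤
        (1 + z * (0.6667 + 0.6 * z)) * ((2 - 0.14 * z) ^ 2 - 3) :=
        mul_le_mul_of_nonneg_right a2 (by nlinarith)
      nlinarith [mul_nonneg hz0 hz0, mul_nonneg hz0 (mul_nonneg hz0 hz0),
        mul_nonneg (mul_nonneg hz0 hz0) (mul_nonneg hz0 hz0)]
    have h3 := mul_le_mul_of_nonneg_left this
      (mul_nonneg (mul_nonneg (by linarith : 0 ≤ 2 - 0.14 * z) h1.1) (by linarith : 0 ≤ 1 - z))
    nlinarith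

theorem three_ratio (hz0 : 0 ≤ z) (hz1 : z ≤ 0.15605) (h1 : IsExponent z 1 α₁)
    (h2 : IsExponent z 3 α₂) : α₂ ≤ 3 * α₁ ∧ (3 - 0.3 * z) * α₁ ≤ α₂ := by
  obtain ⟨a1, a2⟩ := h1.bounds_one hz0 hz1
  obtain ⟨b1, b2⟩ := h2.bounds_three hz0 hz1
  simp only [lowOff, highOff] at a1 a2 b1 b2
  constructor
  · nlinarith
  · refine h2.le_of_le (by linarith) (mul_nonneg (by linarith) h1.1) ?_
    have e := h1.2
    push_cast at e ⊢
    have : α₁ * ((3 - 0.3 * z) ^ 2 - 6) ≤ 6 - (3 - 0.3 * z) := by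
      have : α₁ * ((3 - 0.3 * z) ^ 2 - 6) ≤
        (1 + z * (0.6667 + 0.6 * z)) * ((3 - 0.3 * z) ^ 2 - 6) :=
        mul_le_mul_of_nonneg_right a2 (by nlinarith)
      nlinarith [mul_nonneg hz0 hz0, mul_nonneg hz0 (mul_nonneg hz0 hz0),
        mul_nonneg (mul_nonneg hz0 hz0) (mul_nonneg hz0 hz0)]
    have h3 := mul_le_mul_of_nonneg_left this
      (mul_nonneg (mul_nonneg (by linarith : 0 ≤ 3 - 0.3 * z) h1.1) (by linarith : 0 ≤ 1 - z))
    nlinarith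

end IsExponent

end

/-! ### Powers of the radius -/

/-- This is x ≤ sinh x at x = -log y. For r = y² it bounds log r below with a single factor 1/y,
where log r ≥ 1 - 1/r would cost 1/y². -/
theorem one_sub_inv_le_two_log {y : ℝ} (hy0 : 0 < y) (hy1 : y ≤ 1) :
    -((1 - y ^ 2) / y) ≤ 2 * Real.log y := by
  have h := Real.self_le_sinh_iff.2 (neg_nonneg.2 (Real.log_nonpos hy0.le hy1))
  rw [Real.sinh_neg, Real.sinh_eq, Real.exp_neg, Real.exp_log hy0] at h
  have : (1 - y ^ 2) / y = y⁻¹ - y := by field_simp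
  rw [this]
  linarith

/-- The lower bound is 1 + x ≤ eˣ with the bound of the logarithm; the upper one is Bernoulli's
inequality for an exponent in [0, 1]. -/
theorem rpow_sq_bounds {y β l h : ℝ} (hy0 : 0 < y) (hy1 : y ≤ 1) (hl : 0 ≤ l) (h1 : l ≤ β)
    (h2 : β ≤ h) (h3 : h ≤ 1) :
    1 - h * ((1 - y ^ 2) / y) ≤ (y ^ 2) ^ β ∧ (y ^ 2) ^ β ≤ 1 - l * (1 - y ^ 2) := by
  have hy2 : 0 < y ^ 2 := by positivity
  have hy3 : y ^ 2 ≤ 1 := pow_le_one₀ hy0.le hy1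
  constructor
  · calc 1 - h * ((1 - y ^ 2) / y) ≤ Real.log (y ^ 2) * h + 1 := by
          rw [Real.log_pow]
          push_cast
          nlinarith [one_sub_inv_le_two_log hy0 hy1]
      _ ≤ (y ^ 2) ^ h := by
          rw [Real.rpow_def_of_pos hy2]
          exact Real.add_one_le_exp _
      _ ≤ _ := Real.rpow_le_rpow_of_exponent_ge hy2 hy3 h2
  · calc (y ^ 2) ^ β ≤ (y ^ 2) ^ l := Real.rpow_le_rpow_of_exponent_ge hy2 hy3 h1
      _ = (1 + (y ^ 2 - 1)) ^ l := by congr 1; ring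
      _ ≤ 1 + l * (y ^ 2 - 1) :=
          rpow_one_add_le_one_add_mul_self (by linarith) hl (by linarith)
      _ = _ := by ring

theorem rpow_sq_nat_bounds {y α l h : ℝ} (n : ℕ) (hy0 : 0 < y) (hy1 : y ≤ 1) (hl : 0 ≤ l)
    (h1 : n + l ≤ α) (h2 : α ≤ n + h) (h3 : h ≤ 1) :
    (y ^ 2) ^ n - (y ^ 2) ^ n * (1 - y ^ 2) / y * h ≤ (y ^ 2) ^ α ∧
      (y ^ 2) ^ α ≤ (y ^ 2) ^ n - (y ^ 2) ^ n * (1 - y ^ 2) * l := by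
  have hy2 : 0 < y ^ 2 := by positivity
  obtain ⟨e1, e2⟩ := rpow_sq_bounds (β := α - n) hy0 hy1 hl (by linarith) (by linarith) h3
  have : (y ^ 2) ^ α = (y ^ 2) ^ n * (y ^ 2) ^ (α - n) := by
    rw [← Real.rpow_natCast (y ^ 2) n, ← Real.rpow_add hy2]
    congr 1; ring
  rw [this]
  have hp : 0 ≤ (y ^ 2) ^ n := by positivity
  have e3 := mul_le_mul_of_nonneg_left e1 hp
  have e4 := mul_le_mul_of_nonneg_left e2 hp
  constructor
  · refine le_trans (le_of_eq ?_) e3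
    ring
  · refine e4.trans (le_of_eq ?_)
    ring

section

variable {z : ℝ}

theorem powerBounds (hz0 : 0 ≤ z) (hz1 : z ≤ 0.15605) {α₁ α₂ α₃ : ℝ} (h1 : IsExponent z 1 α₁)
    (h2 : IsExponent z 2 α₂) (h3 : IsExponent z 3 α₃) {y : ℝ} (hy0 : 0 < y) (hy1 : y ≤ 1) :
    PowerBounds z y ((y ^ 2) ^ α₁) ((y ^ 2) ^ α₂) ((y ^ 2) ^ α₃) := by
  obtain ⟨a1, a2⟩ := h1.bounds_one hz0 hz1
  obtain ⟨b1, b2⟩ := h2.bounds_two hz0 hz1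
  obtain ⟨c1, c2⟩ := h3.bounds_three hz0 hz1
  have n1 : 0 ≤ lowOff z 1 := by simp only [lowOff]; positivity
  have n2 : 0 ≤ lowOff z 2 := by simp only [lowOff]; positivity
  have n3 : 0 ≤ lowOff z 3 := by simp only [lowOff]; positivity
  have m1 : highOff z 1 ≤ 1 := by simp only [highOff]; nlinarith
  have m2 : highOff z 2 ≤ 1 := by simp only [highOff]; nlinarith
  have m3 : highOff z 3 ≤ 1 := by simp only [highOff]; nlinarith
  obtain ⟨d1, d2⟩ := rpow_sq_nat_bounds 1 hy0 hy1 n1 (by exact_mod_cast a1) (by exact_mod_cast a2) m1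
  obtain ⟨e1, e2⟩ := rpow_sq_nat_bounds 2 hy0 hy1 n2 (by exact_mod_cast b1) (by exact_mod_cast b2) m2
  obtain ⟨f1, f2⟩ := rpow_sq_nat_bounds 3 hy0 hy1 n3 (by exact_mod_cast c1) (by exact_mod_cast c2) m3
  refine ⟨⟨le_of_eq_of_le ?_ d1, d2.trans_eq ?_⟩, ⟨le_of_eq_of_le ?_ e1, e2.trans_eq ?_⟩,
    ⟨le_of_eq_of_le ?_ f1, f2.trans_eq ?_⟩⟩
  all_goals first | ring1 | field_simp

/-- Quotients of powers of the radius in terms of `ρ = r ^ α₁`. -/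
theorem rpow_ratio_bounds {r α δ : ℝ} (hr0 : 0 < r) (hr1 : r ≤ 1) (hα : 0 < α)
    (hρ : 0.2 ≤ r ^ α) (hδ0 : 0 ≤ δ) (hδ1 : δ ≤ 1) :
    1 ≤ r ^ (-(δ * α)) ∧ r ^ (-(δ * α)) ≤ 1 + 5 * δ * (1 - r ^ α) := by
  set ρ := r ^ α with hρd
  have hρ1 : ρ ≤ 1 := Real.rpow_le_one hr0.le hr1 hα.le
  have hρ0 : 0 < ρ := by linarith
  have e : r ^ (-(δ * α)) = (ρ⁻¹) ^ δ := by
    rw [hρd, ← Real.rpow_neg hr0.le, ← Real.rpow_mul hr0.le]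
    congr 1; ring
  have hinv : 1 ≤ ρ⁻¹ := (one_le_inv₀ hρ0).2 hρ1
  rw [e]
  refine ⟨Real.one_le_rpow hinv hδ0, ?_⟩
  have h := rpow_one_add_le_one_add_mul_self (s := ρ⁻¹ - 1) (by linarith) hδ0 hδ1
  rw [add_sub_cancel] at h
  refine h.trans ?_
  -- This is where ρ ≥ 0.2 is needed. With δ₂ ≤ 0.14z and δ₃ ≤ 0.3z the factor 5 yields the
  -- constants 0.7 and 1.5 of the box test.
  have : ρ⁻¹ - 1 ≤ 5 * (1 - ρ) := by
    have : ρ⁻¹ - 1 = (1 - ρ) / ρ := by field_simp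
    rw [this, div_le_iff₀ hρ0]
    nlinarith
  nlinarith

/-- The difference of the two sides vanishes at 1 and decreases on (0, 1]. By Bernoulli s^{1-γ} ≤ 1
- (1-γ)(1-s), so s^{γ-1} ≥ 1 + (1-γ)(1-s), and 1 - γ ≥ 0.78 = 2 · 0.39. -/
theorem rpow_le_quadratic {ρ γ : ℝ} (hρ0 : 0 < ρ) (hρ1 : ρ ≤ 1) (hγ0 : 0 ≤ γ) (hγ1 : γ ≤ 0.22) :
    ρ ^ γ ≤ 1 - γ * ((1 - ρ) + 0.39 * (1 - ρ) ^ 2) := by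
  have hd : ∀ s ∈ Ioo (0 : ℝ) 2, HasDerivAt
      (fun s : ℝ => 1 - γ * ((1 - s) + 0.39 * (1 - s) ^ 2) - s ^ γ)
      (γ * (1 + 0.78 * (1 - s)) - γ * s ^ (γ - 1)) s := by
    intro s hs
    have e1 : HasDerivAt (fun s : ℝ => 1 - s) (-1) s := by
      simpa using! (hasDerivAt_id s).const_sub 1
    have e2 := ((e1.add ((e1.pow 2).const_mul 0.39)).const_mul γ).const_sub 1
    have e3 := Real.hasDerivAt_rpow_const (x := s) (p := γ) (Or.inl hs.1.ne')
    refine (e2.sub e3).congr_deriv ?_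
    norm_num
    ring
  have hanti : AntitoneOn (fun s : ℝ => 1 - γ * ((1 - s) + 0.39 * (1 - s) ^ 2) - s ^ γ)
      (Ioc 0 1) := by
    refine antitoneOn_of_deriv_nonpos (convex_Ioc 0 1) (fun s hs =>
      (hd s ⟨hs.1, by linarith [hs.2]⟩).continuousAt.continuousWithinAt) (fun s hs => ?_)
      fun s hs => ?_
    · rw [interior_Ioc] at hs
      exact (hd s ⟨hs.1, by linarith [hs.2]⟩).differentiableAt.differentiableWithinAt
    · rw [interior_Ioc] at hs
      rw [(hd s ⟨hs.1, by linarith [hs.2]⟩).deriv, ← mul_sub]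
      refine mul_nonpos_of_nonneg_of_nonpos hγ0 (sub_nonpos.2 ?_)
      have h1 := rpow_one_add_le_one_add_mul_self (s := s - 1) (p := 1 - γ) (by linarith [hs.1])
        (by linarith) (by linarith)
      rw [add_sub_cancel] at h1
      have h2 : 0 < s ^ (1 - γ) := Real.rpow_pos_of_pos hs.1 _
      have h3 : s ^ (γ - 1) = (s ^ (1 - γ))⁻¹ := by
        rw [← Real.rpow_neg hs.1.le]; congr 1; ring
      rw [h3, le_inv_comm₀ (by nlinarith [hs.2]) h2]
      refine h1.trans ?_
      rw [← one_div, le_div_iff₀ (by nlinarith [hs.2])]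
      nlinarith [hs.1, hs.2, mul_nonneg (sub_nonneg.2 hs.2.le) (sub_nonneg.2 hγ1)]
  have := hanti ⟨hρ0, hρ1⟩ (right_mem_Ioc.2 one_pos) hρ1
  norm_num at this
  norm_num
  linarith

end

/-! ### The function w in polar variables, and the sign of v below the cut angle -/

section

variable {z : ℝ}

/-- `w` at the radius `r`. -/
def waveFn (z α₁ α₂ α₃ r t : ℝ) : ℝ := profileSum z t (r ^ α₁) (r ^ α₂) (r ^ α₃)

/-- The operator `r ∂_r` applied to `waveFn`. -/
def waveRadial (z α₁ α₂ α₃ r t : ℝ) : ℝ :=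
  (0.965 + 0.066 * z) * (α₁ * (r ^ α₁ * t)) -
    0.37 * z * (α₂ * (r ^ α₂ * (3 / 2 * (t * t) - 1 / 2))) +
    0.233 * z * (α₃ * (r ^ α₃ * (t * (5 / 2 * (t * t) - 3 / 2))))

/-- The derivative of `waveFn` in `t`. -/
def waveAngular (z α₁ α₂ α₃ r t : ℝ) : ℝ :=
  (0.965 + 0.066 * z) * r ^ α₁ - 0.37 * z * (r ^ α₂ * (3 * t)) +
    0.233 * z * (r ^ α₃ * (15 / 2 * (t * t) - 3 / 2))

variable {α₁ α₂ α₃ r t y : ℝ}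

/-- The constant term dominates, so w has no zero with ρ < 0.2 and the box test may start at ρ =
0.2. -/
theorem profileSum_pos_of_small (hz0 : 0 ≤ z) (hz1 : z ≤ 0.15605) (ht0 : -1 ≤ t) (ht1 : t ≤ 1)
    {q₁ q₂ q₃ : ℝ} (h1 : 0 ≤ q₁) (h1' : q₁ ≤ 0.2) (h2 : 0 ≤ q₂) (h2' : q₂ ≤ 0.2) (h3 : 0 ≤ q₃)
    (h3' : q₃ ≤ 0.2) : 0 < profileSum z t q₁ q₂ q₃ := by
  have t2 : t * t ≤ 1 := by nlinarith
  have e1 : -0.2 ≤ q₁ * t := by nlinarith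
  have e2 : q₂ * (3 / 2 * (t * t) - 1 / 2) ≤ 0.2 := by nlinarith
  have e3 : -0.2 ≤ q₃ * (t * (5 / 2 * (t * t) - 3 / 2)) := by
    have : -1 ≤ t * (5 / 2 * (t * t) - 3 / 2) := by nlinarith [sq_nonneg (t + 1), sq_nonneg (5 * t - 2), mul_nonneg (by linarith : 0 ≤ t + 1) (sq_nonneg (5 * t - 2)), mul_nonneg (by linarith : 0 ≤ t + 1) (sq_nonneg (t - 1 / 2))]
    nlinarith
  unfold profileSum
  have f1 := mul_le_mul_of_nonneg_left e1 (by linarith : 0 ≤ 0.965 + 0.066 * z)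
  have f2 := mul_le_mul_of_nonneg_left e2 (by linarith : 0 ≤ 0.37 * z)
  have f3 := mul_le_mul_of_nonneg_left e3 (by linarith : 0 ≤ 0.233 * z)
  linarith

theorem mul_const_le (hz0 : 0 ≤ z) (hz1 : z ≤ 0.15605) : (1.333 + 0.14 * z) * z ≤ 0.22 := by
  nlinarith

/-- A form of γ₀ ≤ 2(α₁ - 1)/α₁ for γ₀ = (1.333 + 0.14z)z. -/
theorem IsExponent.two_le_mul (hz0 : 0 ≤ z) (hz1 : z ≤ 0.15605) (h1 : IsExponent z 1 α₁) :
    2 ≤ α₁ * (2 - (1.333 + 0.14 * z) * z) := by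
  have hγ : 0 < 2 - (1.333 + 0.14 * z) * z := by nlinarith
  rw [← div_le_iff₀ hγ]
  refine h1.le_of_le (by linarith) (by positivity) ?_
  rw [div_add_one hγ.ne', div_mul_div_comm, div_mul_eq_mul_div, div_le_iff₀ (by positivity)]
  have h2 := mul_nonneg hz0 hz0
  have h3 := mul_nonneg h2 hz0
  have h4 := mul_nonneg h3 hz0
  norm_num
  nlinarith

/-- With ρ = r^{α₁} and γ = 2(α₁ - 1)/α₁ one has ρ² = r²ρ^γ. Multiplied by ρ^γ, the claim has right
side k₀ρ², and on the left ρ^γ is at most the quadratic prefactor of the scaled inequality. -/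
theorem wave_grad_lt (hz0 : 0 ≤ z) (hz1 : z ≤ 0.15605) (h1 : IsExponent z 1 α₁)
    (h2 : IsExponent z 2 α₂) (h3 : IsExponent z 3 α₃) (hr0 : 0 < r) (hr1 : r ≤ 1)
    (ht0 : -1 ≤ t) (ht1 : t ≤ 1) (hw : waveFn z α₁ α₂ α₃ r t = 0) :
    (1 - z) * waveRadial z α₁ α₂ α₃ r t ^ 2 + (1 - t ^ 2) * waveAngular z α₁ α₂ α₃ r t ^ 2 <
      (0.9996 - 0.409 * z + 0.18 * z ^ 2) * r ^ 2 := by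
  obtain ⟨a1, a2⟩ := h1.bounds_one hz0 hz1
  obtain ⟨b1, b2⟩ := h2.bounds_two hz0 hz1
  obtain ⟨c1, c2⟩ := h3.bounds_three hz0 hz1
  obtain ⟨d1, d2⟩ := h1.two_ratio hz0 hz1 h2
  obtain ⟨d3, d4⟩ := h1.three_ratio hz0 hz1 h3
  have hα₁ : 1 ≤ α₁ := le_trans (by simp only [lowOff]; nlinarith) a1
  have hα : 0 < α₁ := by linarith
  set ρ := r ^ α₁ with hρ
  have hρ0 : 0 < ρ := Real.rpow_pos_of_pos hr0 _
  have hρ1 : ρ ≤ 1 := Real.rpow_le_one hr0.le hr1 hα.le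
  rcases lt_or_ge ρ 0.2 with hs | hs
  · exfalso
    have k2 := mul_nonneg (by linarith : 0 ≤ 1 - 0.14 * z) hα.le
    have k3 := mul_nonneg (by linarith : 0 ≤ 2 - 0.3 * z) hα.le
    have m2 : r ^ α₂ ≤ ρ := Real.rpow_le_rpow_of_exponent_ge hr0 hr1 (by linarith)
    have m3 : r ^ α₃ ≤ ρ := Real.rpow_le_rpow_of_exponent_ge hr0 hr1 (by linarith)
    exact (profileSum_pos_of_small hz0 hz1 ht0 ht1 hρ0.le hs.le (Real.rpow_nonneg hr0.le _)
      (m2.trans hs.le) (Real.rpow_nonneg hr0.le _) (m3.trans hs.le)).ne' hw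
  set δ₂ := 2 - α₂ / α₁ with hδ₂
  set δ₃ := 3 - α₃ / α₁ with hδ₃
  have e2 : δ₂ * α₁ = 2 * α₁ - α₂ := by rw [hδ₂]; field_simp
  have e3 : δ₃ * α₁ = 3 * α₁ - α₃ := by rw [hδ₃]; field_simp
  have l2 : 0 ≤ δ₂ := nonneg_of_mul_nonneg_left (by linarith) hα
  have l3 : 0 ≤ δ₃ := nonneg_of_mul_nonneg_left (by linarith) hα
  have u2 : δ₂ ≤ 0.14 * z := le_of_mul_le_mul_right (by linarith) hα
  have u3 : δ₃ ≤ 0.3 * z := le_of_mul_le_mul_right (by linarith) hα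
  obtain ⟨p1, p2⟩ := rpow_ratio_bounds hr0 hr1 hα hs l2 (by linarith)
  obtain ⟨p3, p4⟩ := rpow_ratio_bounds hr0 hr1 hα hs l3 (by linarith)
  have q2 : r ^ α₂ = ρ ^ 2 * r ^ (-(δ₂ * α₁)) := by
    rw [hρ, ← Real.rpow_natCast (r ^ α₁), ← Real.rpow_mul hr0.le, ← Real.rpow_add hr0, e2]
    congr 1; push_cast; ring
  have q3 : r ^ α₃ = ρ ^ 3 * r ^ (-(δ₃ * α₁)) := by
    rw [hρ, ← Real.rpow_natCast (r ^ α₁), ← Real.rpow_mul hr0.le, ← Real.rpow_add hr0, e3]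
    congr 1; push_cast; ring
  have hd : 0 ≤ 1 - ρ := by linarith
  have key := wave_grad_lt_of_scaled hz0 hz1 hs hρ1 ht0 ht1 p1
    (p2.trans (by linarith [mul_le_mul_of_nonneg_right u2 hd])) p3
    (p4.trans (by linarith [mul_le_mul_of_nonneg_right u3 hd])) a1 a2 b1 b2 c1 c2
    (by rw [← q2, ← q3]; exact hw)
  rw [← q2, ← q3] at key
  set γ := 2 * (α₁ - 1) / α₁ with hγ
  have hγα : α₁ * γ = 2 * (α₁ - 1) := by rw [hγ]; field_simp
  set γ₀ := (1.333 + 0.14 * z) * z with hγ₀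
  have g0 : 0 ≤ γ₀ := by positivity
  have g1 : γ₀ ≤ 0.22 := mul_const_le hz0 hz1
  have g2 : γ₀ ≤ γ := by
    rw [hγ, le_div_iff₀ hα]
    have h2m := h1.two_le_mul hz0 hz1
    rw [← hγ₀] at h2m
    linarith
  have g3 : ρ ^ γ ≤ 1 - γ₀ * ((1 - ρ) + 0.39 * (1 - ρ) ^ 2) :=
    (Real.rpow_le_rpow_of_exponent_ge hρ0 hρ1 g2).trans (rpow_le_quadratic hρ0 hρ1 g0 g1)
  have g4 : ρ ^ 2 = r ^ 2 * ρ ^ γ := by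
    rw [hρ, ← Real.rpow_natCast (r ^ α₁), ← Real.rpow_natCast r, ← Real.rpow_mul hr0.le,
      ← Real.rpow_mul hr0.le, ← Real.rpow_add hr0, hγα]
    congr 1; push_cast; ring
  have g5 : 0 < ρ ^ γ := Real.rpow_pos_of_pos hρ0 _
  have hX : 0 ≤ (1 - z) * waveRadial z α₁ α₂ α₃ r t ^ 2 +
      (1 - t ^ 2) * waveAngular z α₁ α₂ α₃ r t ^ 2 :=
    add_nonneg (mul_nonneg (by linarith) (sq_nonneg _)) (mul_nonneg
      (sub_nonneg.2 ((sq_le_one_iff_abs_le_one t).2 (abs_le.2 ⟨ht0, ht1⟩))) (sq_nonneg _))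
  have g6 := (mul_le_mul_of_nonneg_right g3 hX).trans_lt key
  rw [g4] at g6
  refine lt_of_mul_lt_mul_left ?_ g5.le
  linarith

/-- Below the angle `T` the function `v` is positive where `w ≥ 0`. -/
theorem below_cut_pos (hz0 : 0 ≤ z) (hz1 : z ≤ 0.15605) (h1 : IsExponent z 1 α₁)
    (h2 : IsExponent z 2 α₂) (h3 : IsExponent z 3 α₃) (hy0 : 0 < y) (hy1 : y ≤ 1)
    (ht0 : -1 < t) (ht1 : t ≤ -0.44 + 0.705 * z) (hw : 0 ≤ waveFn z α₁ α₂ α₃ (y ^ 2) t) :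
    0 < (0.17 - 0.3 * z) * legendreFn (-(1 - z) / 4) t +
      y ^ 3 * legendreFn (2 * (1 - z)) t := by
  have hq := powerBounds hz0 hz1 h1 h2 h3 hy0 hy1
  have hsum := legendreFn_add_pos hz0 hz1 ht0 (by linarith : t ≤ 1)
  have hg : 0 < legendreFn (-(1 - z) / 4) t := by
    obtain ⟨T, hT1, -, hT⟩ := exists_nested_legendreFn (β := -(1 - z) / 4) (q := 1 - t)
      (by linarith) (by linarith) (t := t) (by linarith) le_rfl (by linarith) 0
    rw [hT]
    simp only [nested]
    have : 0 ≤ (1 - z) / 4 / 2 * (1 - t) * T :=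
      mul_nonneg (mul_nonneg (by linarith) (by linarith)) (by linarith)
    linarith
  -- Indeed εg + y³F = (ε - 0.65y³)g + y³(F + 0.65g). This settles y ≤ 0.3 at once, and t ≤ -0.85 by
  -- `axis_bound`.
  have hfin : 0.65 * y ^ 3 < 0.17 - 0.3 * z → 0 < (0.17 - 0.3 * z) * legendreFn (-(1 - z) / 4) t +
      y ^ 3 * legendreFn (2 * (1 - z)) t := by
    intro h
    have := mul_pos (sub_pos.2 h) hg
    have := mul_pos (by positivity : 0 < y ^ 3) hsum
    linarith
  rcases le_total (-0.85) t with h | h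
  · rcases le_total 0.3 y with h' | h'
    · exact middle_pos hz0 hz1 h' hy1 h ht1 hq hw
    · refine hfin ?_
      have : y ^ 3 ≤ 0.3 ^ 3 := pow_le_pow_left₀ hy0.le h' 3
      norm_num at this ⊢
      linarith
  · refine hfin ?_
    have := axis_bound hz0 hz1 hy0.le hy1 ht0.le h hq hw
    have : 0 < y ^ 3 := by positivity
    linarith

end

/-! ### The angular profiles -/

theorem hasDerivAt_legendreFn' {β t : ℝ} (h1 : -1 ≤ β) (h2 : β ≤ 2) (ht0 : -1 < t) (ht1 : t < 1) :
    HasDerivAt (legendreFn' β) ((2 * t * legendreFn' β t - β * legendreFn β t) / (1 - t ^ 2)) t := by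
  have hx : |1 - t| < 2 := abs_lt.2 ⟨by linarith, by linarith⟩
  have hpos : 0 < 1 - t ^ 2 := by nlinarith
  have e1 := hasDerivAt_flux_legendreFn h1 h2 hx
  have e2 := (hasDerivAt_pow 2 t).const_sub 1
  have e3 := e1.div e2 hpos.ne'
  have e4 : HasDerivAt (legendreFn' β) _ t := e3.congr_of_eventuallyEq (by
    filter_upwards [Ioo_mem_nhds ht0 ht1] with s hs
    have : 0 < 1 - s ^ 2 := by nlinarith [hs.1, hs.2]
    rw [Pi.div_apply, mul_div_cancel_left₀ _ this.ne'])
  refine e4.congr_deriv ?_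
  field_simp
  norm_num
  ring

section

variable {z t : ℝ}

/-- The regular solution for the eigenvalue of degree one. -/
abbrev profF (z t : ℝ) : ℝ := legendreFn (2 * (1 - z)) t

abbrev profF' (z t : ℝ) : ℝ := legendreFn' (2 * (1 - z)) t

/-- The regular solution for the eigenvalue of degree `-1/2`. -/
abbrev profG (z t : ℝ) : ℝ := legendreFn (-(1 - z) / 4) t

abbrev profG' (z t : ℝ) : ℝ := legendreFn' (-(1 - z) / 4) t

theorem hasDerivAt_profF (hz0 : 0 ≤ z) (hz1 : z ≤ 0.15605) (ht0 : -1 < t) (ht1 : t < 3) :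
    HasDerivAt (profF z) (profF' z t) t :=
  hasDerivAt_legendreFn (by linarith) (by linarith) (abs_lt.2 ⟨by linarith, by linarith⟩)

theorem hasDerivAt_profG (hz0 : 0 ≤ z) (hz1 : z ≤ 0.15605) (ht0 : -1 < t) (ht1 : t < 3) :
    HasDerivAt (profG z) (profG' z t) t :=
  hasDerivAt_legendreFn (by linarith) (by linarith) (abs_lt.2 ⟨by linarith, by linarith⟩)

theorem hasDerivAt_profF' (hz0 : 0 ≤ z) (hz1 : z ≤ 0.15605) (ht0 : -1 < t) (ht1 : t < 1) :
    HasDerivAt (profF' z) ((2 * t * profF' z t - 2 * (1 - z) * profF z t) / (1 - t ^ 2)) t :=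
  hasDerivAt_legendreFn' (by linarith) (by linarith) ht0 ht1

theorem hasDerivAt_profG' (hz0 : 0 ≤ z) (hz1 : z ≤ 0.15605) (ht0 : -1 < t) (ht1 : t < 1) :
    HasDerivAt (profG' z) ((2 * t * profG' z t + (1 - z) / 4 * profG z t) / (1 - t ^ 2)) t :=
  (hasDerivAt_legendreFn' (by linarith) (by linarith) ht0 ht1).congr_deriv (by ring)

theorem profF'_pos (hz1 : z ≤ 0.15605) (hz0 : 0 ≤ z) (ht0 : -1 < t) (ht1 : t ≤ 1) :
    0 < profF' z t := by
  rw [profF', legendreFn'_eq]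
  have := one_le_ratioSeries (ρ := legendreRatio' (2 * (1 - z))) (m := 2) (q := 1 / 2) (x := 1 - t)
    (fun j hj => legendreRatio'_nonneg (by linarith) hj)
    (fun j hj => legendreRatio'_le_half (by linarith) hj) (by linarith) (by linarith)
  have : 0 < 2 * (1 - z) / 2 := by linarith
  positivity

theorem one_le_profG (hz0 : 0 ≤ z) (hz1 : z ≤ 0.15605) (ht0 : -1 < t) (ht1 : t ≤ 1) :
    1 ≤ profG z t := by
  have hx : |1 - t| < 2 := abs_lt.2 ⟨by linarith, by linarith⟩
  rw [profG, legendreFn_eq (by linarith) (by linarith) hx]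
  have := one_le_ratioSeries (ρ := legendreRatio (-(1 - z) / 4)) (m := 2) (q := 1 / 2) (x := 1 - t)
    (fun j hj => legendreRatio_nonneg (by linarith) hj)
    (fun j hj => legendreRatio_le (by linarith) hj) (by linarith) (by linarith)
  have : 0 ≤ (1 - z) / 4 / 2 * (1 - t) *
      ratioSeries (legendreRatio (-(1 - z) / 4)) 2 (1 - t) :=
    mul_nonneg (mul_nonneg (by linarith) (by linarith)) (by linarith)
  linarith

theorem profG'_nonpos (hz1 : z ≤ 0.15605) : profG' z t ≤ 0 ∨ 1 < t ∨ t ≤ -1 := by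
  by_cases h : 1 < t ∨ t ≤ -1
  · exact Or.inr h
  push Not at h
  left
  rw [profG', legendreFn'_eq]
  have : 0 ≤ ratioSeries (legendreRatio' (-(1 - z) / 4)) 2 (1 - t) :=
    tsum_nonneg fun j => mul_nonneg (Finset.prod_nonneg fun i _ =>
      legendreRatio'_nonneg (by linarith) (by omega)) (pow_nonneg (by linarith) _)
  have : -(1 - z) / 4 / 2 ≤ 0 := by linarith
  exact mul_nonpos_of_nonpos_of_nonneg this (by assumption)

theorem strictMonoOn_profF (hz0 : 0 ≤ z) (hz1 : z ≤ 0.15605) :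
    StrictMonoOn (profF z) (Ioc (-1) 1) := by
  refine strictMonoOn_of_deriv_pos (convex_Ioc _ _) (fun s hs =>
    (hasDerivAt_profF hz0 hz1 hs.1 (by linarith [hs.2])).continuousAt.continuousWithinAt) ?_
  intro s hs
  rw [interior_Ioc] at hs
  rw [(hasDerivAt_profF hz0 hz1 hs.1 (by linarith [hs.2])).deriv]
  exact profF'_pos hz1 hz0 hs.1 hs.2.le

/-- The zero of `F`, with the bound of the slope there. -/
theorem exists_zero_profF (hz0 : 0 ≤ z) (hz1 : z ≤ 0.15605) : ∃ t₀ : ℝ, profF z t₀ = 0 ∧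
    -0.2 < t₀ ∧ t₀ < 0.01 ∧ 0.9996 - 0.409 * z + 0.18 * z ^ 2 < (1 - t₀ ^ 2) * profF' z t₀ ^ 2 := by
  have hz2 : z ^ 2 ≤ 0.0244 := by nlinarith
  have hz3 : 0 ≤ z ^ 2 := sq_nonneg z
  have h1 := legendreFn_neg_of_left hz0 hz1
  have h2 := legendreFn_pos_of_right hz0 hz1
  set a := -(0.6664 * z + 0.46 * z ^ 2) with ha
  have hc : ContinuousOn (profF z) (Icc (a - 0.001) (a + 0.001)) := fun s hs =>
    (hasDerivAt_profF hz0 hz1 (by linarith [hs.1]) (by linarith [hs.2])).continuousAt.continuousWithinAt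
  obtain ⟨t₀, ht, h0⟩ := intermediate_value_Icc (by linarith) hc ⟨h1.le, h2.le⟩
  exact ⟨t₀, h0, by linarith [ht.1], by linarith [ht.2],
    slope_lower_bound hz0 hz1 ht.1 ht.2⟩

/-! ### The gradient along the zero set of `v` -/

/-- The logarithmic derivative of `g`. -/
def logSlope (z t : ℝ) : ℝ := profG' z t / profG z t

/-- `F' - F g' / g`. -/
def crossSlope (z t : ℝ) : ℝ := profF' z t - logSlope z t * profF z t

/-- The squared length of the gradient of `v` at a zero of `v`. -/
def energy (z t : ℝ) : ℝ := 9 / 4 * (1 - z) * profF z t ^ 2 + (1 - t ^ 2) * crossSlope z t ^ 2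

/-- The Riccati equation of g'/g. -/
theorem hasDerivAt_logSlope (hz0 : 0 ≤ z) (hz1 : z ≤ 0.15605) (ht0 : -1 < t) (ht1 : t < 1) :
    HasDerivAt (logSlope z)
      ((2 * t * logSlope z t + (1 - z) / 4) / (1 - t ^ 2) - logSlope z t ^ 2) t := by
  have hg : profG z t ≠ 0 := by linarith [one_le_profG hz0 hz1 ht0 ht1.le]
  have hpos : 1 - t ^ 2 ≠ 0 := by nlinarith
  refine ((hasDerivAt_profG' hz0 hz1 ht0 ht1).div
    (hasDerivAt_profG hz0 hz1 ht0 (by linarith)) hg).congr_deriv ?_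
  unfold logSlope
  field_simp

theorem hasDerivAt_crossSlope (hz0 : 0 ≤ z) (hz1 : z ≤ 0.15605) (ht0 : -1 < t) (ht1 : t < 1) :
    HasDerivAt (crossSlope z) ((2 * t * crossSlope z t - 9 / 4 * (1 - z) * profF z t) / (1 - t ^ 2) -
      logSlope z t * crossSlope z t) t := by
  have hpos : 1 - t ^ 2 ≠ 0 := by nlinarith
  refine ((hasDerivAt_profF' hz0 hz1 ht0 ht1).sub ((hasDerivAt_logSlope hz0 hz1 ht0 ht1).mul
    (hasDerivAt_profF hz0 hz1 ht0 (by linarith)))).congr_deriv ?_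
  unfold crossSlope
  field_simp
  ring

/-- The factor that decides the sign of the derivative of `energy`. -/
def energyFactor (z t : ℝ) : ℝ := t - (1 - t ^ 2) * logSlope z t +
  9 / 4 * (1 - z) * (logSlope z t * (profF z t / crossSlope z t) ^ 2)

theorem hasDerivAt_energy (hz0 : 0 ≤ z) (hz1 : z ≤ 0.15605) (ht0 : -1 < t) (ht1 : t < 1)
    (hJ : crossSlope z t ≠ 0) :
    HasDerivAt (energy z) (2 * crossSlope z t ^ 2 * energyFactor z t) t := by
  have hpos : 1 - t ^ 2 ≠ 0 := by nlinarith
  have e1 := (((hasDerivAt_profF hz0 hz1 ht0 (by linarith)).pow 2).const_mul (9 / 4 * (1 - z)))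
  have e2 := ((hasDerivAt_pow 2 t).const_sub 1).mul
    ((hasDerivAt_crossSlope hz0 hz1 ht0 ht1).pow 2)
  refine (e1.add e2).congr_deriv ?_
  have hF' : profF' z t = crossSlope z t + logSlope z t * profF z t := by
    unfold crossSlope; ring
  unfold energyFactor
  simp only [hF']
  field_simp
  norm_num
  ring

/-- The Wronskian identity; 9/4 (1-z) is the difference of the two Legendre parameters. -/
theorem hasDerivAt_cross (hz0 : 0 ≤ z) (hz1 : z ≤ 0.15605) (ht0 : -1 < t) (ht1 : t < 1) :
    HasDerivAt (fun t => (1 - t ^ 2) * profF' z t * profG z t - profF z t * ((1 - t ^ 2) * profG' z t))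
      (-(9 / 4 * (1 - z)) * profF z t * profG z t) t := by
  have hx : |1 - t| < 2 := abs_lt.2 ⟨by linarith, by linarith⟩
  have e1 := hasDerivAt_flux_legendreFn (β := 2 * (1 - z)) (by linarith) (by linarith) hx
  have e2 := hasDerivAt_flux_legendreFn (β := -(1 - z) / 4) (by linarith) (by linarith) hx
  refine ((e1.mul (hasDerivAt_profG hz0 hz1 ht0 (by linarith))).sub
    ((hasDerivAt_profF hz0 hz1 ht0 (by linarith)).mul e2)).congr_deriv ?_
  ring

/-- `|g'| (1 + t) ≤ (1 - z) g / 4`. -/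
theorem logSlope_bound (hz0 : 0 ≤ z) (hz1 : z ≤ 0.15605) (ht0 : -1 < t) (ht1 : t < 1) :
    -((1 - z) / 4) ≤ (1 + t) * logSlope z t := by
  have hd : ∀ s ∈ Ioc (-1 : ℝ) 1, HasDerivAt
      (fun t => (1 - t ^ 2) * profG' z t + (1 - z) / 4 * ((1 - t) * profG z t))
      ((1 - z) / 4 * ((1 - s) * profG' z s)) s := by
    intro s hs
    have hx : |1 - s| < 2 := abs_lt.2 ⟨by linarith [hs.2], by linarith [hs.1]⟩
    have e2 := hasDerivAt_flux_legendreFn (β := -(1 - z) / 4) (by linarith) (by linarith) hx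
    have e3 := (((hasDerivAt_id s).const_sub 1).mul
      (hasDerivAt_profG hz0 hz1 hs.1 (by linarith [hs.2]))).const_mul ((1 - z) / 4)
    refine (e2.add e3).congr_deriv ?_
    simp only [id]
    ring
  -- The function decreases because g' ≤ 0, and it vanishes at t = 1; so it is nonnegative before,
  -- and division by 1 - t gives the claim.
  have hanti : AntitoneOn (fun t => (1 - t ^ 2) * profG' z t + (1 - z) / 4 * ((1 - t) * profG z t))
      (Ioc (-1) 1) := by
    refine antitoneOn_of_deriv_nonpos (convex_Ioc _ _) (fun s hs =>
      (hd s hs).continuousAt.continuousWithinAt) (fun s hs =>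
      (hd s (interior_subset hs)).differentiableAt.differentiableWithinAt) fun s hs => ?_
    rw [(hd s (interior_subset hs)).deriv]
    have hs' := interior_subset hs
    have : profG' z s ≤ 0 := by
      rcases profG'_nonpos hz1 (t := s) with h | h | h
      · exact h
      · linarith [hs'.2]
      · linarith [hs'.1]
    have := mul_nonneg (mul_nonneg (by linarith : 0 ≤ (1 - z) / 4) (sub_nonneg.2 hs'.2))
      (neg_nonneg.2 this)
    linarith
  have h := hanti ⟨ht0, ht1.le⟩ (right_mem_Ioc.2 (by norm_num)) ht1.le
  simp only [one_pow, sub_self, zero_mul, mul_zero, add_zero] at h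
  have hg := one_le_profG hz0 hz1 ht0 ht1.le
  have h2 : 0 ≤ (1 - t) * ((1 + t) * profG' z t + (1 - z) / 4 * profG z t) := by linarith
  have h3 := nonneg_of_mul_nonneg_right h2 (by linarith)
  unfold logSlope
  rw [← mul_div_assoc, le_div_iff₀ (by linarith)]
  linarith

theorem logSlope_nonpos (hz0 : 0 ≤ z) (hz1 : z ≤ 0.15605) (ht0 : -1 < t) (ht1 : t < 1) :
    logSlope z t ≤ 0 := by
  have hg := one_le_profG hz0 hz1 ht0 ht1.le
  refine div_nonpos_of_nonpos_of_nonneg ?_ (by linarith)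
  rcases profG'_nonpos hz1 (t := t) with h | h | h
  · exact h
  · linarith
  · linarith

end

/-! ### Monotonicity between the cut angle and the zero of F -/

section

variable {z t t₀ : ℝ}

theorem profF_nonpos_of_le (hz0 : 0 ≤ z) (hz1 : z ≤ 0.15605) (h0 : profF z t₀ = 0) (ht₀ : t₀ ≤ 1)
    (ht : -1 < t) (htt : t ≤ t₀) : profF z t ≤ 0 :=
  h0 ▸ (strictMonoOn_profF hz0 hz1).monotoneOn ⟨ht, htt.trans ht₀⟩ ⟨ht.trans_le htt, ht₀⟩ htt

theorem cut_bounds_prof (hz0 : 0 ≤ z) (hz1 : z ≤ 0.15605) (ht : t = -0.44 + 0.705 * z) :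
    0 < profF' z t * profG z t - profF z t * profG' z t ∧
      9 / 4 * (1 - z) * profF z t ^ 2 * profG z t ^ 2 +
        (1 - t ^ 2) * (profF' z t * profG z t - profF z t * profG' z t) ^ 2 <
      (0.9996 - 0.409 * z + 0.18 * z ^ 2) * profG z t ^ 2 := cut_bounds hz0 hz1 ht

theorem energy_cut_lt (hz0 : 0 ≤ z) (hz1 : z ≤ 0.15605) :
    energy z (-0.44 + 0.705 * z) < 0.9996 - 0.409 * z + 0.18 * z ^ 2 := by
  have h := (cut_bounds_prof hz0 hz1 rfl).2
  set t := -0.44 + 0.705 * z with ht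
  have hg := one_le_profG hz0 hz1 (t := t) (by linarith) (by linarith)
  have hg2 : 0 < profG z t ^ 2 := by positivity
  refine lt_of_mul_lt_mul_right (lt_of_eq_of_lt ?_ h) hg2.le
  have : profG z t ≠ 0 := by linarith
  unfold energy crossSlope logSlope
  generalize profG z t = g at *
  generalize profG' z t = g' at *
  generalize profF z t = f at *
  generalize profF' z t = f' at *
  field_simp

/-- The weighted Wronskian is positive at T by `cut_bounds` and increases as long as F ≤ 0, that is,
up to t₀. -/
theorem crossSlope_pos (hz0 : 0 ≤ z) (hz1 : z ≤ 0.15605) (h0 : profF z t₀ = 0) (ht₀ : t₀ < 0.01)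
    (ht : -0.44 + 0.705 * z ≤ t) (htt : t ≤ t₀) : 0 < crossSlope z t := by
  have hmono : MonotoneOn (fun t => (1 - t ^ 2) * profF' z t * profG z t -
      profF z t * ((1 - t ^ 2) * profG' z t)) (Icc (-0.44 + 0.705 * z) t₀) := by
    have hd : ∀ s ∈ Icc (-0.44 + 0.705 * z) t₀, _ := fun s hs =>
      hasDerivAt_cross hz0 hz1 (t := s) (by linarith [hs.1]) (by linarith [hs.2])
    refine monotoneOn_of_deriv_nonneg (convex_Icc _ _) (fun s hs =>
      (hd s hs).continuousAt.continuousWithinAt) (fun s hs =>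
      (hd s (interior_subset hs)).differentiableAt.differentiableWithinAt) fun s hs => ?_
    rw [(hd s (interior_subset hs)).deriv]
    have hs := interior_subset hs
    have h1 := profF_nonpos_of_le hz0 hz1 h0 (by linarith) (by linarith [hs.1] : -1 < s) hs.2
    have h2 := one_le_profG hz0 hz1 (t := s) (by linarith [hs.1]) (by linarith [hs.2])
    have h3 := mul_nonneg (mul_nonneg (by linarith : 0 ≤ 9 / 4 * (1 - z)) (neg_nonneg.2 h1))
      (by linarith : 0 ≤ profG z s)
    linarith
  have h := hmono ⟨le_rfl, ht.trans htt⟩ ⟨ht, htt⟩ ht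
  have hc := (cut_bounds_prof hz0 hz1 rfl).1
  set T := -0.44 + 0.705 * z with hTd
  simp only at h
  have hT : 0 < 1 - T ^ 2 := by nlinarith [show T = -0.44 + 0.705 * z from rfl]
  have ht2 : 0 < 1 - t ^ 2 := by nlinarith [show T = -0.44 + 0.705 * z from rfl]
  have hg := one_le_profG hz0 hz1 (t := t) (by linarith) (by linarith)
  have h1 := mul_pos hT hc
  have h2 : 0 < (1 - t ^ 2) * (profF' z t * profG z t - profF z t * profG' z t) := by
    linarith
  have h3 := pos_of_mul_pos_right h2 ht2.le
  have : crossSlope z t = (profF' z t * profG z t - profF z t * profG' z t) / profG z t := by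
    unfold crossSlope logSlope
    field_simp
  rw [this]
  exact div_pos h3 (by linarith)

/-- In the Riccati equation for h = g'/g, multiplied by 1 - s² and 1 + s, the bound (1+s)|h| ≤
(1-z)/4 keeps the quadratic term below the constant one for s ≥ -0.44. The term 2sh helps for s ≤ 0
and is small for s < 0.01. -/
theorem monotoneOn_logSlope (hz0 : 0 ≤ z) (hz1 : z ≤ 0.15605) (ht₀ : t₀ < 0.01) :
    MonotoneOn (logSlope z) (Icc (-0.44) t₀) := by
  have hd : ∀ s ∈ Icc (-0.44) t₀, _ := fun s hs =>
    hasDerivAt_logSlope hz0 hz1 (t := s) (by linarith [hs.1]) (by linarith [hs.2])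
  refine monotoneOn_of_deriv_nonneg (convex_Icc _ _) (fun s hs =>
    (hd s hs).continuousAt.continuousWithinAt) (fun s hs =>
    (hd s (interior_subset hs)).differentiableAt.differentiableWithinAt) fun s hs => ?_
  rw [(hd s (interior_subset hs)).deriv]
  obtain ⟨hs1, hs2⟩ := interior_subset hs
  have a1 := logSlope_bound hz0 hz1 (t := s) (by linarith) (by linarith)
  have a2 := logSlope_nonpos hz0 hz1 (t := s) (by linarith) (by linarith)
  set h := logSlope z s
  have hpos : 0 < 1 - s ^ 2 := by nlinarith
  rw [sub_nonneg, le_div_iff₀ hpos]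
  have e1 : (1 + s) * h * ((1 + s) * h) ≤ (1 - z) / 4 * ((1 - z) / 4) := by
    rw [← sq, ← sq]
    exact sq_le_sq' a1 ((mul_nonpos_of_nonneg_of_nonpos (by linarith) a2).trans (by linarith))
  have e2 : (1 - s) * ((1 + s) * h * ((1 + s) * h)) ≤ (1 - s) * ((1 - z) / 4 * ((1 - z) / 4)) :=
    mul_le_mul_of_nonneg_left e1 (by linarith)
  have e3 : -(0.02 * ((1 - z) / 4)) ≤ (1 + s) * (2 * s * h) := by
    rcases le_total s 0 with h' | h'
    · have := mul_nonneg (mul_nonneg (neg_nonneg.2 h') (neg_nonneg.2 a2)) (by linarith : 0 ≤ 1 + s)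
      nlinarith
    · nlinarith
  refine le_of_mul_le_mul_left ?_ (by linarith : 0 < 1 + s)
  have e4 : (1 + s) * (h ^ 2 * (1 - s ^ 2)) = (1 - s) * ((1 + s) * h * ((1 + s) * h)) := by ring
  rw [e4, mul_add]
  refine e2.trans ?_
  nlinarith

/-- By the Riccati equation (1-t²)g'/g has derivative at most (1-z)/4 < 1. -/
theorem monotoneOn_shift (hz0 : 0 ≤ z) (hz1 : z ≤ 0.15605) (ht₀ : t₀ < 0.01) :
    MonotoneOn (fun t => t - (1 - t ^ 2) * logSlope z t) (Icc (-0.44) t₀) := by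
  have hd : ∀ s ∈ Icc (-0.44) t₀, HasDerivAt (fun t => t - (1 - t ^ 2) * logSlope z t)
      (1 - ((1 - z) / 4 - (1 - s ^ 2) * logSlope z s ^ 2)) s := fun s hs => by
    have hpos : 1 - s ^ 2 ≠ 0 := by nlinarith [hs.1, hs.2]
    refine ((hasDerivAt_id s).sub (((hasDerivAt_pow 2 s).const_sub 1).mul
      (hasDerivAt_logSlope hz0 hz1 (t := s) (by linarith [hs.1]) (by linarith [hs.2])))).congr_deriv ?_
    field_simp
    norm_num
    ring
  refine monotoneOn_of_deriv_nonneg (convex_Icc _ _) (fun s hs =>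
    (hd s hs).continuousAt.continuousWithinAt) (fun s hs =>
    (hd s (interior_subset hs)).differentiableAt.differentiableWithinAt) fun s hs => ?_
  rw [(hd s (interior_subset hs)).deriv]
  obtain ⟨hs1, hs2⟩ := interior_subset hs
  have : 0 ≤ (1 - s ^ 2) * logSlope z s ^ 2 := mul_nonneg (by nlinarith) (sq_nonneg _)
  linarith

/-- Let h = g'/g and J = F' - hF. Up to the factor 1 - s², the numerator of the derivative is the
positive quadratic form (1-s²)J² - 2sFJ + 9/4 (1-z)F² plus a multiple of hFJ, which is nonnegative
because h ≤ 0, F ≤ 0 and J > 0. -/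
theorem monotoneOn_quotient (hz0 : 0 ≤ z) (hz1 : z ≤ 0.15605) (h0 : profF z t₀ = 0)
    (ht₀ : t₀ < 0.01) :
    MonotoneOn (fun t => profF z t / crossSlope z t) (Icc (-0.44 + 0.705 * z) t₀) := by
  have hd : ∀ s ∈ Icc (-0.44 + 0.705 * z) t₀, _ := fun s hs =>
    (hasDerivAt_profF hz0 hz1 (t := s) (by linarith [hs.1]) (by linarith [hs.2])).div
    (hasDerivAt_crossSlope hz0 hz1 (t := s) (by linarith [hs.1]) (by linarith [hs.2]))
    (crossSlope_pos hz0 hz1 h0 ht₀ hs.1 hs.2).ne'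
  refine monotoneOn_of_deriv_nonneg (convex_Icc _ _) (fun s hs =>
    (hd s hs).continuousAt.continuousWithinAt) (fun s hs =>
    (hd s (interior_subset hs)).differentiableAt.differentiableWithinAt) fun s hs => ?_
  have e := (hd s (interior_subset hs)).deriv
  refine le_of_le_of_eq ?_ e.symm
  obtain ⟨hs1, hs2⟩ := interior_subset hs
  refine div_nonneg ?_ (sq_nonneg _)
  have hJ := crossSlope_pos hz0 hz1 h0 ht₀ hs1 hs2
  have hF := profF_nonpos_of_le hz0 hz1 h0 (by linarith) (by linarith : -1 < s) hs2
  have hh := logSlope_nonpos hz0 hz1 (t := s) (by linarith) (by linarith)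
  have hF' : profF' z s = crossSlope z s + logSlope z s * profF z s := by
    unfold crossSlope; ring
  rw [hF']
  set F := profF z s
  set J := crossSlope z s
  set h := logSlope z s
  have hpos : 0 < 1 - s ^ 2 := by nlinarith
  have key : 0 ≤ ((1 - s ^ 2) * J ^ 2 - 2 * s * (F * J) + 9 / 4 * (1 - z) * F ^ 2) +
      2 * (1 - s ^ 2) * (h * F * J) := by
    have k1 : 0 ≤ h * F * J := mul_nonneg (mul_nonneg_of_nonpos_of_nonpos hh hF) hJ.le
    have k2 : 0 ≤ (1 - s ^ 2) * (h * F * J) := mul_nonneg hpos.le k1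
    have k3 : 0.8 * J ^ 2 ≤ (1 - s ^ 2) * J ^ 2 :=
      mul_le_mul_of_nonneg_right (by nlinarith) (sq_nonneg _)
    have k4 : 1.8 * F ^ 2 ≤ 9 / 4 * (1 - z) * F ^ 2 :=
      mul_le_mul_of_nonneg_right (by linarith) (sq_nonneg _)
    have k5 : 0 ≤ -F * J := mul_nonneg (neg_nonneg.2 hF) hJ.le
    have k6 : -(2 * s * (F * J)) ≥ -(0.88 * (-F * J)) := by nlinarith
    nlinarith [sq_nonneg (J + F), sq_nonneg F, sq_nonneg J]
  have : (J + h * F) * J - F * ((2 * s * J - 9 / 4 * (1 - z) * F) / (1 - s ^ 2) - h * J) =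
      (((1 - s ^ 2) * J ^ 2 - 2 * s * (F * J) + 9 / 4 * (1 - z) * F ^ 2) +
        2 * (1 - s ^ 2) * (h * F * J)) / (1 - s ^ 2) := by
    field_simp
    ring
  rw [this]
  exact div_nonneg key hpos.le

/-- Besides the shift, the factor contains h (F/J)² with h ≤ 0 increasing. As F/J ≤ 0 increases, its
square decreases, so the product increases. -/
theorem monotoneOn_energyFactor (hz0 : 0 ≤ z) (hz1 : z ≤ 0.15605) (h0 : profF z t₀ = 0)
    (ht₀ : t₀ < 0.01) : MonotoneOn (energyFactor z) (Icc (-0.44 + 0.705 * z) t₀) := by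
  intro a ha b hb hab
  have ha' : a ∈ Icc (-0.44) t₀ := ⟨by linarith [ha.1], ha.2⟩
  have hb' : b ∈ Icc (-0.44) t₀ := ⟨by linarith [hb.1], hb.2⟩
  have e1 := monotoneOn_shift hz0 hz1 ht₀ ha' hb' hab
  have e2 := monotoneOn_logSlope hz0 hz1 ht₀ ha' hb' hab
  have e3 := monotoneOn_quotient hz0 hz1 h0 ht₀ ha hb hab
  simp only at e1 e3
  have n1 := logSlope_nonpos hz0 hz1 (t := b) (by linarith [hb.1]) (by linarith [hb.2])
  have n2 : profF z b / crossSlope z b ≤ 0 := div_nonpos_of_nonpos_of_nonneg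
    (profF_nonpos_of_le hz0 hz1 h0 (by linarith) (by linarith [hb.1]) hb.2)
    (crossSlope_pos hz0 hz1 h0 ht₀ hb.1 hb.2).le
  have e4 : (profF z b / crossSlope z b) ^ 2 ≤ (profF z a / crossSlope z a) ^ 2 := by nlinarith
  have e5 : logSlope z a * (profF z a / crossSlope z a) ^ 2 ≤
      logSlope z b * (profF z b / crossSlope z b) ^ 2 := by
    nlinarith [sq_nonneg (profF z b / crossSlope z b), sq_nonneg (profF z a / crossSlope z a)]
  have e6 := mul_le_mul_of_nonneg_left e5 (by linarith : 0 ≤ 9 / 4 * (1 - z))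
  unfold energyFactor
  linarith

/-- Along the zero set of `v` above the angle `T` the gradient is shorter than at the zero. -/
theorem energy_lt (hz0 : 0 ≤ z) (hz1 : z ≤ 0.15605) (h0 : profF z t₀ = 0) (ht₀ : t₀ < 0.01)
    (hk : 0.9996 - 0.409 * z + 0.18 * z ^ 2 < (1 - t₀ ^ 2) * profF' z t₀ ^ 2)
    (ht : -0.44 + 0.705 * z < t) (htt : t < t₀) :
    energy z t < (1 - t₀ ^ 2) * profF' z t₀ ^ 2 := by
  have hcut := energy_cut_lt hz0 hz1
  have hend : energy z t₀ = (1 - t₀ ^ 2) * profF' z t₀ ^ 2 := by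
    simp [energy, crossSlope, h0]
  set T := -0.44 + 0.705 * z with hT
  have hd : ∀ s ∈ Icc T t₀, HasDerivAt (energy z) (2 * crossSlope z s ^ 2 * energyFactor z s) s :=
    fun s hs => hasDerivAt_energy hz0 hz1 (by linarith [hs.1]) (by linarith [hs.2])
      (crossSlope_pos hz0 hz1 h0 ht₀ hs.1 hs.2).ne'
  -- If the energy at t reached its value at t₀ it would exceed that at T, so the factor would be
  -- positive somewhere in between. By monotonicity the energy would then increase strictly from t
  -- to t₀, a contradiction.
  by_contra! hc
  obtain ⟨ξ, hξ, e⟩ := exists_hasDerivAt_eq_slope (energy z) _ ht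
    (fun s hs => (hd s ⟨hs.1, hs.2.trans htt.le⟩).continuousAt.continuousWithinAt)
    (fun s hs => hd s ⟨hs.1.le, hs.2.le.trans htt.le⟩)
  have hpos : 0 < energyFactor z ξ := by
    have h1 : 0 < 2 * crossSlope z ξ ^ 2 * energyFactor z ξ := by
      rw [e]
      exact div_pos (by linarith) (by linarith)
    exact pos_of_mul_pos_right h1 (by positivity)
  have hmono : StrictMonoOn (energy z) (Icc t t₀) := by
    refine strictMonoOn_of_deriv_pos (convex_Icc _ _) (fun s hs =>
      (hd s ⟨ht.le.trans hs.1, hs.2⟩).continuousAt.continuousWithinAt) fun s hs => ?_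
    have hs := interior_subset hs
    have hs' : s ∈ Icc T t₀ := ⟨ht.le.trans hs.1, hs.2⟩
    rw [(hd s hs').deriv]
    have := monotoneOn_energyFactor hz0 hz1 h0 ht₀ ⟨hξ.1.le, hξ.2.le.trans htt.le⟩ hs'
      (hξ.2.le.trans hs.1)
    have hJ := crossSlope_pos hz0 hz1 h0 ht₀ hs'.1 hs'.2
    have : 0 < energyFactor z s := by linarith
    positivity
  have := hmono (left_mem_Icc.2 htt.le) (right_mem_Icc.2 htt.le) htt
  linarith

end

/-! ### The logarithmic singularity at `t = -1` -/

/-- The right side starts at -β for n = 1 and does not decrease, since n² + n - β ≥ n(n + 1). -/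
theorem le_mul_legendreCoeff {β : ℝ} (h2 : β ≤ 0) {n : ℕ} (hn : 1 ≤ n) :
    -β ≤ n * (legendreCoeff β n * 2 ^ n) := by
  induction n, hn using Nat.le_induction with
  | base =>
    simp [legendreCoeff]
    linarith
  | succ n hn ih =>
    have hn' : (1 : ℝ) ≤ n := by exact_mod_cast hn
    have h0 : 0 ≤ legendreCoeff β n * 2 ^ n := by
      by_contra! h
      nlinarith
    rw [legendreCoeff_succ, pow_succ 2 n]
    push_cast
    have e : ((n : ℝ) + 1) * (legendreCoeff β n * (((n : ℝ) ^ 2 + n - β) / (2 * ((n : ℝ) + 1) ^ 2)) *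
        (2 ^ n * 2)) = (legendreCoeff β n * 2 ^ n) * (((n : ℝ) ^ 2 + n - β) / (n + 1)) := by
      field_simp
    rw [e]
    refine ih.trans ?_
    rw [mul_comm]
    refine mul_le_mul_of_nonneg_left ?_ h0
    rw [le_div_iff₀ (by positivity)]
    nlinarith

theorem legendreCoeff_nonneg {β : ℝ} (h2 : β ≤ 0) (n : ℕ) : 0 ≤ legendreCoeff β n := by
  induction n with
  | zero => simp [legendreCoeff]
  | succ n ih =>
    rw [legendreCoeff_succ]
    exact mul_nonneg ih (div_nonneg (by nlinarith [sq_nonneg (n : ℝ), (n.cast_nonneg : (0 : ℝ) ≤ n)])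
      (by positivity))

/-- At t = -1 the terms dominate -β times the harmonic series. Since all coefficients are
nonnegative, the function stays above each of its continuous partial sums. -/
theorem tendsto_legendreFn_atTop {β : ℝ} (h1 : -1 ≤ β) (h2 : β < 0) :
    Tendsto (legendreFn β) (𝓝[>] (-1)) atTop := by
  rw [tendsto_atTop]
  intro M
  obtain ⟨N, hN⟩ := (tendsto_atTop.1 Real.tendsto_sum_range_one_div_nat_succ_atTop
    ((M + 1) / -β)).exists
  have hβ : 0 < -β := by linarith
  rw [div_le_iff₀ hβ] at hN
  set P : ℝ → ℝ := fun t => ∑ n ∈ Finset.range (N + 1), legendreCoeff β n * (1 - t) ^ n with hP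
  have hP1 : M < P (-1) := by
    have : ∑ i ∈ Finset.range N, 1 / ((i : ℝ) + 1) * -β ≤
        ∑ i ∈ Finset.range N, legendreCoeff β (i + 1) * (1 - (-1 : ℝ)) ^ (i + 1) := by
      refine Finset.sum_le_sum fun i _ => ?_
      have := le_mul_legendreCoeff h2.le (n := i + 1) (by omega)
      push_cast at this
      rw [one_div_mul_eq_div, div_le_iff₀ (by positivity)]
      norm_num
      linarith
    simp only [hP]
    rw [Finset.sum_range_succ']
    rw [Finset.sum_mul] at hN
    simp only [legendreCoeff, pow_zero, mul_one] at this ⊢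
    linarith
  have hcont : ContinuousAt P (-1) := by
    simp only [hP]
    fun_prop
  have hev : ∀ᶠ t in 𝓝[>] (-1 : ℝ), M < P t :=
    (hcont.tendsto.mono_left nhdsWithin_le_nhds).eventually (lt_mem_nhds hP1)
  filter_upwards [hev, Ioo_mem_nhdsGT (show (-1 : ℝ) < 1 by norm_num)] with t ht hI
  have hx : |1 - t| < 2 := abs_lt.2 ⟨by linarith [hI.2], by linarith [hI.1]⟩
  refine ht.le.trans ?_
  exact ((twoRadius_legendreCoeff h1 (by linarith)).hasSum hx).summable.sum_le_tsum _
    fun n _ => mul_nonneg (legendreCoeff_nonneg h2.le n) (pow_nonneg (by linarith [hI.2]) n)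

/-! ### Zonal profiles -/

/-- `h` is a smooth solution of the Legendre equation `(1 - t²) h'' - 2 t h' + μ h = 0` on the open
set `I`. -/
structure ZonalProfile (μ : ℝ) (h : ℝ → ℝ) (I : Set ℝ) : Prop where
  isOpen : IsOpen I
  contDiffOn : ContDiffOn ℝ ∞ h I
  ode : ∀ t ∈ I, (1 - t ^ 2) * deriv (deriv h) t - 2 * t * deriv h t + μ * h t = 0

theorem zonalProfile_legendreFn {β : ℝ} (h1 : -1 ≤ β) (h2 : β ≤ 2) :
    ZonalProfile β (legendreFn β) (Ioo (-1) 3) := by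
  refine ⟨isOpen_Ioo, contDiffOn_legendreFn h1 h2, fun t ht => ?_⟩
  have hx : ∀ s ∈ Ioo (-1 : ℝ) 3, |1 - s| < 2 := fun s hs =>
    abs_lt.2 ⟨by linarith [hs.2], by linarith [hs.1]⟩
  have hd := hasDerivAt_legendreFn h1 h2 (hx t ht)
  have heq : deriv (legendreFn β) =ᶠ[𝓝 t] legendreFn' β := by
    filter_upwards [isOpen_Ioo.mem_nhds ht] with s hs
    exact (hasDerivAt_legendreFn h1 h2 (hx s hs)).deriv
  have hd' : DifferentiableAt ℝ (legendreFn' β) t :=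
    ((contDiffOn_legendreFn' h1 h2).contDiffAt (isOpen_Ioo.mem_nhds ht)).differentiableAt (by simp)
  have e := (((hasDerivAt_pow 2 t).const_sub 1).mul hd'.hasDerivAt).unique
    (hasDerivAt_flux_legendreFn h1 h2 (hx t ht))
  rw [heq.deriv_eq, hd.deriv]
  norm_num at e
  linear_combination e

theorem legendreP_eq (n : ℕ) (t : ℝ) : legendreP n t = ∑ k ∈ Finset.range (n + 1),
    (-1 : ℝ) ^ k * n.choose k * (n + k).choose n * ((1 - t) / 2) ^ k := by
  simp [legendreP, Polynomial.shiftedLegendre, map_sum]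

theorem legendreP_zero (t : ℝ) : legendreP 0 t = 1 := by
  simp [legendreP_eq]

theorem legendreP_one (t : ℝ) : legendreP 1 t = t := by
  rw [legendreP_eq]
  norm_num [Finset.sum_range_succ]
  ring

theorem legendreP_two (t : ℝ) : legendreP 2 t = 3 / 2 * (t * t) - 1 / 2 := by
  rw [legendreP_eq]
  norm_num [Finset.sum_range_succ, Nat.choose]
  ring

theorem legendreP_three (t : ℝ) : legendreP 3 t = t * (5 / 2 * (t * t) - 3 / 2) := by
  rw [legendreP_eq]
  norm_num [Finset.sum_range_succ, Nat.choose]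
  ring

theorem zonalProfile_of_hasDerivAt {μ : ℝ} {h h' h'' : ℝ → ℝ} (hh : ContDiff ℝ ∞ h)
    (h1 : ∀ t, HasDerivAt h (h' t) t) (h2 : ∀ t, HasDerivAt h' (h'' t) t)
    (hode : ∀ t, (1 - t ^ 2) * h'' t - 2 * t * h' t + μ * h t = 0) : ZonalProfile μ h univ := by
  refine ⟨isOpen_univ, hh.contDiffOn, fun t _ => ?_⟩
  have e : deriv h = h' := funext fun s => (h1 s).deriv
  rw [e, (h2 t).deriv, hode]

theorem zonalProfile_id : ZonalProfile 2 (fun t => t) univ :=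
  zonalProfile_of_hasDerivAt contDiff_id (fun t => hasDerivAt_id t)
    (fun t => hasDerivAt_const t 1) (fun t => by ring)

theorem zonalProfile_two : ZonalProfile 6 (fun t => 3 / 2 * (t * t) - 1 / 2) univ :=
  zonalProfile_of_hasDerivAt (h' := fun t => 3 * t) (h'' := fun _ => 3) (by fun_prop)
    (fun t => (((hasDerivAt_id t).mul (hasDerivAt_id t)).const_mul (3 / 2) |>.sub_const
      (1 / 2)).congr_deriv (by simp; ring))
    (fun t => ((hasDerivAt_id t).const_mul 3).congr_deriv (by simp)) (fun t => by ring)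

theorem zonalProfile_three : ZonalProfile 12 (fun t => t * (5 / 2 * (t * t) - 3 / 2)) univ :=
  zonalProfile_of_hasDerivAt (h' := fun t => 15 / 2 * (t * t) - 3 / 2) (h'' := fun t => 15 * t)
    (by fun_prop)
    (fun t => ((hasDerivAt_id t).mul (((hasDerivAt_id t).mul (hasDerivAt_id t)).const_mul (5 / 2)
      |>.sub_const (3 / 2))).congr_deriv (by simp; ring))
    (fun t => (((hasDerivAt_id t).mul (hasDerivAt_id t)).const_mul (15 / 2) |>.sub_const
      (3 / 2)).congr_deriv (by simp; ring)) (fun t => by ring)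

theorem ZonalProfile.const_mul {μ : ℝ} {h : ℝ → ℝ} {I : Set ℝ} (H : ZonalProfile μ h I) (b : ℝ) :
    ZonalProfile μ (fun t => b * h t) I := by
  refine ⟨H.isOpen, contDiffOn_const.mul H.contDiffOn, fun t ht => ?_⟩
  have e : deriv (fun t => b * h t) = fun t => b * deriv h t := by
    funext s
    exact deriv_const_mul_field b
  rw [e, deriv_const_mul_field]
  linear_combination b * H.ode t ht

/-! ### The operator in divergence form -/

/-- The coordinate vectors. -/
def unitVec (i : Fin 3) : E3 := EuclideanSpace.single i (1 : ℝ)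

theorem unitVec_apply (i j : Fin 3) : unitVec i j = if j = i then 1 else 0 := by
  simp [unitVec]

theorem eq_sum_unitVec (y : E3) : y = ∑ i, y i • unitVec i := by
  ext j
  simp [unitVec_apply, Finset.sum_apply]

theorem map_eq_sum (L : E3 →L[ℝ] ℝ) (y : E3) : L y = ∑ i, y i * L (unitVec i) := by
  conv_lhs => rw [eq_sum_unitVec y]
  simp

theorem norm_sq_eq_sum (y : E3) : ‖y‖ ^ 2 = ∑ i, y i * y i := by
  rw [EuclideanSpace.norm_sq_eq]
  simp [sq]

/-- The covector `L` with its index raised by the inverse metric `I - k ŷ ŷᵀ`. -/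
def raise (k : ℝ) (L : E3 →L[ℝ] ℝ) (y : E3) (i : Fin 3) : ℝ :=
  L (unitVec i) - k * (L y * y i / ‖y‖ ^ 2)

/-- The divergence of a vector field given by its components. -/
def divergence (Y : E3 → Fin 3 → ℝ) (y : E3) : ℝ := ∑ i, fderiv ℝ (fun x => Y x i) y (unitVec i)

/-- The gradient field for the metric of the cone. -/
def coneFlux (k : ℝ) (u : E3 → ℝ) (y : E3) (i : Fin 3) : ℝ := raise k (fderiv ℝ u y) y i

theorem raise_add (k : ℝ) (L M : E3 →L[ℝ] ℝ) (y : E3) (i : Fin 3) :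
    raise k (L + M) y i = raise k L y i + raise k M y i := by
  simp [raise]
  ring

theorem raise_smul (k b : ℝ) (L : E3 →L[ℝ] ℝ) (y : E3) (i : Fin 3) :
    raise k (b • L) y i = b * raise k L y i := by
  simp [raise]
  ring

theorem sum_mul_raise (k : ℝ) (L M : E3 →L[ℝ] ℝ) (y : E3) : ∑ i, M (unitVec i) * raise k L y i =
    ∑ i, M (unitVec i) * L (unitVec i) - k * (L y * M y / ‖y‖ ^ 2) := by
  simp only [raise, mul_sub, Finset.sum_sub_distrib]
  rw [map_eq_sum M y, Finset.mul_sum, Finset.sum_div, Finset.mul_sum]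
  congr 1
  refine Finset.sum_congr rfl fun i _ => ?_
  ring

/-- Symmetry of the inverse metric; it cancels the first-order terms in Green's identity. -/
theorem sum_mul_raise_comm (k : ℝ) (L M : E3 →L[ℝ] ℝ) (y : E3) :
    ∑ i, M (unitVec i) * raise k L y i = ∑ i, L (unitVec i) * raise k M y i := by
  rw [sum_mul_raise, sum_mul_raise, mul_comm (L y)]
  simp only [mul_comm]

theorem sum_mul_raise_nonneg {k : ℝ} (hk0 : 0 ≤ k) (hk1 : k ≤ 1) (L : E3 →L[ℝ] ℝ) (y : E3) :
    0 ≤ ∑ i, L (unitVec i) * raise k L y i := by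
  rw [sum_mul_raise]
  have h : (L y) ^ 2 ≤ (∑ i, L (unitVec i) * L (unitVec i)) * ‖y‖ ^ 2 := by
    rw [map_eq_sum L y, norm_sq_eq_sum]
    have := Finset.sum_mul_sq_le_sq_mul_sq Finset.univ (fun i => y i) (fun i => L (unitVec i))
    simp only [sq] at this ⊢
    linarith
  have h0 : 0 ≤ ∑ i, L (unitVec i) * L (unitVec i) := Finset.sum_nonneg fun i _ => mul_self_nonneg _
  rcases eq_or_ne y 0 with rfl | hy
  · simpa using h0
  have hr : 0 < ‖y‖ ^ 2 := by positivity
  have h2 : L y * L y / ‖y‖ ^ 2 ≤ ∑ i, L (unitVec i) * L (unitVec i) := by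
    rw [div_le_iff₀ hr]
    linarith [sq (L y)]
  have h3 : 0 ≤ L y * L y / ‖y‖ ^ 2 := div_nonneg (mul_self_nonneg _) hr.le
  nlinarith

/-- The coordinate functionals. -/
abbrev coordProj (i : Fin 3) : E3 →L[ℝ] ℝ := EuclideanSpace.proj i

theorem hasFDerivAt_coord (y : E3) (i : Fin 3) :
    HasFDerivAt (fun x : E3 => x i) (coordProj i) y :=
  (coordProj i).hasFDerivAt

theorem contDiff_coord (i : Fin 3) {n : WithTop ℕ∞} : ContDiff ℝ n (fun x : E3 => x i) :=
  (coordProj i).contDiff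

theorem contDiffAt_raise {k : ℝ} {L : E3 → E3 →L[ℝ] ℝ} {y : E3} {n : WithTop ℕ∞} (hy : y ≠ 0)
    (hL : ContDiffAt ℝ n L y) (i : Fin 3) : ContDiffAt ℝ n (fun x => raise k (L x) x i) y := by
  unfold raise
  have h1 : ContDiffAt ℝ n (fun x : E3 => ‖x‖ ^ 2) y := (contDiff_norm_sq ℝ).contDiffAt
  refine (hL.clm_apply contDiffAt_const).sub (contDiffAt_const.mul
    (((hL.clm_apply contDiffAt_id).mul (contDiff_coord i).contDiffAt).div h1 ?_))
  simpa using hy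

theorem contDiffAt_coneFlux {k : ℝ} {u : E3 → ℝ} {y : E3} (hy : y ≠ 0) (hu : ContDiffAt ℝ 2 u y)
    (i : Fin 3) : ContDiffAt ℝ 1 (fun x => coneFlux k u x i) y :=
  contDiffAt_raise hy (hu.fderiv_right (by norm_num)) i

theorem divergence_congr {X Y : E3 → Fin 3 → ℝ} {y : E3} (h : X =ᶠ[𝓝 y] Y) :
    divergence X y = divergence Y y := by
  unfold divergence
  refine Finset.sum_congr rfl fun i _ => ?_
  have : (fun x => X x i) =ᶠ[𝓝 y] fun x => Y x i := h.mono fun x hx => congrFun hx i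
  rw [this.fderiv_eq]

theorem divergence_mul {φ : E3 → ℝ} {Y : E3 → Fin 3 → ℝ} {y : E3} (hφ : DifferentiableAt ℝ φ y)
    (hY : ∀ i, DifferentiableAt ℝ (fun x => Y x i) y) :
    divergence (fun x i => φ x * Y x i) y =
      φ y * divergence Y y + ∑ i, fderiv ℝ φ y (unitVec i) * Y y i := by
  unfold divergence
  rw [Finset.mul_sum, ← Finset.sum_add_distrib]
  refine Finset.sum_congr rfl fun i _ => ?_
  rw [fderiv_fun_mul hφ (hY i)]
  simp
  ring

theorem divergence_add {X Y : E3 → Fin 3 → ℝ} {y : E3}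
    (hX : ∀ i, DifferentiableAt ℝ (fun x => X x i) y)
    (hY : ∀ i, DifferentiableAt ℝ (fun x => Y x i) y) :
    divergence (fun x i => X x i + Y x i) y = divergence X y + divergence Y y := by
  unfold divergence
  rw [← Finset.sum_add_distrib]
  refine Finset.sum_congr rfl fun i _ => ?_
  rw [fderiv_fun_add (hX i) (hY i)]
  simp

theorem divergence_sub {X Y : E3 → Fin 3 → ℝ} {y : E3}
    (hX : ∀ i, DifferentiableAt ℝ (fun x => X x i) y)
    (hY : ∀ i, DifferentiableAt ℝ (fun x => Y x i) y) :
    divergence (fun x i => X x i - Y x i) y = divergence X y - divergence Y y := by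
  unfold divergence
  rw [← Finset.sum_sub_distrib]
  refine Finset.sum_congr rfl fun i _ => ?_
  rw [fderiv_fun_sub (hX i) (hY i)]
  simp

/-- The Laplace-Beltrami operator is the divergence of the gradient field. -/
theorem coneLaplacian_eq_divergence (c : ℝ) {u : E3 → ℝ} {y : E3} (hy : y ≠ 0)
    (hu : ContDiffAt ℝ 2 u y) :
    coneLaplacian c u y = divergence (coneFlux (c ^ 2 / (1 + c ^ 2)) u) y := by
  rw [coneLaplacian]
  generalize c ^ 2 / (1 + c ^ 2) = k
  have hd : DifferentiableAt ℝ (fderiv ℝ u) y :=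
    (hu.fderiv_right (m := 1) (by norm_num)).differentiableAt (by norm_num)
  set H := fderiv ℝ (fderiv ℝ u) y with hH
  have hr : ‖y‖ ≠ 0 := by simpa using hy
  have hterm : ∀ i, fderiv ℝ (fun x => coneFlux k u x i) y (unitVec i) =
      H (unitVec i) (unitVec i) - k * ((H (unitVec i) y * y i + fderiv ℝ u y (unitVec i) * y i +
        fderiv ℝ u y y) / ‖y‖ ^ 2 - 2 * fderiv ℝ u y y * (y i * y i) / ‖y‖ ^ 4) := by
    intro i
    have h1 : HasFDerivAt (fun x => fderiv ℝ u x (unitVec i)) (H.flip (unitVec i)) y := by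
      have := hd.hasFDerivAt.clm_apply (hasFDerivAt_const (unitVec i) y)
      refine this.congr_fderiv ?_
      ext v
      simp [hH]
    have h2 := hd.hasFDerivAt.clm_apply (hasFDerivAt_id y)
    have h3 := h2.mul (hasFDerivAt_coord y i)
    have h4 : HasFDerivAt (fun x : E3 => ‖x‖ ^ 2) (2 • innerSL ℝ y) y :=
      (hasStrictFDerivAt_norm_sq y).hasFDerivAt
    have h5 := (hasDerivAt_inv (𝕜 := ℝ) (pow_ne_zero 2 hr)).comp_hasFDerivAt y h4
    have h6 := h1.sub ((h3.mul h5).const_mul k)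
    have h7 : (fun x => coneFlux k u x i) = fun x => fderiv ℝ u x (unitVec i) -
        k * (fderiv ℝ u x (id x) * x i * (‖x‖ ^ 2)⁻¹) := by
      funext x
      simp [coneFlux, raise, div_eq_mul_inv]
    rw [h7, HasFDerivAt.fderiv (f := fun x => fderiv ℝ u x (unitVec i) -
        k * (fderiv ℝ u x (id x) * x i * (‖x‖ ^ 2)⁻¹)) h6]
    have h9 : (inner ℝ y (unitVec i) : ℝ) = y i := by
      rw [unitVec, EuclideanSpace.inner_single_right]
      simp
    simp [h9, unitVec_apply]
    field_simp
    ring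
  unfold divergence
  simp only [hterm]
  rw [InnerProductSpace.laplacian_eq_iteratedFDeriv_orthonormalBasis u
    (EuclideanSpace.basisFun (Fin 3) ℝ)]
  simp only [iteratedFDeriv_two_apply]
  simp only [Matrix.cons_val_zero, Matrix.cons_val_one, EuclideanSpace.basisFun_apply, radial,
    map_smul, _root_.smul_apply, ← hH]
  have e1 : H y y = ∑ i, H (unitVec i) y * y i := by
    have := map_eq_sum (H.flip y) y
    simp only [ContinuousLinearMap.flip_apply] at this
    rw [this]
    exact Finset.sum_congr rfl fun i _ => mul_comm _ _
  have e2 : fderiv ℝ u y y = ∑ i, fderiv ℝ u y (unitVec i) * y i := by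
    rw [map_eq_sum]
    exact Finset.sum_congr rfl fun i _ => mul_comm _ _
  have e3 := norm_sq_eq_sum y
  rw [Finset.sum_sub_distrib, ← Finset.mul_sum, Finset.sum_sub_distrib, ← Finset.sum_div,
    Finset.sum_add_distrib, Finset.sum_add_distrib, ← e1, ← e2, ← Finset.sum_div, ← Finset.mul_sum,
    ← e3]
  simp only [smul_eq_mul, Finset.sum_const, Finset.card_univ, Fintype.card_fin, unitVec]
  field_simp
  ring

/-! ### Functions of the radius and the angle -/

theorem hasFDerivAt_norm' {y : E3} (hy : y ≠ 0) :
    HasFDerivAt (fun x : E3 => ‖x‖) (‖y‖⁻¹ • innerSL ℝ y) y := by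
  have hr : ‖y‖ ≠ 0 := by simpa using hy
  have h := (hasStrictFDerivAt_norm_sq y).hasFDerivAt.sqrt (pow_ne_zero 2 hr)
  have e : (fun x : E3 => Real.sqrt (‖x‖ ^ 2)) = fun x => ‖x‖ := by
    funext x
    exact Real.sqrt_sq (norm_nonneg x)
  rw [e] at h
  refine h.congr_fderiv ?_
  rw [Real.sqrt_sq (norm_nonneg y)]
  ext v
  simp
  field_simp

/-- The covector with radial coefficient `A` and axial coefficient `B`. -/
def polarCovector (A B : ℝ) (y : E3) : E3 →L[ℝ] ℝ := A • innerSL ℝ y + B • coordProj 2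

theorem polarCovector_apply (A B : ℝ) (y v : E3) :
    polarCovector A B y v = A * inner ℝ y v + B * v 2 := by
  simp [polarCovector]

theorem polarCovector_unitVec (A B : ℝ) (y : E3) (i : Fin 3) :
    polarCovector A B y (unitVec i) = A * y i + B * (if 2 = i then 1 else 0) := by
  rw [polarCovector_apply, unitVec_apply]
  congr 2
  rw [unitVec, EuclideanSpace.inner_single_right]
  simp

theorem polarCovector_self (A B : ℝ) (y : E3) :
    polarCovector A B y y = A * ‖y‖ ^ 2 + B * y 2 := by
  rw [polarCovector_apply, real_inner_self_eq_norm_sq]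

theorem polarCovector_add (A B A' B' : ℝ) (y : E3) :
    polarCovector A B y + polarCovector A' B' y = polarCovector (A + A') (B + B') y := by
  ext v
  simp [polarCovector]
  ring

theorem mul_cosAngle (y : E3) : ‖y‖ * cosAngle y = y 2 := by
  rcases eq_or_ne y 0 with rfl | hy
  · simp
  · exact mul_div_cancel₀ _ (by simpa using hy)

theorem hasFDerivAt_cosAngle {y : E3} (hy : y ≠ 0) :
    HasFDerivAt cosAngle (polarCovector (-(‖y‖ ^ (-2 : ℝ) * cosAngle y)) (‖y‖ ^ (-1 : ℝ)) y) y := by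
  have hr : ‖y‖ ≠ 0 := by simpa using hy
  have h := (hasFDerivAt_coord y 2).mul
    ((hasDerivAt_inv (𝕜 := ℝ) hr).comp_hasFDerivAt y (hasFDerivAt_norm' hy))
  have e : cosAngle = fun x => x 2 * ‖x‖⁻¹ := by
    funext x
    rw [cosAngle, div_eq_mul_inv]
  rw [e]
  refine HasFDerivAt.congr_fderiv (f := fun x : E3 => x 2 * ‖x‖⁻¹) h ?_
  ext v
  rw [polarCovector_apply, Real.rpow_neg (norm_nonneg y), Real.rpow_neg (norm_nonneg y)]
  simp
  field_simp

/-- The function `r ^ a h(t)`. -/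
def polarTerm (a : ℝ) (h : ℝ → ℝ) (y : E3) : ℝ := ‖y‖ ^ a * h (cosAngle y)

theorem hasFDerivAt_polarTerm {a h' : ℝ} {h : ℝ → ℝ} {y : E3} (hy : y ≠ 0)
    (hh : HasDerivAt h h' (cosAngle y)) :
    HasFDerivAt (polarTerm a h) (polarCovector (‖y‖ ^ (a - 2) * (a * h (cosAngle y) -
      cosAngle y * h')) (‖y‖ ^ (a - 1) * h') y) y := by
  have hr : 0 < ‖y‖ := by simpa using hy
  have e := ((hasFDerivAt_norm' hy).rpow_const (p := a) (Or.inl hr.ne')).mul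
    (hh.comp_hasFDerivAt y (hasFDerivAt_cosAngle hy))
  refine HasFDerivAt.congr_fderiv (f := polarTerm a h) e ?_
  ext v
  have e1 : ‖y‖ ^ (a - 2) = ‖y‖ ^ a * (‖y‖ ^ 2)⁻¹ := by
    rw [Real.rpow_sub hr, div_eq_mul_inv]
    norm_cast
  have e2 : ‖y‖ ^ (a - 1) = ‖y‖ ^ a * ‖y‖⁻¹ := by
    rw [Real.rpow_sub hr, Real.rpow_one, div_eq_mul_inv]
  have e3 : ‖y‖ ^ (-2 : ℝ) = (‖y‖ ^ 2)⁻¹ := by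
    rw [Real.rpow_neg hr.le]
    norm_cast
  have e4 : ‖y‖ ^ (-1 : ℝ) = ‖y‖⁻¹ := by
    rw [Real.rpow_neg hr.le, Real.rpow_one]
  simp [polarCovector_apply, e1, e2, e3, e4]
  field_simp
  ring

theorem contDiffAt_cosAngle {y : E3} (hy : y ≠ 0) {n : ℕ∞} : ContDiffAt ℝ n cosAngle y :=
  (contDiff_coord 2).contDiffAt.div (contDiffAt_norm ℝ hy) (by simpa using hy)

theorem contDiffAt_polarTerm {a : ℝ} {h : ℝ → ℝ} {y : E3} {n : ℕ∞} (hy : y ≠ 0)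
    (hh : ContDiffAt ℝ n h (cosAngle y)) : ContDiffAt ℝ n (polarTerm a h) y :=
  ((contDiffAt_norm ℝ hy).rpow_const_of_ne (by simpa using hy)).mul
    (hh.comp y (contDiffAt_cosAngle hy))

/-- A solution `h` of the Legendre equation with parameter `(1 - k) a (a + 1)` gives a harmonic
function `r ^ a h(t)` on the cone. -/
theorem divergence_polarTerm {k a μ : ℝ} {h : ℝ → ℝ} {I : Set ℝ} (H : ZonalProfile μ h I)
    (hμ : μ = (1 - k) * (a * (a + 1))) {y : E3} (hy : y ≠ 0) (hI : cosAngle y ∈ I) :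
    divergence (coneFlux k (polarTerm a h)) y = 0 := by
  have hr : 0 < ‖y‖ := by simpa using hy
  -- The gradient field of r^a h(t) is r^{a-2} m(t) y + r^{a-1} h'(t) e₃, with e₃ the third
  -- coordinate vector; both coefficients have again the form `polarTerm`.
  set m : ℝ → ℝ := fun s => (1 - k) * a * h s - s * deriv h s with hm
  have hd : ∀ s ∈ I, HasDerivAt h (deriv h s) s := fun s hs =>
    ((H.contDiffOn.contDiffAt (H.isOpen.mem_nhds hs)).differentiableAt (by simp)).hasDerivAt
  have hd2 : HasDerivAt (deriv h) (deriv (deriv h) (cosAngle y)) (cosAngle y) :=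
    (((contDiffOn_infty_iff_deriv_of_isOpen H.isOpen).1 H.contDiffOn).2.contDiffAt
      (H.isOpen.mem_nhds hI)).differentiableAt (by simp) |>.hasDerivAt
  have hmd : HasDerivAt m ((1 - k) * a * deriv h (cosAngle y) -
      (deriv h (cosAngle y) + cosAngle y * deriv (deriv h) (cosAngle y))) (cosAngle y) :=
    (((hd _ hI).const_mul ((1 - k) * a)).sub ((hasDerivAt_id _).mul hd2)).congr_deriv (by simp)
  have hev : coneFlux k (polarTerm a h) =ᶠ[𝓝 y] fun x i => polarTerm (a - 2) m x * x i +
      polarTerm (a - 1) (deriv h) x * (if 2 = i then 1 else 0) := by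
    filter_upwards [isOpen_ne.mem_nhds hy,
      (contDiffAt_cosAngle (n := 0) hy).continuousAt.preimage_mem_nhds (H.isOpen.mem_nhds hI)]
      with x hx hxI
    have hx0 : 0 < ‖x‖ := by simpa using hx
    have e2 : ‖x‖ ^ (a - 2) = ‖x‖ ^ a * (‖x‖ ^ 2)⁻¹ := by
      rw [Real.rpow_sub hx0, div_eq_mul_inv]
      norm_cast
    have e1 : ‖x‖ ^ (a - 1) = ‖x‖ ^ a * ‖x‖⁻¹ := by
      rw [Real.rpow_sub hx0, Real.rpow_one, div_eq_mul_inv]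
    funext i
    rw [coneFlux, (hasFDerivAt_polarTerm hx (hd _ hxI)).fderiv, raise, polarCovector_unitVec,
      polarCovector_self, polarTerm, polarTerm, hm, e1, e2, ← mul_cosAngle x]
    simp only
    field_simp
    ring
  rw [divergence_congr hev]
  have hD : ∀ i, fderiv ℝ (fun x => polarTerm (a - 2) m x * x i +
      polarTerm (a - 1) (deriv h) x * (if 2 = i then 1 else 0)) y (unitVec i) =
      polarTerm (a - 2) m y + y i * (‖y‖ ^ (a - 2 - 2) * ((a - 2) * m (cosAngle y) -
      cosAngle y * ((1 - k) * a * deriv h (cosAngle y) -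
      (deriv h (cosAngle y) + cosAngle y * deriv (deriv h) (cosAngle y)))) * y i +
      ‖y‖ ^ (a - 2 - 1) * ((1 - k) * a * deriv h (cosAngle y) -
      (deriv h (cosAngle y) + cosAngle y * deriv (deriv h) (cosAngle y))) *
      (if 2 = i then 1 else 0)) + (if 2 = i then 1 else 0) *
      (‖y‖ ^ (a - 1 - 2) * ((a - 1) * deriv h (cosAngle y) -
        cosAngle y * deriv (deriv h) (cosAngle y)) * y i +
      ‖y‖ ^ (a - 1 - 1) * deriv (deriv h) (cosAngle y) * (if 2 = i then 1 else 0)) := by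
    intro i
    have e := ((hasFDerivAt_polarTerm (a := a - 2) hy hmd).mul (hasFDerivAt_coord y i)).add
      ((hasFDerivAt_polarTerm (a := a - 1) hy hd2).mul_const (if 2 = i then 1 else 0))
    rw [HasFDerivAt.fderiv (f := fun x => polarTerm (a - 2) m x * x i +
      polarTerm (a - 1) (deriv h) x * (if 2 = i then 1 else 0)) e]
    simp only [_root_.add_apply, _root_.smul_apply, polarCovector_unitVec, smul_eq_mul,
      PiLp.proj_apply, unitVec_apply]
    simp
  unfold divergence
  simp only [hD]
  have hn := norm_sq_eq_sum y
  have ht := mul_cosAngle y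
  have hode := H.ode _ hI
  rw [hμ] at hode
  rw [polarTerm, hm]
  have e0 : ‖y‖ ^ (a - 2) = ‖y‖ ^ (a - 2 - 2) * ‖y‖ ^ 2 := by
    rw [← Real.rpow_add_natCast hr.ne']
    norm_num
  have e1 : ‖y‖ ^ (a - 2 - 1) = ‖y‖ ^ (a - 2 - 2) * ‖y‖ := by
    rw [← Real.rpow_add_one hr.ne']
    ring_nf
  have e2 : ‖y‖ ^ (a - 1 - 2) = ‖y‖ ^ (a - 2 - 2) * ‖y‖ := by
    rw [← Real.rpow_add_one hr.ne']
    ring_nf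
  have e3 : ‖y‖ ^ (a - 1 - 1) = ‖y‖ ^ (a - 2 - 2) * ‖y‖ ^ 2 := by
    rw [← Real.rpow_add_natCast hr.ne']
    congr 1
    push_cast
    ring
  rw [e0, e1, e2, e3]
  simp only [Fin.sum_univ_three, show (2 : Fin 3) ≠ 0 by decide, show (2 : Fin 3) ≠ 1 by decide,
    if_true, if_false] at hn ⊢
  generalize ‖y‖ ^ (a - 2 - 2) = R at *
  generalize deriv (deriv h) (cosAngle y) = h2 at *
  generalize deriv h (cosAngle y) = h1 at *
  generalize h (cosAngle y) = h0 at *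
  generalize cosAngle y = t at *
  have hp : y 0 * y 0 + y 1 * y 1 = ‖y‖ ^ 2 - (‖y‖ * t) ^ 2 := by rw [hn, ht]; ring
  rw [← ht]
  linear_combination R * ((a - 2) * ((1 - k) * a * h0 - t * h1) -
    t * ((1 - k) * a * h1 - (h1 + t * h2))) * hp + R * ‖y‖ ^ 2 * hode

/-! ### Composition with a function of one variable -/

theorem coneFlux_congr {k : ℝ} {u v : E3 → ℝ} {y : E3} (h : u =ᶠ[𝓝 y] v) :
    coneFlux k u =ᶠ[𝓝 y] coneFlux k v := by
  filter_upwards [h.eventuallyEq_nhds] with x hx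
  funext i
  rw [coneFlux, coneFlux, hx.fderiv_eq]

theorem differentiableAt_coneFlux {k : ℝ} {u : E3 → ℝ} {y : E3} (hy : y ≠ 0)
    (hu : ContDiffAt ℝ 2 u y) (i : Fin 3) : DifferentiableAt ℝ (fun x => coneFlux k u x i) y :=
  (contDiffAt_coneFlux hy hu i).differentiableAt (by norm_num)

theorem eventually_differentiableAt {u : E3 → ℝ} {y : E3} (hu : ContDiffAt ℝ 2 u y) :
    ∀ᶠ x in 𝓝 y, DifferentiableAt ℝ u x :=
  (hu.eventually (by simp)).mono fun _ hx => hx.differentiableAt (by norm_num)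

theorem divergence_coneFlux_add {k : ℝ} {u v : E3 → ℝ} {y : E3} (hy : y ≠ 0)
    (hu : ContDiffAt ℝ 2 u y) (hv : ContDiffAt ℝ 2 v y) :
    divergence (coneFlux k (fun x => u x + v x)) y =
      divergence (coneFlux k u) y + divergence (coneFlux k v) y := by
  rw [← divergence_add (differentiableAt_coneFlux hy hu) (differentiableAt_coneFlux hy hv)]
  refine divergence_congr ?_
  filter_upwards [eventually_differentiableAt hu, eventually_differentiableAt hv] with x h1 h2
  funext i
  simp only [coneFlux]
  rw [fderiv_fun_add h1 h2, raise_add]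

/-- The divergence of the gradient field of a composition. -/
theorem divergence_coneFlux_comp {k : ℝ} {d : E3 → ℝ} {y : E3} {η : ℝ → ℝ} (hη : ContDiff ℝ 2 η)
    (hy : y ≠ 0) (hd : ContDiffAt ℝ 2 d y) :
    divergence (coneFlux k (fun x => η (d x))) y = deriv η (d y) * divergence (coneFlux k d) y +
      deriv (deriv η) (d y) * ∑ i, fderiv ℝ d y (unitVec i) * coneFlux k d y i := by
  have h1 : ∀ s, HasDerivAt η (deriv η s) s := fun s =>
    (hη.differentiable (by norm_num) s).hasDerivAt
  have h2 : ∀ s, HasDerivAt (deriv η) (deriv (deriv η) s) s := fun s =>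
    ((hη.iterate_deriv' 1 1).differentiable (by norm_num) s).hasDerivAt
  have e : coneFlux k (fun x => η (d x)) =ᶠ[𝓝 y] fun x i => deriv η (d x) * coneFlux k d x i := by
    filter_upwards [eventually_differentiableAt hd] with x hx
    funext i
    rw [coneFlux, HasFDerivAt.fderiv (f := fun x => η (d x))
      ((h1 (d x)).comp_hasFDerivAt x hx.hasFDerivAt), raise_smul, coneFlux]
  have hdd := hd.differentiableAt (by norm_num)
  have h3 := (h2 (d y)).comp_hasFDerivAt y hdd.hasFDerivAt
  rw [divergence_congr e, divergence_mul (φ := fun x => deriv η (d x)) h3.differentiableAt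
    (differentiableAt_coneFlux hy hd)]
  congr 1
  rw [Finset.mul_sum]
  refine Finset.sum_congr rfl fun i _ => ?_
  rw [HasFDerivAt.fderiv (f := fun x => deriv η (d x)) h3]
  simp
  ring

/-- For harmonic d only η''(d)|∇d|² is left. -/
theorem divergence_coneFlux_comp_nonpos {k : ℝ} (hk0 : 0 ≤ k) (hk1 : k ≤ 1) {d : E3 → ℝ} {y : E3}
    {η : ℝ → ℝ} (hη : ContDiff ℝ 2 η) (hη2 : ∀ s, deriv (deriv η) s ≤ 0) (hy : y ≠ 0)
    (hd : ContDiffAt ℝ 2 d y) (hd0 : divergence (coneFlux k d) y = 0) :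
    divergence (coneFlux k (fun x => η (d x))) y ≤ 0 := by
  rw [divergence_coneFlux_comp hη hy hd, hd0, mul_zero, zero_add]
  exact mul_nonpos_of_nonpos_of_nonneg (hη2 _) (sum_mul_raise_nonneg hk0 hk1 _ _)

/-! ### Integration by parts across the vertex -/

/-- In polar coordinates the volume factor r² of dimension three leaves the bounded integrand r. -/
theorem integrableOn_norm_inv {K : Set E3} (hK : IsCompact K) :
    IntegrableOn (fun y : E3 => ‖y‖⁻¹) K := by
  obtain ⟨R, hR⟩ := hK.isBounded.subset_ball 0
  refine IntegrableOn.mono_set ?_ hR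
  have := (integrableOn_fun_norm_addHaar (volume : Measure E3) (f := fun x : ℝ => x⁻¹) (r := R)).2
  refine this ?_
  have e : EqOn (fun y : ℝ => y) (fun y : ℝ => y ^ (Module.finrank ℝ E3 - 1) • y⁻¹) (Ioo 0 R) := by
    intro x hx
    have : x ≠ 0 := hx.1.ne'
    simp only [finrank_euclideanSpace, Fintype.card_fin, smul_eq_mul]
    field_simp
  refine IntegrableOn.congr_fun ?_ e measurableSet_Ioo
  exact (continuous_id.integrableOn_Icc (a := 0) (b := R)).mono_set Ioo_subset_Icc_self

theorem bound_of_continuousAt {f : E3 → ℝ} {K : Set E3} (hK : IsCompact K)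
    (hf0 : ∀ y ∉ K, f y = 0) (hfc : ∀ y, y ≠ 0 → ContinuousAt f y) {b : E3 → ℝ}
    (hb : ∀ y, 1 ≤ b y) (hnear : ∃ C : ℝ, ∀ᶠ y in 𝓝[≠] 0, |f y| ≤ C * b y) :
    ∃ C : ℝ, 0 ≤ C ∧ ∀ y, y ≠ 0 → |f y| ≤ C * b y := by
  obtain ⟨C, hC⟩ := hnear
  rw [eventually_nhdsWithin_iff, Metric.eventually_nhds_iff] at hC
  obtain ⟨δ, hδ, hC⟩ := hC
  obtain ⟨M, hM⟩ := (hK.diff Metric.isOpen_ball).exists_bound_of_continuousOn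
    (f := f) (s := K \ Metric.ball 0 δ) fun y hy => (hfc y (by
      rintro rfl
      exact hy.2 (Metric.mem_ball_self hδ))).continuousWithinAt
  refine ⟨max (max C M) 0, le_max_right _ _, fun y hy => ?_⟩
  have hb0 : 0 ≤ b y := zero_le_one.trans (hb y)
  by_cases h1 : dist y 0 < δ
  · exact (hC h1 hy).trans (mul_le_mul_of_nonneg_right ((le_max_left _ _).trans (le_max_left _ _)) hb0)
  by_cases h2 : y ∈ K
  · have h3 := hM y ⟨h2, h1⟩
    rw [Real.norm_eq_abs] at h3
    calc |f y| ≤ max (max C M) 0 := h3.trans ((le_max_right _ _).trans (le_max_left _ _))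
      _ ≤ _ := le_mul_of_one_le_right (le_max_right _ _) (hb y)
  · rw [hf0 y h2, abs_zero]
    exact mul_nonneg (le_max_right _ _) hb0

theorem ae_ne_zero : ∀ᵐ y : E3, y ≠ 0 := by
  simp [ae_iff]

theorem aestronglyMeasurable_of_continuousAt {f : E3 → ℝ} (hfc : ∀ y, y ≠ 0 → ContinuousAt f y) :
    AEStronglyMeasurable f := by
  have h : ContinuousOn f {0}ᶜ := fun y hy => (hfc y hy).continuousWithinAt
  have := h.aestronglyMeasurable (μ := (volume : Measure E3)) (measurableSet_singleton 0).compl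
  rwa [Measure.restrict_eq_self_of_ae_mem] at this
  exact ae_ne_zero

theorem integrable_one_add_norm_inv {K : Set E3} (hK : IsCompact K) :
    Integrable (K.indicator fun y : E3 => 1 + ‖y‖⁻¹) := by
  rw [integrable_indicator_iff hK.isClosed.measurableSet]
  exact (integrableOn_const hK.measure_lt_top.ne).add (integrableOn_norm_inv hK)

/-- A function with compact support that is continuous off the vertex and there has at most the
singularity `1 / r` is integrable. -/
theorem integrable_of_continuousAt {f : E3 → ℝ} {K : Set E3} (hK : IsCompact K)
    (hf0 : ∀ y ∉ K, f y = 0) (hfc : ∀ y, y ≠ 0 → ContinuousAt f y)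
    (hnear : ∃ C : ℝ, ∀ᶠ y in 𝓝[≠] 0, |f y| ≤ C * (1 + ‖y‖⁻¹)) : Integrable f := by
  obtain ⟨C, hC0, hC⟩ := bound_of_continuousAt hK hf0 hfc (b := fun y => 1 + ‖y‖⁻¹)
    (fun y => by simp) hnear
  refine ((integrable_one_add_norm_inv hK).const_mul C).mono'
    (aestronglyMeasurable_of_continuousAt hfc) ?_
  filter_upwards [ae_ne_zero] with y hy
  by_cases h : y ∈ K
  · rw [indicator_of_mem h]
    exact hC y hy
  · rw [indicator_of_notMem h, hf0 y h]
    simp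

theorem integral_fderiv_eq_zero {φ : E3 → ℝ} (hφ : ContDiff ℝ 1 φ) (hc : HasCompactSupport φ)
    (v : E3) : ∫ y, fderiv ℝ φ y v = 0 := by
  have h1 : Integrable fun y => fderiv ℝ φ y v :=
    ((hφ.continuous_fderiv one_ne_zero).clm_apply continuous_const).integrable_of_hasCompactSupport
      (hc.fderiv_apply (𝕜 := ℝ) v)
  have := integral_mul_fderiv_eq_neg_fderiv_mul_of_integrable (μ := (volume : Measure E3)) (𝕜 := ℝ)
    (f := fun _ => (1 : ℝ)) (g := φ) (v := v) (by simp) (by simpa using h1)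
    (by simpa using hφ.continuous.integrable_of_hasCompactSupport hc)
    (fun _ _ => differentiableAt_const _) (fun y _ => hφ.differentiable one_ne_zero y)
  simpa using this

theorem norm_unitVec (i : Fin 3) : ‖unitVec i‖ = 1 := by
  simp [unitVec]

/-- A smooth function that vanishes near the vertex and is `1` away from it. -/
theorem exists_vertex_cutoff : ∃ χ : E3 → ℝ, ContDiff ℝ 1 χ ∧ (∀ y, |χ y| ≤ 1) ∧
    (∀ y, ‖y‖ < 1 → χ y = 0) ∧ (∀ y, 2 < ‖y‖ → χ y = 1) ∧
    ∃ M : ℝ, ∀ y v, |fderiv ℝ χ y v| * ‖y‖ ≤ M * ‖v‖ := by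
  set β : ContDiffBump (0 : E3) := ⟨1, 2, one_pos, one_lt_two⟩ with hβ
  have hs : ContDiff ℝ 1 β := β.contDiff
  have hχ : ContDiff ℝ 1 fun y => 1 - β y := contDiff_const.sub hs
  refine ⟨fun y => 1 - β y, hχ, fun y => ?_, fun y hy => ?_, fun y hy => ?_, ?_⟩
  · rw [abs_le]
    constructor <;> linarith [β.nonneg (x := y), β.le_one (x := y)]
  · simp only
    rw [β.one_of_mem_closedBall (by simpa using hy.le), sub_self]
  · simp only
    rw [β.zero_of_le_dist (by simpa using hy.le), sub_zero]
  · have hcs : HasCompactSupport (fun y => fderiv ℝ β y) := β.hasCompactSupport.fderiv (𝕜 := ℝ)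
    have hcont : Continuous fun y : E3 => ‖y‖ • fderiv ℝ β y :=
      continuous_norm.smul (hs.continuous_fderiv one_ne_zero)
    obtain ⟨M, hM⟩ := hcont.bounded_above_of_compact_support (hcs.smul_left (f := fun y => ‖y‖))
    refine ⟨M, fun y v => ?_⟩
    have e : fderiv ℝ (fun y => 1 - β y) y = -fderiv ℝ β y := by
      rw [fderiv_const_sub]
    rw [e, _root_.neg_apply, abs_neg]
    have h1 := (fderiv ℝ β y).le_opNorm v
    have h2 := hM y
    rw [norm_smul, norm_norm] at h2
    rw [Real.norm_eq_abs] at h1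
    nlinarith [norm_nonneg y, norm_nonneg v]

/-- The divergence theorem for a bounded field with compact support that is differentiable off the
vertex. -/
theorem integral_divergence_eq_zero {Y : E3 → Fin 3 → ℝ} {K : Set E3} (hK : IsCompact K)
    (hY0 : ∀ y ∉ K, ∀ i, Y y i = 0)
    (hYd : ∀ y, y ≠ 0 → ∀ i, ContDiffAt ℝ 1 (fun x => Y x i) y) {C : ℝ}
    (hYb : ∀ y, y ≠ 0 → ∀ i, |Y y i| ≤ C) (hint : Integrable (divergence Y)) :
    ∫ y, divergence Y y = 0 := by
  obtain ⟨χ, hχ, hχ1, hχ0, hχ2, M, hM⟩ := exists_vertex_cutoff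
  -- Rescaled cutoffs: by homogeneity |∇θₙ| ≤ M/|y| for all n, so against the bounded field Y the
  -- cutoff error is dominated by a multiple of 1/|y|. At each y ≠ 0 the cutoff is eventually 1
  -- nearby.
  set θ : ℕ → E3 → ℝ := fun n y => χ (((n : ℝ) + 1) • y) with hθ
  have hn : ∀ n : ℕ, 0 < (n : ℝ) + 1 := fun n => by positivity
  have hθd : ∀ n, ContDiff ℝ 1 (θ n) := fun n => hχ.comp (contDiff_id.const_smul ((n : ℝ) + 1))
  have hθf : ∀ n y v, |fderiv ℝ (θ n) y v| * ‖y‖ ≤ M * ‖v‖ := by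
    intro n y v
    have h1 : HasFDerivAt (θ n) _ y := ((hχ.differentiable one_ne_zero _).hasFDerivAt).comp y
      ((hasFDerivAt_id y).const_smul ((n : ℝ) + 1))
    rw [h1.fderiv]
    have h2 := hM (((n : ℝ) + 1) • y) v
    rw [norm_smul, Real.norm_of_nonneg (hn n).le] at h2
    simp only [ContinuousLinearMap.comp_apply, _root_.smul_apply, map_smul, smul_eq_mul, abs_mul,
      abs_of_pos (hn n)]
    simp only [ContinuousLinearMap.id_apply]
    calc _ = |fderiv ℝ χ (((n : ℝ) + 1) • y) v| * (((n : ℝ) + 1) * ‖y‖) := by ring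
      _ ≤ _ := h2
  have hφ : ∀ n i, ContDiff ℝ 1 fun x => θ n x * Y x i := by
    intro n i
    rw [contDiff_iff_contDiffAt]
    intro y
    rcases eq_or_ne y 0 with rfl | hy
    · refine (contDiffAt_const (c := (0 : ℝ))).congr_of_eventuallyEq ?_
      have : ∀ᶠ x : E3 in 𝓝 0, ‖((n : ℝ) + 1) • x‖ < 1 := by
        refine (Continuous.tendsto' (by fun_prop) 0 0 (by simp)).eventually (gt_mem_nhds one_pos)
      filter_upwards [this] with x hx
      simp [hθ, hχ0 _ hx]
    · exact (hθd n).contDiffAt.mul (hYd y hy i)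
  have hφc : ∀ n i, HasCompactSupport fun x => θ n x * Y x i := fun n i =>
    HasCompactSupport.intro hK fun y hy => by rw [hY0 y hy i, mul_zero]
  have hzero : ∀ n, ∫ y, divergence (fun x i => θ n x * Y x i) y = 0 := by
    intro n
    unfold divergence
    rw [integral_finsetSum]
    · exact Finset.sum_eq_zero fun i _ => integral_fderiv_eq_zero (hφ n i) (hφc n i) _
    · intro i _
      exact (((hφ n i).continuous_fderiv one_ne_zero).clm_apply
        continuous_const).integrable_of_hasCompactSupport ((hφc n i).fderiv_apply (𝕜 := ℝ) _)
  have hlim : Tendsto (fun n => ∫ y, divergence (fun x i => θ n x * Y x i) y) atTop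
      (𝓝 (∫ y, divergence Y y)) := by
    refine tendsto_integral_of_dominated_convergence
      (fun y => |divergence Y y| + 3 * (M * C) * K.indicator (fun y => 1 + ‖y‖⁻¹) y) ?_
      (hint.abs.add ((integrable_one_add_norm_inv hK).const_mul _)) ?_ ?_
    · intro n
      refine Continuous.aestronglyMeasurable ?_
      unfold divergence
      exact continuous_finsetSum _ fun i _ =>
        ((hφ n i).continuous_fderiv one_ne_zero).clm_apply continuous_const
    · intro n
      filter_upwards [ae_ne_zero] with y hy
      have hr : 0 < ‖y‖ := by simpa using hy
      have hdY : ∀ i, DifferentiableAt ℝ (fun x => Y x i) y := fun i =>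
        (hYd y hy i).differentiableAt one_ne_zero
      rw [divergence_mul ((hθd n).differentiable one_ne_zero y) hdY, Real.norm_eq_abs]
      refine (abs_add_le _ _).trans (add_le_add ?_ ?_)
      · rw [abs_mul]
        exact mul_le_of_le_one_left (abs_nonneg _) (hχ1 _)
      · by_cases h : y ∈ K
        · rw [indicator_of_mem h]
          refine (Finset.abs_sum_le_sum_abs _ _).trans ?_
          have hM0 : 0 ≤ M := by
            have := (mul_nonneg (abs_nonneg _) (norm_nonneg y)).trans (hθf n y (unitVec 0))
            rwa [norm_unitVec, mul_one] at this
          have hC0 : 0 ≤ C := (abs_nonneg _).trans (hYb y hy 0)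
          have hi : ∀ i ∈ (Finset.univ : Finset (Fin 3)),
              |fderiv ℝ (θ n) y (unitVec i) * Y y i| ≤ M * C * ‖y‖⁻¹ := by
            intro i _
            have h1 := hθf n y (unitVec i)
            rw [norm_unitVec, mul_one, ← le_div_iff₀ hr] at h1
            rw [abs_mul]
            calc _ ≤ M / ‖y‖ * C := mul_le_mul h1 (hYb y hy i) (abs_nonneg _) (by positivity)
              _ = _ := by ring
          refine (Finset.sum_le_sum hi).trans ?_
          simp only [Finset.sum_const, Finset.card_univ, Fintype.card_fin, nsmul_eq_mul]
          push_cast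
          nlinarith [mul_nonneg hM0 hC0]
        · rw [indicator_of_notMem h]
          simp [hY0 y h]
    · filter_upwards [ae_ne_zero] with y hy
      have hr : 0 < ‖y‖ := by simpa using hy
      refine tendsto_const_nhds.congr' ?_
      obtain ⟨n₀, hn₀⟩ := exists_nat_gt (2 / ‖y‖)
      filter_upwards [eventually_ge_atTop n₀] with n hn'
      refine (divergence_congr ?_).symm
      have h2 : 2 < ‖((n : ℝ) + 1) • y‖ := by
        rw [norm_smul, Real.norm_of_nonneg (hn n).le]
        rw [div_lt_iff₀ hr] at hn₀
        have : (n₀ : ℝ) ≤ n := by exact_mod_cast hn'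
        nlinarith
      have : ∀ᶠ x in 𝓝 y, 2 < ‖((n : ℝ) + 1) • x‖ :=
        (Continuous.tendsto (by fun_prop) y).eventually (lt_mem_nhds h2)
      filter_upwards [this] with x hx
      funext i
      simp [hθ, hχ2 _ hx]
  simp only [hzero] at hlim
  exact tendsto_nhds_unique hlim tendsto_const_nhds

theorem abs_raise_le {k : ℝ} (hk0 : 0 ≤ k) (hk1 : k ≤ 1) (L : E3 →L[ℝ] ℝ) (y : E3) (i : Fin 3) :
    |raise k L y i| ≤ 2 * ‖L‖ := by
  have h1 : |L (unitVec i)| ≤ ‖L‖ := by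
    have := L.le_opNorm (unitVec i)
    rwa [norm_unitVec, mul_one] at this
  have h2 : |L y * y i / ‖y‖ ^ 2| ≤ ‖L‖ := by
    rcases eq_or_ne y 0 with rfl | hy
    · simp
    have hr : 0 < ‖y‖ := by simpa using hy
    rw [abs_div, abs_mul, abs_of_pos (by positivity : 0 < ‖y‖ ^ 2), div_le_iff₀ (by positivity)]
    have h3 := L.le_opNorm y
    have h4 : |y i| ≤ ‖y‖ := PiLp.norm_apply_le y i
    rw [Real.norm_eq_abs] at h3
    calc |L y| * |y i| ≤ ‖L‖ * ‖y‖ * ‖y‖ := mul_le_mul h3 h4 (abs_nonneg _) (by positivity)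
      _ = _ := by ring
  have h5 : |k * (L y * y i / ‖y‖ ^ 2)| ≤ ‖L‖ := by
    rw [abs_mul, abs_of_nonneg hk0]
    exact (mul_le_of_le_one_left (abs_nonneg _) hk1).trans h2
  unfold raise
  calc _ ≤ |L (unitVec i)| + |k * (L y * y i / ‖y‖ ^ 2)| := abs_sub _ _
    _ ≤ _ := by linarith

theorem continuousAt_divergence {Y : E3 → Fin 3 → ℝ} {y : E3}
    (hY : ∀ i, ContDiffAt ℝ 1 (fun x => Y x i) y) : ContinuousAt (divergence Y) y := by
  unfold divergence
  refine tendsto_finsetSum _ fun i _ => ?_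
  exact (((hY i).fderiv_right (m := 0) (by norm_num)).continuousAt.clm_apply continuousAt_const)

theorem norm_radial_le (y : E3) : ‖radial y‖ ≤ 1 := by
  rw [radial, norm_smul, norm_inv, norm_norm]
  exact inv_mul_le_one

theorem abs_coneLaplacian_le (c : ℝ) {ψ : E3 → ℝ} (y : E3) : |coneLaplacian c ψ y| ≤
    4 * ‖iteratedFDeriv ℝ 2 ψ y‖ + 2 * ‖fderiv ℝ ψ y‖ * ‖y‖⁻¹ := by
  have hk0 : 0 ≤ c ^ 2 / (1 + c ^ 2) := by positivity
  have hk1 : c ^ 2 / (1 + c ^ 2) ≤ 1 := by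
    rw [div_le_one (by positivity)]
    linarith
  have hD : ∀ v : E3, ‖v‖ ≤ 1 → |iteratedFDeriv ℝ 2 ψ y ![v, v]| ≤ ‖iteratedFDeriv ℝ 2 ψ y‖ := by
    intro v hv
    have := (iteratedFDeriv ℝ 2 ψ y).le_opNorm ![v, v]
    rw [Fin.prod_univ_two] at this
    simp only [Matrix.cons_val_zero, Matrix.cons_val_one] at this
    refine this.trans (mul_le_of_le_one_right (norm_nonneg _) ?_)
    exact mul_le_one₀ hv (norm_nonneg _) hv
  have h1 : |Laplacian.laplacian ψ y| ≤ 3 * ‖iteratedFDeriv ℝ 2 ψ y‖ := by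
    rw [InnerProductSpace.laplacian_eq_iteratedFDeriv_orthonormalBasis ψ
      (EuclideanSpace.basisFun (Fin 3) ℝ)]
    refine (Finset.abs_sum_le_sum_abs _ _).trans ?_
    refine (Finset.sum_le_sum fun i _ => hD _ (OrthonormalBasis.norm_eq_one _ i).le).trans ?_
    simp
  have h2 := hD _ (norm_radial_le y)
  have h3 : |fderiv ℝ ψ y (radial y)| ≤ ‖fderiv ℝ ψ y‖ :=
    ((fderiv ℝ ψ y).le_opNorm _).trans (mul_le_of_le_one_right (norm_nonneg _) (norm_radial_le y))
  have h4 : |2 / ‖y‖ * fderiv ℝ ψ y (radial y)| ≤ 2 * ‖fderiv ℝ ψ y‖ * ‖y‖⁻¹ := by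
    rw [abs_mul, abs_of_nonneg (by positivity : 0 ≤ 2 / ‖y‖), div_eq_mul_inv]
    nlinarith [mul_le_mul_of_nonneg_left h3 (by positivity : 0 ≤ 2 * ‖y‖⁻¹)]
  unfold coneLaplacian
  refine (abs_sub _ _).trans ?_
  have h5 : |c ^ 2 / (1 + c ^ 2) * (iteratedFDeriv ℝ 2 ψ y ![radial y, radial y] +
      2 / ‖y‖ * fderiv ℝ ψ y (radial y))| ≤ ‖iteratedFDeriv ℝ 2 ψ y‖ +
        2 * ‖fderiv ℝ ψ y‖ * ‖y‖⁻¹ := by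
    rw [abs_mul, abs_of_nonneg hk0]
    exact (mul_le_of_le_one_left (abs_nonneg _) hk1).trans ((abs_add_le _ _).trans (add_le_add h2 h4))
  linarith

theorem iteratedFDeriv_bound {ψ : E3 → ℝ} (hψ : ContDiff ℝ ∞ ψ) : ∃ C : ℝ, 0 ≤ C ∧
    ∀ᶠ y in 𝓝[≠] (0 : E3), |ψ y| ≤ C ∧ ‖fderiv ℝ ψ y‖ ≤ C ∧ ‖iteratedFDeriv ℝ 2 ψ y‖ ≤ C := by
  have c1 : Continuous fun y => |ψ y| := hψ.continuous.abs
  have c2 : Continuous fun y => ‖fderiv ℝ ψ y‖ := (hψ.continuous_fderiv (by simp)).norm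
  have c3 : Continuous fun y => ‖iteratedFDeriv ℝ 2 ψ y‖ :=
    (hψ.continuous_iteratedFDeriv (m := 2) (by norm_cast)).norm
  set C := max (max |ψ 0| ‖fderiv ℝ ψ 0‖) ‖iteratedFDeriv ℝ 2 ψ 0‖ + 1 with hC
  have b1 : |ψ 0| < C := by
    have := (le_max_left |ψ 0| ‖fderiv ℝ ψ 0‖).trans (le_max_left _ ‖iteratedFDeriv ℝ 2 ψ 0‖)
    linarith
  have b2 : ‖fderiv ℝ ψ 0‖ < C := by
    have := (le_max_right |ψ 0| ‖fderiv ℝ ψ 0‖).trans (le_max_left _ ‖iteratedFDeriv ℝ 2 ψ 0‖)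
    linarith
  have b3 : ‖iteratedFDeriv ℝ 2 ψ 0‖ < C := by
    have := le_max_right (max |ψ 0| ‖fderiv ℝ ψ 0‖) ‖iteratedFDeriv ℝ 2 ψ 0‖
    linarith
  refine ⟨C, (abs_nonneg _).trans b1.le, ?_⟩
  have e1 := (c1.tendsto 0).eventually (gt_mem_nhds b1)
  have e2 := (c2.tendsto 0).eventually (gt_mem_nhds b2)
  have e3 := (c3.tendsto 0).eventually (gt_mem_nhds b3)
  filter_upwards [nhdsWithin_le_nhds e1, nhdsWithin_le_nhds e2, nhdsWithin_le_nhds e3] with y h1 h2 h3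
  exact ⟨h1.le, h2.le, h3.le⟩

/-- A function that is `C²` off the vertex, with bounded gradient and harmonic near the vertex, and
that satisfies `Δ_c u ≤ 0` off the vertex, does so in the sense of distributions. -/
theorem integral_mul_coneLaplacian_nonpos (c : ℝ) {u ψ : E3 → ℝ} (hψ : ContDiff ℝ ∞ ψ)
    (hc : HasCompactSupport ψ) (hψ0 : ∀ y, 0 ≤ ψ y)
    (hu : ∀ y ∈ tsupport ψ, y ≠ 0 → ContDiffAt ℝ 2 u y)
    (hdiv : ∀ y ∈ tsupport ψ, y ≠ 0 → divergence (coneFlux (c ^ 2 / (1 + c ^ 2)) u) y ≤ 0)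
    (hnear : 0 ∈ tsupport ψ → ∃ C : ℝ, ∀ᶠ y in 𝓝[≠] 0, |u y| ≤ C ∧ ‖fderiv ℝ u y‖ ≤ C ∧
      divergence (coneFlux (c ^ 2 / (1 + c ^ 2)) u) y = 0) :
    Integrable (fun y => u y * coneLaplacian c ψ y) ∧ ∫ y, u y * coneLaplacian c ψ y ≤ 0 := by
  have hk0 : 0 ≤ c ^ 2 / (1 + c ^ 2) := by positivity
  have hk1 : c ^ 2 / (1 + c ^ 2) ≤ 1 := by
    rw [div_le_one (by positivity)]
    linarith
  have hLap : ∀ y, y ≠ 0 → coneLaplacian c ψ y = divergence (coneFlux (c ^ 2 / (1 + c ^ 2)) ψ) y :=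
    fun y hy => coneLaplacian_eq_divergence c hy (hψ.contDiffAt.of_le (by norm_cast))
  set k := c ^ 2 / (1 + c ^ 2) with hk
  have hψ2 : ContDiff ℝ 2 ψ := hψ.of_le (by norm_cast)
  obtain ⟨D, hD0, hD⟩ := iteratedFDeriv_bound hψ
  have hout : ∀ y ∉ tsupport ψ, ψ =ᶠ[𝓝 y] fun _ => 0 := fun y hy =>
    notMem_tsupport_iff_eventuallyEq.1 hy
  have hfluxout : ∀ y ∉ tsupport ψ, coneFlux k ψ =ᶠ[𝓝 y] fun _ _ => 0 := by
    intro y hy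
    refine (coneFlux_congr (hout y hy)).trans (Eventually.of_forall fun x => ?_)
    funext i
    simp [coneFlux, raise]
  have hlapout : ∀ y ∉ tsupport ψ, ∀ᶠ x in 𝓝 y, coneLaplacian c ψ x = 0 := by
    intro y hy
    filter_upwards [(hout y hy).eventuallyEq_nhds] with x hx
    have e1 : Laplacian.laplacian ψ x = 0 := by
      rw [InnerProductSpace.laplacian_eq_iteratedFDeriv_orthonormalBasis ψ
        (EuclideanSpace.basisFun (Fin 3) ℝ)]
      simp only [iteratedFDeriv_two_apply]
      simp [hx.fderiv.fderiv_eq]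
    rw [coneLaplacian, e1, iteratedFDeriv_two_apply, hx.fderiv_eq, hx.fderiv.fderiv_eq]
    simp
  have hnear' : ∃ C : ℝ, 0 ≤ C ∧ ∀ᶠ y in 𝓝[≠] 0, (0 : E3) ∈ tsupport ψ → (|u y| ≤ C ∧
      ‖fderiv ℝ u y‖ ≤ C ∧ divergence (coneFlux k u) y = 0) := by
    by_cases h : (0 : E3) ∈ tsupport ψ
    · obtain ⟨C, hC⟩ := hnear h
      refine ⟨max C 0, le_max_right _ _, hC.mono fun y hy _ => ?_⟩
      exact ⟨hy.1.trans (le_max_left _ _), hy.2.1.trans (le_max_left _ _), hy.2.2⟩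
    · exact ⟨0, le_rfl, Eventually.of_forall fun y h' => absurd h' h⟩
  obtain ⟨C, hC0, hC⟩ := hnear'
  have hK : IsCompact (tsupport ψ) := hc
  have hI1 : Integrable fun y => u y * coneLaplacian c ψ y := by
    refine integrable_of_continuousAt hK (fun y hy => ?_) (fun y hy => ?_) ?_
    · rw [(hlapout y hy).self_of_nhds, mul_zero]
    · by_cases h : y ∈ tsupport ψ
      · refine (hu y h hy).continuousAt.mul ?_
        have e : coneLaplacian c ψ =ᶠ[𝓝 y] divergence (coneFlux k ψ) := by
          filter_upwards [isOpen_ne.mem_nhds hy] with x hx using hLap x hx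
        exact (continuousAt_divergence (contDiffAt_coneFlux hy hψ2.contDiffAt)).congr e.symm
      · refine (continuousAt_const (y := (0 : ℝ))).congr ?_
        filter_upwards [hlapout y h] with x hx
        rw [hx, mul_zero]
    · by_cases h : (0 : E3) ∈ tsupport ψ
      · refine ⟨C * (6 * D), ?_⟩
        filter_upwards [hC, hD] with y h1 h2
        rw [abs_mul]
        have h3 := abs_coneLaplacian_le c (ψ := ψ) y
        have h4 : |coneLaplacian c ψ y| ≤ 6 * D * (1 + ‖y‖⁻¹) := by
          have : 0 ≤ ‖y‖⁻¹ := by positivity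
          nlinarith [h2.2.1, h2.2.2]
        calc _ ≤ C * (6 * D * (1 + ‖y‖⁻¹)) :=
              mul_le_mul (h1 h).1 h4 (abs_nonneg _) hC0
          _ = _ := by ring
      · refine ⟨0, nhdsWithin_le_nhds ?_⟩
        filter_upwards [hlapout 0 h] with y hy
        simp [hy]
  have hI2 : Integrable fun y => ψ y * divergence (coneFlux k u) y := by
    refine integrable_of_continuousAt hK (fun y hy => ?_) (fun y hy => ?_) ?_
    · rw [image_eq_zero_of_notMem_tsupport hy, zero_mul]
    · by_cases h : y ∈ tsupport ψ
      · exact hψ.continuous.continuousAt.mul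
          (continuousAt_divergence (contDiffAt_coneFlux hy (hu y h hy)))
      · refine (continuousAt_const (y := (0 : ℝ))).congr ?_
        filter_upwards [hout y h] with x hx
        rw [hx, zero_mul]
    · refine ⟨0, ?_⟩
      by_cases h : (0 : E3) ∈ tsupport ψ
      · filter_upwards [hC] with y h1
        rw [(h1 h).2.2]
        simp
      · refine nhdsWithin_le_nhds ?_
        filter_upwards [hout 0 h] with x hx
        simp [hx]
  -- Green's identity: the divergence of u∇ψ - ψ∇u is uΔψ - ψΔu, and the field is bounded near the
  -- vertex.
  set Y : E3 → Fin 3 → ℝ := fun y i => u y * coneFlux k ψ y i - ψ y * coneFlux k u y i with hY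
  have hYout : ∀ y ∉ tsupport ψ, Y =ᶠ[𝓝 y] fun _ _ => 0 := by
    intro y hy
    filter_upwards [hout y hy, hfluxout y hy] with x h1 h2
    funext i
    simp [hY, h1, h2]
  have hYd : ∀ y, y ≠ 0 → ∀ i, ContDiffAt ℝ 1 (fun x => Y x i) y := by
    intro y hy i
    by_cases h : y ∈ tsupport ψ
    · exact (((hu y h hy).of_le (by norm_num)).mul (contDiffAt_coneFlux hy hψ2.contDiffAt i)).sub
        ((hψ2.contDiffAt.of_le (by norm_num)).mul (contDiffAt_coneFlux hy (hu y h hy) i))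
    · exact (contDiffAt_const (c := (0 : ℝ))).congr_of_eventuallyEq
        ((hYout y h).mono fun x hx => congrFun hx i)
  have hYb : ∃ B : ℝ, ∀ y, y ≠ 0 → ∀ i, |Y y i| ≤ B := by
    have hi : ∀ i, ∃ B : ℝ, 0 ≤ B ∧ ∀ y, y ≠ 0 → |Y y i| ≤ B * 1 := by
      intro i
      refine bound_of_continuousAt hK (b := fun _ => 1) (fun y hy => ?_)
        (fun y hy => (hYd y hy i).continuousAt) (fun _ => le_rfl) ?_
      · exact congrFun (hYout y hy).self_of_nhds i
      · by_cases h : (0 : E3) ∈ tsupport ψ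
        · refine ⟨C * (2 * D) + D * (2 * C), ?_⟩
          filter_upwards [hC, hD] with y h1 h2
          have h3 := abs_raise_le hk0 hk1 (fderiv ℝ ψ y) y i
          have h4 := abs_raise_le hk0 hk1 (fderiv ℝ u y) y i
          rw [mul_one]
          refine (abs_sub _ _).trans (add_le_add ?_ ?_)
          · rw [abs_mul]
            exact mul_le_mul (h1 h).1 (h3.trans (by linarith [h2.2.1])) (abs_nonneg _) hC0
          · rw [abs_mul]
            exact mul_le_mul h2.1 (h4.trans (by linarith [(h1 h).2.1])) (abs_nonneg _) hD0
        · refine ⟨0, nhdsWithin_le_nhds ?_⟩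
          filter_upwards [hYout 0 h] with x hx
          rw [hx]
          simp
    choose B hB0 hB using hi
    refine ⟨∑ i, B i, fun y hy i => (hB i y hy).trans ?_⟩
    rw [mul_one]
    exact Finset.single_le_sum (fun j _ => hB0 j) (Finset.mem_univ i)
  obtain ⟨B, hB⟩ := hYb
  have hdivY : ∀ y, y ≠ 0 → divergence Y y =
      u y * coneLaplacian c ψ y - ψ y * divergence (coneFlux k u) y := by
    intro y hy
    by_cases h : y ∈ tsupport ψ
    · have hud := (hu y h hy).differentiableAt (by norm_num)
      have hψd := hψ2.differentiable (by norm_num) y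
      have d1 := differentiableAt_coneFlux (k := k) hy hψ2.contDiffAt
      have d2 := differentiableAt_coneFlux (k := k) hy (hu y h hy)
      rw [hY, divergence_sub (X := fun y i => u y * coneFlux k ψ y i)
        (Y := fun y i => ψ y * coneFlux k u y i) (fun i => hud.mul (d1 i)) (fun i => hψd.mul (d2 i)),
        divergence_mul hud d1, divergence_mul hψd d2, hLap y hy]
      simp only [coneFlux]
      rw [sum_mul_raise_comm]
      unfold coneFlux
      ring
    · rw [divergence_congr (hYout y h), (hlapout y h).self_of_nhds,
        image_eq_zero_of_notMem_tsupport h]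
      simp [divergence]
  have hae : divergence Y =ᵐ[volume] fun y =>
      u y * coneLaplacian c ψ y - ψ y * divergence (coneFlux k u) y := by
    filter_upwards [ae_ne_zero] with y hy using hdivY y hy
  have hz := integral_divergence_eq_zero hK
    (fun y hy i => congrFun (hYout y hy).self_of_nhds i) hYd hB ((hI1.sub hI2).congr hae.symm)
  rw [integral_congr_ae hae, integral_sub hI1 hI2, sub_eq_zero] at hz
  refine ⟨hI1, hz.trans_le (integral_nonpos_of_ae ?_)⟩
  filter_upwards [ae_ne_zero] with y hy
  by_cases h : y ∈ tsupport ψ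
  · exact mul_nonpos_of_nonneg_of_nonpos (hψ0 y) (hdiv y h hy)
  · rw [image_eq_zero_of_notMem_tsupport h, zero_mul]
    rfl

/-! ### Smooth concave approximations of `min s 0` -/

/-- The primitive of the smooth step from 0 to 1: it is convex because the step is monotone, and its
slope differs from that of max(s, 0) only on [0, 1]. -/
theorem exists_smooth_ramp : ∃ κ : ℝ → ℝ, ContDiff ℝ 2 κ ∧ (∀ s, 0 ≤ deriv (deriv κ) s) ∧
    (∀ s ≤ 0, κ s = 0) ∧ ∀ s, |κ s - max s 0| ≤ 1 := by
  have hst : ContDiff ℝ 1 Real.smoothTransition := Real.smoothTransition.contDiff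
  have hcont : Continuous Real.smoothTransition := hst.continuous
  set κ : ℝ → ℝ := fun s => ∫ x in (0 : ℝ)..s, Real.smoothTransition x with hκ
  have hd : ∀ s, HasDerivAt κ (Real.smoothTransition s) s := fun s =>
    intervalIntegral.integral_hasDerivAt_right (hcont.intervalIntegrable _ _)
      (hcont.stronglyMeasurableAtFilter _ _) hcont.continuousAt
  have hde : deriv κ = Real.smoothTransition := funext fun s => (hd s).deriv
  have hneg : ∀ s ≤ 0, κ s = 0 := by
    intro s hs
    simp only [hκ]
    rw [intervalIntegral.integral_congr (g := fun _ => (0 : ℝ))]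
    · simp
    · intro x hx
      rw [uIcc_of_ge hs] at hx
      exact Real.smoothTransition.zero_of_nonpos hx.2
  refine ⟨κ, ?_, fun s => ?_, hneg, fun s => ?_⟩
  · have : ContDiff ℝ (1 + 1) κ := by
      rw [contDiff_succ_iff_deriv]
      exact ⟨fun s => (hd s).differentiableAt, by simp, hde ▸ hst⟩
    exact_mod_cast this
  · rw [hde]
    exact Real.smoothTransition.monotone.deriv_nonneg
  · rcases le_total s 0 with hs | hs
    · simp [hneg s hs, max_eq_right hs]
    rw [max_eq_left hs]
    have h1 : κ s ≤ s := by
      have := intervalIntegral.integral_mono_on (μ := volume) hs (hcont.intervalIntegrable 0 s)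
        (continuous_const.intervalIntegrable 0 s) fun x _ => Real.smoothTransition.le_one x
      simpa using this
    have h2 : s - 1 ≤ κ s := by
      rcases le_total s 1 with h1 | h1
      · have : 0 ≤ κ s :=
          intervalIntegral.integral_nonneg hs fun x _ => Real.smoothTransition.nonneg x
        linarith
      · have e : κ s = (∫ x in (0 : ℝ)..1, Real.smoothTransition x) +
            ∫ x in (1 : ℝ)..s, Real.smoothTransition x :=
          (intervalIntegral.integral_add_adjacent_intervals (hcont.intervalIntegrable _ _)
            (hcont.intervalIntegrable _ _)).symm
        have e1 : 0 ≤ ∫ x in (0 : ℝ)..1, Real.smoothTransition x :=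
          intervalIntegral.integral_nonneg zero_le_one fun x _ => Real.smoothTransition.nonneg x
        have e2 : ∫ x in (1 : ℝ)..s, Real.smoothTransition x = s - 1 := by
          rw [intervalIntegral.integral_congr (g := fun _ => (1 : ℝ))]
          · simp
          · intro x hx
            rw [uIcc_of_le h1] at hx
            exact Real.smoothTransition.one_of_one_le hx.1
        linarith
    rw [abs_le]
    constructor <;> linarith

/-- A reflected and rescaled ramp. That η vanishes exactly for s ≥ 0 matters: W + η(V - W) then
equals W wherever V ≥ W, in particular near the ray, where V is singular. -/
theorem exists_smooth_min {ε : ℝ} (hε : 0 < ε) : ∃ η : ℝ → ℝ, ContDiff ℝ 2 η ∧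
    (∀ s, deriv (deriv η) s ≤ 0) ∧ (∀ s, 0 ≤ s → η s = 0) ∧ ∀ s, |η s - min s 0| ≤ ε := by
  obtain ⟨κ, h1, h2, h3, h4⟩ := exists_smooth_ramp
  have hd1 : ∀ s, HasDerivAt κ (deriv κ s) s := fun s =>
    (h1.differentiable (by norm_num) s).hasDerivAt
  have hd2 : ∀ s, HasDerivAt (deriv κ) (deriv (deriv κ) s) s := fun s =>
    ((h1.iterate_deriv' 1 1).differentiable (by norm_num) s).hasDerivAt
  have hl : ∀ s, HasDerivAt (fun s => -s / ε) (-1 / ε) s := fun s =>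
    ((hasDerivAt_id s).neg).div_const ε
  have e1 : deriv (fun s => -ε * κ (-s / ε)) = fun s => deriv κ (-s / ε) := by
    funext s
    rw [HasDerivAt.deriv (f := fun s => -ε * κ (-s / ε))
      (((hd1 (-s / ε)).comp s (hl s)).const_mul (-ε))]
    field_simp
  refine ⟨fun s => -ε * κ (-s / ε), ?_, fun s => ?_, fun s hs => ?_, fun s => ?_⟩
  · exact contDiff_const.mul (h1.comp (contDiff_id.neg.div_const ε))
  · have e2 : HasDerivAt (deriv κ ∘ fun s => -s / ε) _ s := (hd2 (-s / ε)).comp s (hl s)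
    rw [e1, HasDerivAt.deriv (f := fun s => deriv κ (-s / ε)) e2]
    exact mul_nonpos_of_nonneg_of_nonpos (h2 _) (div_nonpos_of_nonpos_of_nonneg (by norm_num) hε.le)
  · simp only
    rw [h3 _ (div_nonpos_of_nonpos_of_nonneg (by linarith) hε.le), mul_zero]
  · have h5 := h4 (-s / ε)
    have h6 : min s 0 = -ε * max (-s / ε) 0 := by
      rcases le_total s 0 with hs | hs
      · rw [min_eq_left hs, max_eq_left (div_nonneg (by linarith) hε.le)]
        field_simp
      · rw [min_eq_right hs, max_eq_right (div_nonpos_of_nonpos_of_nonneg (by linarith) hε.le)]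
        simp
    rw [h6, ← mul_sub, abs_mul, abs_neg, abs_of_pos hε]
    exact mul_le_of_le_one_right hε.le h5

/-! ### The minimum of two harmonic functions -/

theorem isClosed_singularRay : IsClosed singularRay :=
  isClosed_eq (contDiff_coord 2 (n := 0)).continuous continuous_norm.neg

theorem zero_mem_singularRay : (0 : E3) ∈ singularRay := by
  simp [singularRay]

/-- `p = max {min {V, W}, 0}` where `V`, `W` are harmonic and `V` is larger than `W` near the points
of the singular ray with `W ≥ 0`, with the slopes below `1` at the zeros. -/
structure IsMinPair (c : ℝ) (V W p : E3 → ℝ) : Prop where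
  contDiffAt_left : ∀ y ∉ singularRay, ContDiffAt ℝ 2 V y
  harmonic_left : ∀ y ∉ singularRay, divergence (coneFlux (c ^ 2 / (1 + c ^ 2)) V) y = 0
  contDiffAt_right : ∀ y, y ≠ 0 → ContDiffAt ℝ 2 W y
  harmonic_right : ∀ y, y ≠ 0 → divergence (coneFlux (c ^ 2 / (1 + c ^ 2)) W) y = 0
  continuous_right : Continuous W
  bounded_right : ∃ C : ℝ, ∀ᶠ y in 𝓝[≠] 0, ‖fderiv ℝ W y‖ ≤ C
  vertex_pos : 0 < W 0
  blowup : ∀ y ∈ singularRay, ‖y‖ < 1 → 0 ≤ W y →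
    Tendsto (fun x => V x - W x) (𝓝[singularRayᶜ] y) atTop
  eq_off : ∀ y ∉ singularRay, p y = max (min (V y) (W y)) 0
  eq_on : ∀ y ∈ singularRay, ‖y‖ < 1 → p y = max (W y) 0
  slope_left : ∀ y ∉ singularRay, ‖y‖ < 1 → V y = 0 → 0 ≤ W y → gradSq c V y < 1
  slope_right : ∀ y, y ≠ 0 → ‖y‖ < 1 → W y = 0 → gradSq c W y < 1

namespace IsMinPair

variable {c : ℝ} {V W p : E3 → ℝ}

theorem eventually_le (H : IsMinPair c V W p) {y : E3} (hy : y ∈ singularRay) (hy1 : ‖y‖ < 1)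
    (hW : 0 ≤ W y) : ∀ᶠ x in 𝓝 y, x ∉ singularRay → W x ≤ V x := by
  have := (tendsto_atTop.1 (H.blowup y hy hy1 hW) 0)
  rw [eventually_nhdsWithin_iff] at this
  filter_upwards [this] with x hx h
  linarith [hx h]

/-- Take u = W + η(V - W) off the ray and u = W on it. On the support of ψ this is C² off the vertex
and uniformly close to min(V, W). As V - W is harmonic and η concave, the divergence of its gradient
field is nonpositive. -/
theorem exists_approx (H : IsMinPair c V W p) {ψ : E3 → ℝ} (hψ : ContDiff ℝ ∞ ψ)
    (hc : HasCompactSupport ψ) (hsupp : tsupport ψ ⊆ {y | ‖y‖ < 1 ∧ 0 < p y})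
    (hψ0 : ∀ y, 0 ≤ ψ y) {ε : ℝ} (hε : 0 < ε) : ∃ u : E3 → ℝ,
    Integrable (fun y => u y * coneLaplacian c ψ y) ∧ ∫ y, u y * coneLaplacian c ψ y ≤ 0 ∧
    ∀ y ∈ tsupport ψ, |u y - p y| ≤ ε := by
  classical
  obtain ⟨η, hη, hη2, hη0, hηe⟩ := exists_smooth_min hε
  have hk0 : 0 ≤ c ^ 2 / (1 + c ^ 2) := by positivity
  have hk1 : c ^ 2 / (1 + c ^ 2) ≤ 1 := by
    rw [div_le_one (by positivity)]
    linarith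
  have hray : ∀ y ∈ tsupport ψ, y ∈ singularRay → 0 < W y := by
    intro y hy hyr
    have h := hsupp hy
    have h2 := h.2
    rw [H.eq_on y hyr h.1] at h2
    exact (lt_max_iff.1 h2).resolve_right (lt_irrefl 0)
  set u : E3 → ℝ := fun y => if y ∈ singularRay then W y else W y + η (V y + (-1) * W y) with hu
  have hon : ∀ y ∈ tsupport ψ, y ∈ singularRay → u =ᶠ[𝓝 y] W := by
    intro y hy hyr
    filter_upwards [H.eventually_le hyr (hsupp hy).1 (hray y hy hyr).le] with x hx
    by_cases h : x ∈ singularRay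
    · simp [hu, h]
    · simp only [hu, h, if_false]
      rw [hη0 _ (by linarith [hx h]), add_zero]
  have hoff : ∀ y ∉ singularRay, u =ᶠ[𝓝 y] fun x => W x + η (V x + (-1) * W x) := by
    intro y hy
    filter_upwards [isClosed_singularRay.isOpen_compl.mem_nhds hy] with x hx
    simp [hu, show x ∉ singularRay from hx]
  have hd : ∀ y ∉ singularRay, ContDiffAt ℝ 2 (fun x => V x + (-1) * W x) y := fun y hy =>
    (H.contDiffAt_left y hy).add (contDiffAt_const.mul (H.contDiffAt_right y (by
      rintro rfl
      exact hy zero_mem_singularRay)))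
  have hne : ∀ y ∉ singularRay, y ≠ 0 := by
    rintro y hy rfl
    exact hy zero_mem_singularRay
  have hsub : ∀ y ∉ singularRay,
      divergence (coneFlux (c ^ 2 / (1 + c ^ 2)) fun x => V x + (-1) * W x) y = 0 := by
    intro y hy
    have e : divergence (coneFlux (c ^ 2 / (1 + c ^ 2)) fun x => (-1) * W x) y = 0 := by
      have hη' : ContDiff ℝ 2 fun s : ℝ => (-1) * s := by fun_prop
      rw [divergence_coneFlux_comp hη' (hne y hy) (H.contDiffAt_right y (hne y hy)),
        H.harmonic_right y (hne y hy)]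
      have : deriv (fun s : ℝ => (-1) * s) = fun _ => -1 := by
        funext s
        simp
      rw [this]
      simp
    rw [divergence_coneFlux_add (hne y hy) (H.contDiffAt_left y hy)
      (contDiffAt_const.mul (H.contDiffAt_right y (hne y hy))), H.harmonic_left y hy, e, add_zero]
  have key := integral_mul_coneLaplacian_nonpos c (u := u) hψ hc hψ0 ?_ ?_ ?_
  · refine ⟨u, key.1, key.2, fun y hy => ?_⟩
    have hp := (hsupp hy).2
    by_cases h : y ∈ singularRay
    · rw [H.eq_on y h (hsupp hy).1, max_eq_left (hray y hy h).le]
      simp [hu, h, hε.le]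
    · rw [H.eq_off y h] at hp ⊢
      have h1 : 0 < min (V y) (W y) := (lt_max_iff.1 hp).resolve_right (lt_irrefl 0)
      rw [max_eq_left h1.le]
      simp only [hu, h, if_false]
      have h2 := hηe (V y + (-1) * W y)
      have h3 : min (V y) (W y) = W y + min (V y + (-1) * W y) 0 := by
        rw [← min_add_add_left]
        ring_nf
      rw [h3]
      convert h2 using 2
      ring
  · intro y hy hy0
    by_cases h : y ∈ singularRay
    · exact (H.contDiffAt_right y hy0).congr_of_eventuallyEq (hon y hy h)
    · exact ((H.contDiffAt_right y hy0).add (hη.contDiffAt.comp y (hd y h))).congr_of_eventuallyEq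
        (hoff y h)
  · intro y hy hy0
    by_cases h : y ∈ singularRay
    · rw [divergence_congr (coneFlux_congr (hon y hy h)), H.harmonic_right y hy0]
    · rw [divergence_congr (coneFlux_congr (hoff y h)), divergence_coneFlux_add
        (v := fun x => η (V x + (-1) * W x)) hy0 (H.contDiffAt_right y hy0) (hη.contDiffAt.comp y (hd y h)), H.harmonic_right y hy0, zero_add]
      exact divergence_coneFlux_comp_nonpos hk0 hk1 hη hη2 hy0 (hd y h) (hsub y h)
  · intro h0
    obtain ⟨C, hC⟩ := H.bounded_right
    have hu0 := hon 0 h0 zero_mem_singularRay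
    refine ⟨max C (|W 0| + 1), ?_⟩
    have hb : ∀ᶠ y in 𝓝 (0 : E3), |W y| < |W 0| + 1 :=
      (H.continuous_right.abs.tendsto 0).eventually (gt_mem_nhds (by linarith))
    filter_upwards [hC, nhdsWithin_le_nhds hu0.eventuallyEq_nhds, nhdsWithin_le_nhds hb,
      self_mem_nhdsWithin] with y h1 h2 h3 h4
    rw [h2.eq_of_nhds, h2.fderiv_eq, divergence_congr (coneFlux_congr h2), H.harmonic_right y h4]
    exact ⟨h3.le.trans (le_max_right _ _), h1.trans (le_max_left _ _), rfl⟩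

theorem distribSuperharmonicOn (H : IsMinPair c V W p) :
    DistribSuperharmonicOn c p {y | ‖y‖ < 1 ∧ 0 < p y} := by
  intro ψ hψ hc hsupp hψ0
  choose u hu1 hu2 hu3 using fun n : ℕ => H.exists_approx hψ hc hsupp hψ0
    (Nat.one_div_pos_of_nat (α := ℝ) (n := n))
  -- Obtained from the case u = 1. Continuity of ψ is not enough here: the operator applied to ψ may
  -- grow like 1/r at the vertex.
  have hL : Integrable (coneLaplacian c ψ) := by
    have h0 : ∀ y, divergence (coneFlux (c ^ 2 / (1 + c ^ 2)) fun _ => (1 : ℝ)) y = 0 := by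
      intro y
      have : coneFlux (c ^ 2 / (1 + c ^ 2)) (fun _ : E3 => (1 : ℝ)) = fun _ _ => 0 := by
        funext x i
        simp [coneFlux, raise]
      rw [this]
      simp [divergence]
    have := (integral_mul_coneLaplacian_nonpos c (u := fun _ => 1) hψ hc hψ0
      (fun _ _ _ => contDiffAt_const) (fun y _ _ => (h0 y).le)
      fun _ => ⟨1, Eventually.of_forall fun y => by simp [h0]⟩).1
    simpa using this
  have hdist : ∀ n y, |u n y * coneLaplacian c ψ y - p y * coneLaplacian c ψ y| ≤
      1 / ((n : ℝ) + 1) * |coneLaplacian c ψ y| := by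
    intro n y
    rw [← sub_mul, abs_mul]
    by_cases h : y ∈ tsupport ψ
    · exact mul_le_mul_of_nonneg_right (hu3 n y h) (abs_nonneg _)
    · have h1 := (notMem_tsupport_iff_eventuallyEq.1 h)
      have e1 : coneLaplacian c ψ y = 0 := by
        rw [coneLaplacian, InnerProductSpace.laplacian_eq_iteratedFDeriv_orthonormalBasis ψ
          (EuclideanSpace.basisFun (Fin 3) ℝ)]
        simp only [iteratedFDeriv_two_apply]
        simp [h1.fderiv.fderiv_eq, h1.fderiv_eq]
      simp [e1]
  have hle : ∀ n : ℕ, 1 / ((n : ℝ) + 1) ≤ 1 := fun n => by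
    rw [div_le_one (by positivity)]
    linarith [(n.cast_nonneg : (0 : ℝ) ≤ n)]
  have hlim : ∀ y, Tendsto (fun n => u n y * coneLaplacian c ψ y) atTop
      (𝓝 (p y * coneLaplacian c ψ y)) := by
    intro y
    rw [tendsto_iff_norm_sub_tendsto_zero]
    refine squeeze_zero (fun _ => norm_nonneg _) (fun n => hdist n y) ?_
    simpa using (tendsto_one_div_add_atTop_nhds_zero_nat (𝕜 := ℝ)).mul_const |coneLaplacian c ψ y|
  have hp : ∀ n y, |u n y * coneLaplacian c ψ y| ≤
      |u 0 y * coneLaplacian c ψ y| + 2 * |coneLaplacian c ψ y| := by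
    intro n y
    have h1 := hdist n y
    have h2 := hdist 0 y
    have h3 := mul_le_mul_of_nonneg_right (hle n) (abs_nonneg (coneLaplacian c ψ y))
    have h4 := mul_le_mul_of_nonneg_right (hle 0) (abs_nonneg (coneLaplacian c ψ y))
    rw [abs_le] at h1 h2
    rw [abs_le]
    have h5 := neg_abs_le (u 0 y * coneLaplacian c ψ y)
    have h6 := le_abs_self (u 0 y * coneLaplacian c ψ y)
    constructor <;> linarith [h1.1, h1.2, h2.1, h2.2]
  have hB := (hu1 0).abs.add (hL.abs.const_mul 2)
  have hT := tendsto_integral_of_dominated_convergence _ (fun n => (hu1 n).aestronglyMeasurable) hB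
    (fun n => Eventually.of_forall (hp n)) (Eventually.of_forall hlim)
  refine ⟨hB.mono' (aestronglyMeasurable_of_tendsto_ae _ (fun n => (hu1 n).aestronglyMeasurable)
    (Eventually.of_forall hlim)) (Eventually.of_forall fun y => ?_),
    le_of_tendsto' hT fun n => hu2 n⟩
  exact le_of_tendsto' (hlim y).norm fun n => hp n y

end IsMinPair

/-! ### The slope of the minimum -/

theorem gradSq_congr_of_fderiv {c : ℝ} {u v : E3 → ℝ} {y : E3} (h : fderiv ℝ u y = fderiv ℝ v y) :
    gradSq c u y = gradSq c v y := by
  rw [gradSq, gradSq, gradient, gradient, h]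

theorem inner_gradient (u : E3 → ℝ) (y v : E3) : inner ℝ (gradient u y) v = fderiv ℝ u y v := by
  rw [gradient, InnerProductSpace.toDual_symm_apply]

theorem gradSq_eq (c : ℝ) (u : E3 → ℝ) (y : E3) : gradSq c u y =
    ∑ i, fderiv ℝ u y (unitVec i) * fderiv ℝ u y (unitVec i) -
      c ^ 2 / (1 + c ^ 2) * fderiv ℝ u y (radial y) ^ 2 := by
  rw [gradSq, inner_gradient, norm_sq_eq_sum]
  congr 1
  refine Finset.sum_congr rfl fun i _ => ?_
  rw [← inner_gradient, unitVec, EuclideanSpace.inner_single_right]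
  simp

theorem gradSq_of_fderiv_eq_zero {c : ℝ} {u : E3 → ℝ} {y : E3} (h : fderiv ℝ u y = 0) :
    gradSq c u y = 0 := by
  rw [gradSq_eq, h]
  simp

theorem continuousAt_gradSq {c : ℝ} {u : E3 → ℝ} {y : E3} (hy : y ≠ 0) (hu : ContDiffAt ℝ 1 u y) :
    ContinuousAt (gradSq c u) y := by
  have e : gradSq c u = fun x => ∑ i, fderiv ℝ u x (unitVec i) * fderiv ℝ u x (unitVec i) -
      c ^ 2 / (1 + c ^ 2) * fderiv ℝ u x (radial x) ^ 2 := funext fun x => gradSq_eq c u x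
  have h1 : ContinuousAt (fderiv ℝ u) y := (hu.fderiv_right (m := 0) (by norm_num)).continuousAt
  have h2 : ContinuousAt radial y :=
    (continuous_norm.continuousAt.inv₀ (by simpa using hy)).smul continuousAt_id
  rw [e]
  refine ContinuousAt.sub ?_ (continuousAt_const.mul ((h1.clm_apply h2).pow 2))
  exact tendsto_finsetSum _ fun i _ =>
    (h1.clm_apply continuousAt_const).mul (h1.clm_apply continuousAt_const)

theorem eventually_gradSq_or {c : ℝ} {V W : E3 → ℝ} {x : E3} (hx : x ≠ 0)
    (hV : ContDiffAt ℝ 1 V x) (hW : ContDiffAt ℝ 1 W x) (h : gradSq c V x < 1 ∨ W x < V x) :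
    ∃ q < 1, ∀ᶠ y in 𝓝 x, gradSq c V y ≤ q ∨ W y < V y := by
  rcases h with h | h
  · obtain ⟨q, hq1, hq2⟩ := exists_between h
    exact ⟨q, hq2, ((continuousAt_gradSq hx hV).eventually (gt_mem_nhds hq1)).mono
      fun y hy => Or.inl hy.le⟩
  · exact ⟨0, zero_lt_one, (hW.continuousAt.eventually_lt hV.continuousAt h).mono
      fun y hy => Or.inr hy⟩

/-- At a point of differentiability near x either min(V, W) ≤ 0 and p has a local minimum, so its
gradient vanishes, or p touches the smaller of V and W from below and has the same gradient. A
function that is strictly the larger one at x stays inactive nearby, so its gradient is not needed.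
-/
theorem gradLimsupLtOne_of_eventuallyEq {c : ℝ} {V W p : E3 → ℝ} {x : E3} (hx : x ≠ 0)
    (hV : ContDiffAt ℝ 1 V x) (hW : ContDiffAt ℝ 1 W x)
    (hp : p =ᶠ[𝓝 x] fun y => max (min (V y) (W y)) 0)
    (h1 : gradSq c V x < 1 ∨ W x < V x) (h2 : gradSq c W x < 1 ∨ V x < W x) :
    GradLimsupLtOne c p x := by
  constructor
  · obtain ⟨K₁, s₁, hs₁, hL₁⟩ := hV.exists_lipschitzOnWith
    obtain ⟨K₂, s₂, hs₂, hL₂⟩ := hW.exists_lipschitzOnWith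
    have hmm : LipschitzWith 1 fun q : ℝ × ℝ => max (min q.1 q.2) 0 := by
      have := (lipschitzWith_max.comp ((lipschitzWith_min).prodMk (LipschitzWith.const (0 : ℝ))))
      simpa using! this
    refine ⟨1 * max K₁ K₂, (s₁ ∩ s₂) ∩ {y | p y = max (min (V y) (W y)) 0},
      inter_mem (inter_mem hs₁ hs₂) hp, ?_⟩
    have h3 := (hmm.lipschitzOnWith (s := univ)).comp
      ((hL₁.mono (inter_subset_left (t := s₂))).prodMk (hL₂.mono inter_subset_right))
      (mapsTo_univ _ _)
    intro a ha b hb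
    rw [ha.2, hb.2]
    exact h3 ha.1 hb.1
  · obtain ⟨q₁, hq₁, e1⟩ := eventually_gradSq_or hx hV hW h1
    obtain ⟨q₂, hq₂, e2⟩ := eventually_gradSq_or hx hW hV h2
    set q := max (max q₁ q₂) 0 with hq
    have hq1 : q < 1 := max_lt (max_lt hq₁ hq₂) one_pos
    have hqle : q₁ ≤ q := (le_max_left _ _).trans (le_max_left _ _)
    have hqle' : q₂ ≤ q := (le_max_right _ _).trans (le_max_left _ _)
    have hb : ENNReal.ofReal (Real.sqrt q) < 1 := by
      rw [ENNReal.ofReal_lt_one, Real.sqrt_lt' one_pos]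
      simpa using hq1
    refine (limsup_le_of_le (by isBoundedDefault) ?_).trans_lt hb
    have hVd : ∀ᶠ y in 𝓝 x, DifferentiableAt ℝ V y :=
      (hV.eventually (by simp)).mono fun _ h => h.differentiableAt one_ne_zero
    have hWd : ∀ᶠ y in 𝓝 x, DifferentiableAt ℝ W y :=
      (hW.eventually (by simp)).mono fun _ h => h.differentiableAt one_ne_zero
    filter_upwards [hp.eventuallyEq_nhds, hVd, hWd, e1, e2] with y hpy hVy hWy h3 h4
    rw [gradNorm]
    split_ifs with hd
    · refine ENNReal.ofReal_le_ofReal (Real.sqrt_le_sqrt ?_)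
      have hval : p y = max (min (V y) (W y)) 0 := hpy.eq_of_nhds
      rcases le_or_gt (min (V y) (W y)) 0 with hle | hgt
      · have hmin : IsLocalMin p y := by
          filter_upwards [hpy] with s hs
          rw [hval, max_eq_right hle, hs]
          exact le_max_right _ _
        rw [gradSq_of_fderiv_eq_zero hmin.fderiv_eq_zero]
        exact le_max_right _ _
      · have hpos : ∀ᶠ s in 𝓝 y, 0 < min (V s) (W s) :=
          (hVy.continuousAt.min hWy.continuousAt).eventually (lt_mem_nhds hgt)
        have heq : ∀ {U : E3 → ℝ}, DifferentiableAt ℝ U y → p y = U y →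
            (∀ᶠ s in 𝓝 y, p s ≤ U s) → gradSq c p y = gradSq c U y := by
          intro U hU hU1 hU2
          have hmin : IsLocalMin (fun s => U s - p s) y := by
            filter_upwards [hU2] with s hs
            rw [hU1, sub_self]
            linarith
          have := hmin.fderiv_eq_zero
          rw [fderiv_fun_sub hU hd.2, sub_eq_zero] at this
          exact gradSq_congr_of_fderiv this.symm
        rw [max_eq_left hgt.le] at hval
        rcases le_or_gt (V y) (W y) with hVW | hWV
        · rw [heq hVy (by rw [hval, min_eq_left hVW]) (by
            filter_upwards [hpy, hpos] with s hs hs'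
            rw [hs, max_eq_left hs'.le]
            exact min_le_left _ _)]
          exact (h3.resolve_right (not_lt.2 hVW)).trans hqle
        · rw [heq hWy (by rw [hval, min_eq_right hWV.le]) (by
            filter_upwards [hpy, hpos] with s hs hs'
            rw [hs, max_eq_left hs'.le]
            exact min_le_right _ _)]
          exact (h4.resolve_right (not_lt.2 hWV.le)).trans hqle'
    · exact zero_le

theorem eq_zero_of_mem_frontier {p m : E3 → ℝ} {x : E3} (hm : ContinuousAt m x)
    (hp : p =ᶠ[𝓝 x] fun y => max (m y) 0) (hx : x ∈ frontier {y | 0 < p y}) : m x = 0 := by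
  rcases lt_trichotomy (m x) 0 with h | h | h
  · exfalso
    have h1 : ∀ᶠ y in 𝓝 x, ¬ 0 < p y := by
      filter_upwards [hp, hm.eventually (gt_mem_nhds h)] with y h2 h3
      rw [h2, max_eq_right h3.le]
      exact lt_irrefl 0
    exact (mem_closure_iff_frequently.1 hx.1) h1
  · exact h
  · exfalso
    refine hx.2 (mem_interior_iff_mem_nhds.2 ?_)
    filter_upwards [hp, hm.eventually (lt_mem_nhds h)] with y h2 h3
    show 0 < p y
    rw [h2]
    exact lt_max_of_lt_left h3

namespace IsMinPair

variable {c : ℝ} {V W p : E3 → ℝ}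

theorem eventuallyEq_on (H : IsMinPair c V W p) {y : E3} (hy : y ∈ singularRay) (hy1 : ‖y‖ < 1) :
    p =ᶠ[𝓝 y] fun x => max (W x) 0 := by
  have hn : ∀ᶠ x in 𝓝 y, ‖x‖ < 1 := (continuous_norm.tendsto y).eventually (gt_mem_nhds hy1)
  rcases le_or_gt 0 (W y) with hW | hW
  · filter_upwards [hn, H.eventually_le hy hy1 hW] with x h1 h2
    by_cases h : x ∈ singularRay
    · exact H.eq_on x h h1
    · rw [H.eq_off x h, min_eq_right (h2 h)]
  · filter_upwards [hn, (H.continuous_right.tendsto y).eventually (gt_mem_nhds hW)] with x h1 h2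
    by_cases h : x ∈ singularRay
    · exact H.eq_on x h h1
    · rw [H.eq_off x h, max_eq_right ((min_le_right _ _).trans h2.le), max_eq_right h2.le]

/-- At a free boundary point off the ray min(V, W) = 0, so if one of the two is positive there it is
inactive and the other has a slope bound. On the ray p = max(W, 0) nearby, which is the case V = W;
the vertex is excluded by W(0) > 0. -/
theorem gradLimsupLtOne (H : IsMinPair c V W p) {x : E3} (hx1 : ‖x‖ < 1)
    (hx : x ∈ frontier {y | 0 < p y}) : GradLimsupLtOne c p x := by
  by_cases h : x ∈ singularRay
  · have e := H.eventuallyEq_on h hx1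
    have h0 := eq_zero_of_mem_frontier H.continuous_right.continuousAt e hx
    have hne : x ≠ 0 := by
      rintro rfl
      exact H.vertex_pos.ne' h0
    have hW := (H.contDiffAt_right x hne).of_le (m := 1) (by norm_num)
    have hg := H.slope_right x hne hx1 h0
    exact gradLimsupLtOne_of_eventuallyEq hne hW hW (by simpa using e) (Or.inl hg) (Or.inl hg)
  · have hne : x ≠ 0 := by
      rintro rfl
      exact h zero_mem_singularRay
    have hV := (H.contDiffAt_left x h).of_le (m := 1) (by norm_num)
    have hW := (H.contDiffAt_right x hne).of_le (m := 1) (by norm_num)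
    have e : p =ᶠ[𝓝 x] fun y => max (min (V y) (W y)) 0 := by
      filter_upwards [isClosed_singularRay.isOpen_compl.mem_nhds h] with y hy using H.eq_off y hy
    have h0 := eq_zero_of_mem_frontier (hV.continuousAt.min hW.continuousAt) e hx
    have hVn : 0 ≤ V x := h0 ▸ min_le_left (V x) (W x)
    have hWn : 0 ≤ W x := h0 ▸ min_le_right (V x) (W x)
    refine gradLimsupLtOne_of_eventuallyEq hne hV hW e ?_ ?_
    · rcases hVn.eq_or_lt with h1 | h1
      · exact Or.inl (H.slope_left x h hx1 h1.symm hWn)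
      · refine Or.inr ?_
        rcases min_choice (V x) (W x) with h2 | h2 <;> rw [h2] at h0 <;> linarith
    · rcases hWn.eq_or_lt with h1 | h1
      · exact Or.inl (H.slope_right x hne hx1 h1.symm)
      · refine Or.inr ?_
        rcases min_choice (V x) (W x) with h2 | h2 <;> rw [h2] at h0 <;> linarith

end IsMinPair

/-! ### The gradient in polar form -/

theorem abs_cosAngle_le (y : E3) : |cosAngle y| ≤ 1 := by
  rw [cosAngle, abs_div, abs_norm]
  exact div_le_one_of_le₀ (PiLp.norm_apply_le y 2) (norm_nonneg _)

theorem cosAngle_eq_of_mem {y : E3} (hy : y ∈ singularRay) (hy0 : y ≠ 0) : cosAngle y = -1 := by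
  have hr : ‖y‖ ≠ 0 := by simpa using hy0
  rw [cosAngle, show y 2 = -‖y‖ from hy, neg_div, div_self hr]

theorem ne_zero_of_notMem {y : E3} (hy : y ∉ singularRay) : y ≠ 0 := by
  rintro rfl
  exact hy zero_mem_singularRay

theorem neg_one_lt_cosAngle {y : E3} (hy : y ∉ singularRay) : -1 < cosAngle y := by
  refine lt_of_le_of_ne (abs_le.1 (abs_cosAngle_le y)).1 fun h => hy ?_
  show y 2 = -‖y‖
  rw [← mul_cosAngle, ← h]
  ring

theorem gradSq_of_hasFDerivAt {c A B : ℝ} {u : E3 → ℝ} {y : E3} (hy : y ≠ 0)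
    (hu : HasFDerivAt u (polarCovector A B y) y) : gradSq c u y =
      (1 - c ^ 2 / (1 + c ^ 2)) * (A * ‖y‖ + B * cosAngle y) ^ 2 + B ^ 2 * (1 - cosAngle y ^ 2) := by
  have hr : ‖y‖ ≠ 0 := by simpa using hy
  have hn := norm_sq_eq_sum y
  have ht := mul_cosAngle y
  have hrad : polarCovector A B y (radial y) = A * ‖y‖ + B * cosAngle y := by
    rw [radial, map_smul, polarCovector_self, ← ht, smul_eq_mul]
    field_simp
  rw [gradSq_eq, hu.fderiv, hrad]
  simp only [polarCovector_unitVec]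
  simp only [Fin.sum_univ_three, show (2 : Fin 3) ≠ 0 by decide, show (2 : Fin 3) ≠ 1 by decide,
    if_true, if_false] at hn ⊢
  rw [← ht] at hn ⊢
  generalize c ^ 2 / (1 + c ^ 2) = k
  linear_combination -A ^ 2 * hn

theorem exists_bound_comp_cosAngle {h : ℝ → ℝ} (hh : Continuous h) : ∃ C : ℝ, 0 ≤ C ∧
    ∀ y : E3, |h (cosAngle y)| ≤ C := by
  obtain ⟨C, hC⟩ := (isCompact_Icc (a := (-1 : ℝ)) (b := 1)).exists_bound_of_continuousOn
    hh.continuousOn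
  refine ⟨C, (norm_nonneg _).trans (hC 0 (by norm_num)), fun y => hC _ ?_⟩
  exact abs_le.1 (abs_cosAngle_le y)

theorem continuous_polarTerm {a : ℝ} (ha : 0 < a) {h : ℝ → ℝ} (hh : Continuous h) :
    Continuous (polarTerm a h) := by
  rw [continuous_iff_continuousAt]
  intro y
  rcases eq_or_ne y 0 with rfl | hy
  · obtain ⟨C, hC0, hC⟩ := exists_bound_comp_cosAngle hh
    have h0 : polarTerm a h 0 = 0 := by simp [polarTerm, Real.zero_rpow ha.ne']
    have hlim : Tendsto (fun y : E3 => ‖y‖ ^ a * C) (𝓝 0) (𝓝 0) := by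
      have := ((continuous_norm (E := E3)).rpow_const fun _ => Or.inr ha.le).mul_const C
      exact this.tendsto' 0 0 (by simp [Real.zero_rpow ha.ne'])
    rw [ContinuousAt, h0]
    refine squeeze_zero_norm (fun y => ?_) hlim
    rw [polarTerm, norm_mul, Real.norm_of_nonneg (by positivity)]
    exact mul_le_mul_of_nonneg_left (hC y) (by positivity)
  · exact (continuous_norm.continuousAt.rpow_const (Or.inl (by simpa using hy))).mul
      (hh.continuousAt.comp (contDiffAt_cosAngle (n := 0) hy).continuousAt)

theorem norm_polarCovector_le (A B : ℝ) (y : E3) : ‖polarCovector A B y‖ ≤ |A| * ‖y‖ + |B| := by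
  refine ContinuousLinearMap.opNorm_le_bound _ (by positivity) fun v => ?_
  rw [polarCovector_apply, Real.norm_eq_abs]
  refine (abs_add_le _ _).trans ?_
  rw [abs_mul, abs_mul, add_mul, mul_assoc]
  exact add_le_add (mul_le_mul_of_nonneg_left (abs_real_inner_le_norm _ _) (abs_nonneg _))
    (mul_le_mul_of_nonneg_left (PiLp.norm_apply_le v 2) (abs_nonneg _))

theorem bound_fderiv_polarTerm {a : ℝ} (ha : 1 ≤ a) {h : ℝ → ℝ} (hh : ContDiff ℝ 1 h) :
    ∃ C : ℝ, ∀ᶠ y in 𝓝[≠] (0 : E3), ‖fderiv ℝ (polarTerm a h) y‖ ≤ C := by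
  obtain ⟨C, hC0, hC⟩ := exists_bound_comp_cosAngle hh.continuous
  obtain ⟨D, hD0, hD⟩ := exists_bound_comp_cosAngle (hh.continuous_deriv le_rfl)
  refine ⟨a * C + 2 * D, ?_⟩
  have h1 : ∀ᶠ y : E3 in 𝓝 0, ‖y‖ < 1 :=
    (continuous_norm.tendsto' (0 : E3) 0 norm_zero).eventually (gt_mem_nhds one_pos)
  filter_upwards [nhdsWithin_le_nhds h1, self_mem_nhdsWithin] with y hy1 hy0
  have hr : 0 < ‖y‖ := by simpa using hy0
  rw [(hasFDerivAt_polarTerm hy0 (hh.differentiable one_ne_zero _).hasDerivAt).fderiv]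
  refine (norm_polarCovector_le _ _ _).trans ?_
  have e : ‖y‖ ^ (a - 2) * ‖y‖ = ‖y‖ ^ (a - 1) := by
    rw [← Real.rpow_add_one hr.ne']
    ring_nf
  have hle : ‖y‖ ^ (a - 1) ≤ 1 := Real.rpow_le_one hr.le hy1.le (by linarith)
  have hle0 : 0 ≤ ‖y‖ ^ (a - 1) := by positivity
  have h2 : |a * h (cosAngle y) - cosAngle y * deriv h (cosAngle y)| ≤ a * C + D := by
    refine (abs_sub _ _).trans (add_le_add ?_ ?_)
    · rw [abs_mul, abs_of_nonneg (by linarith : 0 ≤ a)]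
      exact mul_le_mul_of_nonneg_left (hC y) (by linarith)
    · rw [abs_mul]
      exact (mul_le_of_le_one_left (abs_nonneg _) (abs_cosAngle_le y)).trans (hD y)
  rw [abs_mul, abs_mul, abs_of_nonneg hle0, abs_of_nonneg (by positivity : 0 ≤ ‖y‖ ^ (a - 2)),
    mul_right_comm, e]
  have h3 : ‖y‖ ^ (a - 1) * |a * h (cosAngle y) - cosAngle y * deriv h (cosAngle y)| ≤ a * C + D :=
    (mul_le_of_le_one_left (abs_nonneg _) hle).trans h2
  have h4 : ‖y‖ ^ (a - 1) * |deriv h (cosAngle y)| ≤ D :=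
    (mul_le_of_le_one_left (abs_nonneg _) hle).trans (hD y)
  linarith

/-! ### The function `w` -/

section

variable {z L α₁ α₂ α₃ : ℝ}

/-- The function `w`, with the scaling factor `L`. -/
def waveCone (z L α₁ α₂ α₃ : ℝ) (y : E3) : ℝ :=
  L * (0.235 - 0.045 * z) + polarTerm α₁ (fun t => L * (0.965 + 0.066 * z) * t) y +
    polarTerm α₂ (fun t => L * (-0.37 * z) * (3 / 2 * (t * t) - 1 / 2)) y +
    polarTerm α₃ (fun t => L * (0.233 * z) * (t * (5 / 2 * (t * t) - 3 / 2))) y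

theorem waveCone_eq (y : E3) :
    waveCone z L α₁ α₂ α₃ y = L * waveFn z α₁ α₂ α₃ ‖y‖ (cosAngle y) := by
  simp only [waveCone, waveFn, profileSum, polarTerm]
  ring

theorem IsExponent.one_le {n : ℕ} {α : ℝ} (h : IsExponent z n α) (hz0 : 0 ≤ z) (hn : 1 ≤ n) :
    1 ≤ α := by
  obtain ⟨h0, h1⟩ := h
  have hn' : (1 : ℝ) ≤ n := by exact_mod_cast hn
  by_contra! hc
  have h2 : α * (α + 1) < 2 := by nlinarith
  have h3 : 0 ≤ α * (α + 1) := by positivity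
  nlinarith

theorem continuous_waveCone (h1 : 1 ≤ α₁) (h2 : 1 ≤ α₂) (h3 : 1 ≤ α₃) :
    Continuous (waveCone z L α₁ α₂ α₃) :=
  (((continuous_const.add (continuous_polarTerm (by linarith) (by fun_prop))).add
    (continuous_polarTerm (by linarith) (by fun_prop))).add
    (continuous_polarTerm (by linarith) (by fun_prop)))

theorem waveCone_zero (h1 : 1 ≤ α₁) (h2 : 1 ≤ α₂) (h3 : 1 ≤ α₃) :
    waveCone z L α₁ α₂ α₃ 0 = L * (0.235 - 0.045 * z) := by
  simp [waveCone, polarTerm, Real.zero_rpow (by linarith : α₁ ≠ 0),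
    Real.zero_rpow (by linarith : α₂ ≠ 0), Real.zero_rpow (by linarith : α₃ ≠ 0)]

theorem contDiffAt_waveCone {y : E3} (hy : y ≠ 0) : ContDiffAt ℝ 2 (waveCone z L α₁ α₂ α₃) y :=
  ((contDiffAt_const.add (contDiffAt_polarTerm (n := 2) hy (by fun_prop))).add
    (contDiffAt_polarTerm (n := 2) hy (by fun_prop))).add
    (contDiffAt_polarTerm (n := 2) hy (by fun_prop))

theorem divergence_waveCone (h1 : IsExponent z 1 α₁) (h2 : IsExponent z 2 α₂)
    (h3 : IsExponent z 3 α₃) {y : E3} (hy : y ≠ 0) :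
    divergence (coneFlux z (waveCone z L α₁ α₂ α₃)) y = 0 := by
  have e1 := divergence_polarTerm (k := z) (a := α₁) (zonalProfile_id.const_mul
    (L * (0.965 + 0.066 * z))) (by linear_combination -(1 : ℝ) * h1.2) hy (mem_univ _)
  have e2 := divergence_polarTerm (k := z) (a := α₂) (zonalProfile_two.const_mul
    (L * (-0.37 * z))) (by linear_combination -(1 : ℝ) * h2.2) hy (mem_univ _)
  have e3 := divergence_polarTerm (k := z) (a := α₃) (zonalProfile_three.const_mul
    (L * (0.233 * z))) (by linear_combination -(1 : ℝ) * h3.2) hy (mem_univ _)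
  have e0 : divergence (coneFlux z fun _ : E3 => L * (0.235 - 0.045 * z)) y = 0 := by
    have : coneFlux z (fun _ : E3 => L * (0.235 - 0.045 * z)) = fun _ _ => 0 := by
      funext x i
      simp [coneFlux, raise]
    rw [this]
    simp [divergence]
  have c1 : ContDiffAt ℝ 2 (polarTerm α₁ fun t => L * (0.965 + 0.066 * z) * t) y :=
    contDiffAt_polarTerm (n := 2) hy (by fun_prop)
  have c2 : ContDiffAt ℝ 2
      (polarTerm α₂ fun t => L * (-0.37 * z) * (3 / 2 * (t * t) - 1 / 2)) y :=
    contDiffAt_polarTerm (n := 2) hy (by fun_prop)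
  have c3 : ContDiffAt ℝ 2
      (polarTerm α₃ fun t => L * (0.233 * z) * (t * (5 / 2 * (t * t) - 3 / 2))) y :=
    contDiffAt_polarTerm (n := 2) hy (by fun_prop)
  unfold waveCone
  rw [divergence_coneFlux_add hy ((contDiffAt_const.add c1).add c2) c3,
    divergence_coneFlux_add hy (contDiffAt_const.add c1) c2,
    divergence_coneFlux_add hy contDiffAt_const c1, e0, e1, e2, e3]
  norm_num

theorem bound_fderiv_waveCone (h1 : 1 ≤ α₁) (h2 : 1 ≤ α₂) (h3 : 1 ≤ α₃) :
    ∃ C : ℝ, ∀ᶠ y in 𝓝[≠] (0 : E3), ‖fderiv ℝ (waveCone z L α₁ α₂ α₃) y‖ ≤ C := by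
  obtain ⟨C₁, b1⟩ := bound_fderiv_polarTerm h1 (h := fun t => L * (0.965 + 0.066 * z) * t)
    (by fun_prop)
  obtain ⟨C₂, b2⟩ := bound_fderiv_polarTerm h2
    (h := fun t => L * (-0.37 * z) * (3 / 2 * (t * t) - 1 / 2)) (by fun_prop)
  obtain ⟨C₃, b3⟩ := bound_fderiv_polarTerm h3
    (h := fun t => L * (0.233 * z) * (t * (5 / 2 * (t * t) - 3 / 2))) (by fun_prop)
  refine ⟨C₁ + C₂ + C₃, ?_⟩
  filter_upwards [b1, b2, b3, self_mem_nhdsWithin] with y b1 b2 b3 hy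
  have c1 : DifferentiableAt ℝ (polarTerm α₁ fun t => L * (0.965 + 0.066 * z) * t) y :=
    (contDiffAt_polarTerm (n := 1) hy (by fun_prop)).differentiableAt (by norm_num)
  have c2 : DifferentiableAt ℝ
      (polarTerm α₂ fun t => L * (-0.37 * z) * (3 / 2 * (t * t) - 1 / 2)) y :=
    (contDiffAt_polarTerm (n := 1) hy (by fun_prop)).differentiableAt (by norm_num)
  have c3 : DifferentiableAt ℝ
      (polarTerm α₃ fun t => L * (0.233 * z) * (t * (5 / 2 * (t * t) - 3 / 2))) y :=
    (contDiffAt_polarTerm (n := 1) hy (by fun_prop)).differentiableAt (by norm_num)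
  have e := ((c1.hasFDerivAt.const_add (L * (0.235 - 0.045 * z))).add c2.hasFDerivAt).add
    c3.hasFDerivAt
  rw [HasFDerivAt.fderiv (f := waveCone z L α₁ α₂ α₃) e]
  exact (norm_add_le _ _).trans (add_le_add ((norm_add_le _ _).trans (add_le_add b1 b2)) b3)

theorem gradSq_waveCone {c : ℝ} {y : E3} (hy : y ≠ 0) :
    gradSq c (waveCone z L α₁ α₂ α₃) y * ‖y‖ ^ 2 = L ^ 2 *
      ((1 - c ^ 2 / (1 + c ^ 2)) * waveRadial z α₁ α₂ α₃ ‖y‖ (cosAngle y) ^ 2 +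
        (1 - cosAngle y ^ 2) * waveAngular z α₁ α₂ α₃ ‖y‖ (cosAngle y) ^ 2) := by
  have hr : 0 < ‖y‖ := by simpa using hy
  set t := cosAngle y with ht
  have d1 : HasDerivAt (fun t => L * (0.965 + 0.066 * z) * t) (L * (0.965 + 0.066 * z)) t :=
    ((hasDerivAt_id t).const_mul _).congr_deriv (by simp)
  have d2 : HasDerivAt (fun t => L * (-0.37 * z) * (3 / 2 * (t * t) - 1 / 2))
      (L * (-0.37 * z) * (3 * t)) t :=
    ((((hasDerivAt_id t).mul (hasDerivAt_id t)).const_mul (3 / 2) |>.sub_const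
      (1 / 2)).congr_deriv (by simp; ring)).const_mul _
  have d3 : HasDerivAt (fun t => L * (0.233 * z) * (t * (5 / 2 * (t * t) - 3 / 2)))
      (L * (0.233 * z) * (15 / 2 * (t * t) - 3 / 2)) t :=
    (((hasDerivAt_id t).mul (((hasDerivAt_id t).mul (hasDerivAt_id t)).const_mul (5 / 2)
      |>.sub_const (3 / 2))).congr_deriv (by simp; ring)).const_mul _
  have e := (((hasFDerivAt_polarTerm (a := α₁) hy d1).const_add (L * (0.235 - 0.045 * z))).add
    (hasFDerivAt_polarTerm (a := α₂) hy d2)).add (hasFDerivAt_polarTerm (a := α₃) hy d3)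
  rw [polarCovector_add, polarCovector_add] at e
  rw [gradSq_of_hasFDerivAt (u := waveCone z L α₁ α₂ α₃) hy e, ← ht]
  have p2 : ∀ a : ℝ, ‖y‖ ^ (a - 2) = ‖y‖ ^ a * (‖y‖ ^ 2)⁻¹ := by
    intro a
    rw [Real.rpow_sub hr, div_eq_mul_inv]
    norm_cast
  have p1 : ∀ a : ℝ, ‖y‖ ^ (a - 1) = ‖y‖ ^ a * ‖y‖⁻¹ := by
    intro a
    rw [Real.rpow_sub hr, Real.rpow_one, div_eq_mul_inv]
  simp only [p1, p2, waveRadial, waveAngular]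
  generalize ‖y‖ ^ α₁ = q₁
  generalize ‖y‖ ^ α₂ = q₂
  generalize ‖y‖ ^ α₃ = q₃
  generalize c ^ 2 / (1 + c ^ 2) = k
  field_simp
  ring

end

/-! ### The function `v` -/

section

variable {z L α₁ α₂ α₃ : ℝ}

/-- The function `v`, with the scaling factor `L`. -/
def bubbleCone (z L : ℝ) (y : E3) : ℝ :=
  polarTerm 1 (fun t => L * profF z t) y +
    polarTerm (-(1 / 2)) (fun t => L * (0.17 - 0.3 * z) * profG z t) y

theorem zonalProfile_profF (hz0 : 0 ≤ z) (hz1 : z ≤ 0.15605) :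
    ZonalProfile (2 * (1 - z)) (profF z) (Ioo (-1) 3) :=
  zonalProfile_legendreFn (by linarith) (by linarith)

theorem zonalProfile_profG (hz0 : 0 ≤ z) (hz1 : z ≤ 0.15605) :
    ZonalProfile (-(1 - z) / 4) (profG z) (Ioo (-1) 3) :=
  zonalProfile_legendreFn (by linarith) (by linarith)

theorem cosAngle_mem_Ioo {y : E3} (hy : y ∉ singularRay) : cosAngle y ∈ Ioo (-1 : ℝ) 3 :=
  ⟨neg_one_lt_cosAngle hy, by linarith [(abs_le.1 (abs_cosAngle_le y)).2]⟩

theorem contDiffAt_bubbleCone_terms (hz0 : 0 ≤ z) (hz1 : z ≤ 0.15605) {y : E3}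
    (hy : y ∉ singularRay) : ContDiffAt ℝ 2 (polarTerm 1 fun t => L * profF z t) y ∧
      ContDiffAt ℝ 2 (polarTerm (-(1 / 2)) fun t => L * (0.17 - 0.3 * z) * profG z t) y := by
  have hI := isOpen_Ioo.mem_nhds (cosAngle_mem_Ioo hy)
  exact ⟨contDiffAt_polarTerm (n := 2) (ne_zero_of_notMem hy) ((((zonalProfile_profF hz0
      hz1).const_mul L).contDiffOn.contDiffAt hI).of_le (by norm_cast)),
    contDiffAt_polarTerm (n := 2) (ne_zero_of_notMem hy) ((((zonalProfile_profG hz0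
      hz1).const_mul _).contDiffOn.contDiffAt hI).of_le (by norm_cast))⟩

theorem contDiffAt_bubbleCone (hz0 : 0 ≤ z) (hz1 : z ≤ 0.15605) {y : E3} (hy : y ∉ singularRay) :
    ContDiffAt ℝ 2 (bubbleCone z L) y :=
  (contDiffAt_bubbleCone_terms hz0 hz1 hy).1.add (contDiffAt_bubbleCone_terms hz0 hz1 hy).2

theorem divergence_bubbleCone (hz0 : 0 ≤ z) (hz1 : z ≤ 0.15605) {y : E3} (hy : y ∉ singularRay) :
    divergence (coneFlux z (bubbleCone z L)) y = 0 := by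
  obtain ⟨c1, c2⟩ := contDiffAt_bubbleCone_terms (L := L) hz0 hz1 hy
  have hy0 := ne_zero_of_notMem hy
  have hI := cosAngle_mem_Ioo hy
  unfold bubbleCone
  rw [divergence_coneFlux_add hy0 c1 c2,
    divergence_polarTerm ((zonalProfile_profF hz0 hz1).const_mul L) (by ring) hy0 hI,
    divergence_polarTerm ((zonalProfile_profG hz0 hz1).const_mul _) (by ring) hy0 hI, add_zero]

theorem bubbleCone_eq (y : E3) : bubbleCone z L y = L * (‖y‖ * profF z (cosAngle y) +
    (0.17 - 0.3 * z) * ‖y‖ ^ (-(1 / 2) : ℝ) * profG z (cosAngle y)) := by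
  simp only [bubbleCone, polarTerm, Real.rpow_one]
  ring

theorem sqrt_mul_rpow {r : ℝ} (hr : 0 < r) : Real.sqrt r * r ^ (-(1 / 2) : ℝ) = 1 := by
  rw [Real.sqrt_eq_rpow, ← Real.rpow_add hr]
  norm_num

/-- On {v = 0} one may eliminate ε r^{-3/2} = -F/g. Then, without the factor L, the radial
derivative is F + F/2 = (3/2)F and the derivative in t, over r, is F' - Fg'/g, so that r drops out.
-/
theorem gradSq_bubbleCone {c : ℝ} (hz : z = c ^ 2 / (1 + c ^ 2)) (hz0 : 0 ≤ z) (hz1 : z ≤ 0.15605)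
    (hL : 0 < L) {y : E3} (hy : y ∉ singularRay) (h0 : bubbleCone z L y = 0) :
    gradSq c (bubbleCone z L) y = L ^ 2 * energy z (cosAngle y) := by
  have hy0 := ne_zero_of_notMem hy
  have hr : 0 < ‖y‖ := by simpa using hy0
  have hI := cosAngle_mem_Ioo hy
  have hg := one_le_profG hz0 hz1 hI.1 (abs_le.1 (abs_cosAngle_le y)).2
  have e := (hasFDerivAt_polarTerm (a := 1) hy0 ((hasDerivAt_profF hz0 hz1 hI.1 hI.2).const_mul
    L)).add (hasFDerivAt_polarTerm (a := -(1 / 2)) hy0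
    ((hasDerivAt_profG hz0 hz1 hI.1 hI.2).const_mul (L * (0.17 - 0.3 * z))))
  rw [polarCovector_add] at e
  rw [gradSq_of_hasFDerivAt (u := bubbleCone z L) hy0 e, ← hz]
  rw [bubbleCone_eq] at h0
  have h1 := (mul_eq_zero.1 h0).resolve_left hL.ne'
  set R := ‖y‖ ^ (-(1 / 2) : ℝ) with hR
  have p1 : ‖y‖ ^ ((1 : ℝ) - 2) = ‖y‖⁻¹ := by
    rw [← Real.rpow_neg_one]
    norm_num
  have p2 : ‖y‖ ^ ((1 : ℝ) - 1) = 1 := by norm_num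
  have p3 : ‖y‖ ^ (-(1 / 2 : ℝ) - 2) = R * (‖y‖ ^ 2)⁻¹ := by
    rw [Real.rpow_sub hr, div_eq_mul_inv]
    norm_cast
  have p4 : ‖y‖ ^ (-(1 / 2 : ℝ) - 1) = R * ‖y‖⁻¹ := by
    rw [Real.rpow_sub hr, Real.rpow_one, div_eq_mul_inv]
  rw [p1, p2, p3, p4]
  set t := cosAngle y
  have hRv : (0.17 - 0.3 * z) * R = -(‖y‖ * profF z t / profG z t) := by
    field_simp
    linarith
  have hB : 1 * (L * profF' z t) + R * ‖y‖⁻¹ * (L * (0.17 - 0.3 * z) * profG' z t) =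
      L * crossSlope z t := by
    calc _ = L * profF' z t + L * ((0.17 - 0.3 * z) * R) * ‖y‖⁻¹ * profG' z t := by ring
      _ = _ := by
        rw [hRv, crossSlope, logSlope]
        field_simp
        ring
  have hA : (‖y‖⁻¹ * (1 * (L * profF z t) - t * (L * profF' z t)) + R * (‖y‖ ^ 2)⁻¹ *
      (-(1 / 2) * (L * (0.17 - 0.3 * z) * profG z t) - t * (L * (0.17 - 0.3 * z) * profG' z t))) *
      ‖y‖ + L * crossSlope z t * t = 3 / 2 * L * profF z t := by
    calc _ = L * (profF z t - t * profF' z t) - L * ((0.17 - 0.3 * z) * R) * ‖y‖⁻¹ *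
          (1 / 2 * profG z t + t * profG' z t) + L * crossSlope z t * t := by
            field_simp
            ring
      _ = _ := by
        rw [hRv, crossSlope, logSlope]
        field_simp
        ring
  rw [hB, hA, energy]
  ring

/-- Along its zero set, where `w ≥ 0`, the gradient of `v` is short. -/
theorem gradSq_bubbleCone_lt {c t₀ : ℝ} (hz : z = c ^ 2 / (1 + c ^ 2)) (hz0 : 0 ≤ z)
    (hz1 : z ≤ 0.15605) (hL : 0 < L) (h1 : IsExponent z 1 α₁) (h2 : IsExponent z 2 α₂)
    (h3 : IsExponent z 3 α₃) (h0 : profF z t₀ = 0) (ht1 : -0.2 < t₀) (ht₀ : t₀ < 0.01)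
    (hk : 0.9996 - 0.409 * z + 0.18 * z ^ 2 < (1 - t₀ ^ 2) * profF' z t₀ ^ 2) {y : E3}
    (hy : y ∉ singularRay) (hy1 : ‖y‖ < 1) (hV : bubbleCone z L y = 0)
    (hW : 0 ≤ waveCone z L α₁ α₂ α₃ y) :
    gradSq c (bubbleCone z L) y < L ^ 2 * ((1 - t₀ ^ 2) * profF' z t₀ ^ 2) := by
  rw [gradSq_bubbleCone hz hz0 hz1 hL hy hV]
  refine mul_lt_mul_of_pos_left ?_ (by positivity)
  have hy0 := ne_zero_of_notMem hy
  have hr : 0 < ‖y‖ := by simpa using hy0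
  have ht := neg_one_lt_cosAngle hy
  have ht' := (abs_le.1 (abs_cosAngle_le y)).2
  have hg := one_le_profG hz0 hz1 ht ht'
  rw [bubbleCone_eq] at hV
  rw [waveCone_eq] at hW
  have hV' := (mul_eq_zero.1 hV).resolve_left hL.ne'
  have hW' := nonneg_of_mul_nonneg_right hW hL
  have hR : 0 < ‖y‖ ^ (-(1 / 2) : ℝ) := by positivity
  have hε : 0 < 0.17 - 0.3 * z := by linarith
  refine energy_lt hz0 hz1 h0 ht₀ hk ?_ ?_
  -- With y = √r the function v/L is r^{-1/2}(εg + y³F), which is positive below the cut angle where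
  -- w ≥ 0.
  · by_contra! hc
    have hs := Real.sq_sqrt hr.le
    have := below_cut_pos hz0 hz1 h1 h2 h3 (y := Real.sqrt ‖y‖) (Real.sqrt_pos.2 hr)
      (Real.sqrt_le_one.2 hy1.le) ht hc (by rwa [hs])
    have h4 := mul_pos hR this
    have h5 := sqrt_mul_rpow hr
    have h6 : ‖y‖ ^ (-(1 / 2) : ℝ) * ((0.17 - 0.3 * z) * profG z (cosAngle y) +
        Real.sqrt ‖y‖ ^ 3 * profF z (cosAngle y)) = ‖y‖ * profF z (cosAngle y) +
        (0.17 - 0.3 * z) * ‖y‖ ^ (-(1 / 2) : ℝ) * profG z (cosAngle y) := by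
      linear_combination (profF z (cosAngle y) * Real.sqrt ‖y‖ ^ 2) * h5 +
        profF z (cosAngle y) * hs
    linarith
  · have hneg : profF z (cosAngle y) < 0 := by
      have : 0 < (0.17 - 0.3 * z) * ‖y‖ ^ (-(1 / 2) : ℝ) * profG z (cosAngle y) := by positivity
      by_contra! hc
      have := mul_nonneg hr.le hc
      linarith
    rw [← h0] at hneg
    exact (strictMonoOn_profF hz0 hz1).lt_iff_lt ⟨ht, ht'⟩ ⟨by linarith, by linarith⟩ |>.1 hneg

theorem gradSq_waveCone_lt {c K : ℝ} (hz : z = c ^ 2 / (1 + c ^ 2)) (hz0 : 0 ≤ z)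
    (hz1 : z ≤ 0.15605) (hL : 0 < L) (h1 : IsExponent z 1 α₁) (h2 : IsExponent z 2 α₂)
    (h3 : IsExponent z 3 α₃) (hk : 0.9996 - 0.409 * z + 0.18 * z ^ 2 < K) {y : E3} (hy : y ≠ 0)
    (hy1 : ‖y‖ < 1) (hW : waveCone z L α₁ α₂ α₃ y = 0) :
    gradSq c (waveCone z L α₁ α₂ α₃) y < L ^ 2 * K := by
  have hr : 0 < ‖y‖ := by simpa using hy
  rw [waveCone_eq] at hW
  obtain ⟨ht, ht'⟩ := abs_le.1 (abs_cosAngle_le y)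
  have h4 := wave_grad_lt hz0 hz1 h1 h2 h3 hr hy1.le ht ht' ((mul_eq_zero.1 hW).resolve_left hL.ne')
  have h5 := gradSq_waveCone (z := z) (L := L) (α₁ := α₁) (α₂ := α₂) (α₃ := α₃) (c := c) hy
  rw [← hz] at h5
  have hr2 : 0 < ‖y‖ ^ 2 := by positivity
  have hL2 : 0 < L ^ 2 := by positivity
  refine lt_of_mul_lt_mul_right ?_ hr2.le
  rw [h5]
  calc _ < L ^ 2 * ((0.9996 - 0.409 * z + 0.18 * z ^ 2) * ‖y‖ ^ 2) :=
        mul_lt_mul_of_pos_left h4 hL2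
    _ ≤ L ^ 2 * (K * ‖y‖ ^ 2) := by gcongr
    _ = _ := by ring

/-! ### The singularities of `v` -/

/-- From F ≥ -0.65 g. This single bound gives the blow-up at the vertex, by r^{-1/2}, and along the
ray, by g. -/
theorem le_bubbleCone (hz0 : 0 ≤ z) (hz1 : z ≤ 0.15605) (hL : 0 < L) {y : E3}
    (hy : y ∉ singularRay) : L * (((0.17 - 0.3 * z) * ‖y‖ ^ (-(1 / 2) : ℝ) - 0.65 * ‖y‖) *
      profG z (cosAngle y)) ≤ bubbleCone z L y := by
  rw [bubbleCone_eq]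
  refine mul_le_mul_of_nonneg_left ?_ hL.le
  have h := legendreFn_add_pos hz0 hz1 (neg_one_lt_cosAngle hy) (abs_le.1 (abs_cosAngle_le y)).2
  have := mul_nonneg (norm_nonneg y) h.le
  nlinarith

theorem tendsto_bubbleCone_vertex (hz0 : 0 ≤ z) (hz1 : z ≤ 0.15605) (hL : 0 < L) :
    Tendsto (bubbleCone z L) (𝓝[singularRayᶜ] 0) atTop := by
  have hε : 0 < 0.17 - 0.3 * z := by linarith
  have h1 : Tendsto (fun y : E3 => ‖y‖ ^ (-(1 / 2) : ℝ)) (𝓝[singularRayᶜ] 0) atTop := by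
    refine (tendsto_rpow_neg_nhdsGT_zero (by norm_num)).comp ?_
    refine tendsto_nhdsWithin_iff.2 ⟨(continuous_norm.tendsto' (0 : E3) 0 norm_zero).mono_left
      nhdsWithin_le_nhds, ?_⟩
    filter_upwards [self_mem_nhdsWithin] with y hy
    exact norm_pos_iff.2 (ne_zero_of_notMem hy)
  have h2 : Tendsto (fun y : E3 => L * ((0.17 - 0.3 * z) * ‖y‖ ^ (-(1 / 2) : ℝ) - 0.65))
      (𝓝[singularRayᶜ] 0) atTop :=
    (tendsto_atTop_add_const_right _ (-0.65) (h1.const_mul_atTop hε)).const_mul_atTop hL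
  have hpos := (tendsto_atTop.1 (tendsto_atTop_add_const_right _ (-0.65) (h1.const_mul_atTop hε)) 0)
  have hnear : ∀ᶠ y : E3 in 𝓝[singularRayᶜ] 0, ‖y‖ < 1 := nhdsWithin_le_nhds
    ((continuous_norm.tendsto' (0 : E3) 0 norm_zero).eventually (gt_mem_nhds one_pos))
  refine tendsto_atTop_mono' _ ?_ h2
  filter_upwards [hpos, hnear, self_mem_nhdsWithin] with y h3 h4 h5
  refine le_trans ?_ (le_bubbleCone hz0 hz1 hL h5)
  have hg := one_le_profG hz0 hz1 (neg_one_lt_cosAngle h5) (abs_le.1 (abs_cosAngle_le y)).2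
  refine mul_le_mul_of_nonneg_left ?_ hL.le
  nlinarith

theorem tendsto_bubbleCone_ray (hz0 : 0 ≤ z) (hz1 : z ≤ 0.15605) (hL : 0 < L) {y : E3}
    (hy : y ∈ singularRay) (hy0 : y ≠ 0)
    (h : 0.65 * ‖y‖ < (0.17 - 0.3 * z) * ‖y‖ ^ (-(1 / 2) : ℝ)) :
    Tendsto (bubbleCone z L) (𝓝[singularRayᶜ] y) atTop := by
  have h1 : Tendsto cosAngle (𝓝[singularRayᶜ] y) (𝓝[>] (-1)) := by
    refine tendsto_nhdsWithin_iff.2 ⟨?_, ?_⟩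
    · rw [← cosAngle_eq_of_mem hy hy0]
      exact (contDiffAt_cosAngle (n := 0) hy0).continuousAt.tendsto.mono_left nhdsWithin_le_nhds
    · filter_upwards [self_mem_nhdsWithin] with x hx using neg_one_lt_cosAngle hx
  have h2 : Tendsto (fun x => profG z (cosAngle x)) (𝓝[singularRayᶜ] y) atTop :=
    (tendsto_legendreFn_atTop (by linarith) (by linarith)).comp h1
  have h3 : ContinuousAt (fun x : E3 => (0.17 - 0.3 * z) * ‖x‖ ^ (-(1 / 2) : ℝ) - 0.65 * ‖x‖) y :=
    (continuousAt_const.mul (continuous_norm.continuousAt.rpow_const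
      (Or.inl (by simpa using hy0)))).sub (continuousAt_const.mul continuous_norm.continuousAt)
  have h4 := (h3.tendsto.mono_left nhdsWithin_le_nhds).pos_mul_atTop (by linarith) h2
  refine tendsto_atTop_mono' _ ?_ (h4.const_mul_atTop hL)
  filter_upwards [self_mem_nhdsWithin] with x hx using le_bubbleCone hz0 hz1 hL hx

/-- On the ray w ≥ 0 forces 0.66 r^{3/2} < ε, so the factor εr^{-1/2} - 0.65r of g in the lower
bound is positive. -/
theorem tendsto_sub_waveCone (hz0 : 0 ≤ z) (hz1 : z ≤ 0.15605) (hL : 0 < L)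
    (h1 : IsExponent z 1 α₁) (h2 : IsExponent z 2 α₂) (h3 : IsExponent z 3 α₃) {y : E3}
    (hy : y ∈ singularRay) (hy1 : ‖y‖ < 1) (hW : 0 ≤ waveCone z L α₁ α₂ α₃ y) :
    Tendsto (fun x => bubbleCone z L x - waveCone z L α₁ α₂ α₃ x) (𝓝[singularRayᶜ] y) atTop := by
  have hc := (continuous_waveCone (z := z) (L := L) (h1.one_le hz0 le_rfl)
    (h2.one_le hz0 (by norm_num)) (h3.one_le hz0 (by norm_num))).continuousAt (x := y)
  have hb : Tendsto (bubbleCone z L) (𝓝[singularRayᶜ] y) atTop := by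
    rcases eq_or_ne y 0 with rfl | hy0
    · exact tendsto_bubbleCone_vertex hz0 hz1 hL
    have hr : 0 < ‖y‖ := by simpa using hy0
    refine tendsto_bubbleCone_ray hz0 hz1 hL hy hy0 ?_
    rw [waveCone_eq, cosAngle_eq_of_mem hy hy0, waveFn] at hW
    have hs := Real.sq_sqrt hr.le
    have hq := powerBounds hz0 hz1 h1 h2 h3 (Real.sqrt_pos.2 hr) (Real.sqrt_le_one.2 hy1.le)
    rw [hs] at hq
    have h4 := axis_bound hz0 hz1 (Real.sqrt_nonneg _) (Real.sqrt_le_one.2 hy1.le) (t := -1) le_rfl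
      (by norm_num) hq (nonneg_of_mul_nonneg_right hW hL)
    have hR : 0 < ‖y‖ ^ (-(1 / 2) : ℝ) := by positivity
    have h5 := sqrt_mul_rpow hr
    have h6 : Real.sqrt ‖y‖ ^ 3 * ‖y‖ ^ (-(1 / 2) : ℝ) = ‖y‖ := by
      linear_combination Real.sqrt ‖y‖ ^ 2 * h5 + hs
    nlinarith [mul_lt_mul_of_pos_right h4 hR]
  simp only [sub_eq_add_neg]
  exact hb.atTop_add (hc.neg.tendsto.mono_left nhdsWithin_le_nhds)

end

/-! ### The function `p` -/

/-- A shift along the first axis keeps the third coordinate and increases the norm, hence leaves the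
ray. Without this the lower limit could not be computed as a limit. -/
theorem nhdsWithin_compl_singularRay_neBot {y : E3} (hy : y ∈ singularRay) :
    (𝓝[singularRayᶜ] y).NeBot := by
  rw [← mem_closure_iff_nhdsWithin_neBot]
  have hy2 : y 2 = -‖y‖ := hy
  have h0 : y 0 = 0 := by
    have hn := norm_sq_eq_sum y
    rw [Fin.sum_univ_three, hy2] at hn
    nlinarith [mul_self_nonneg (y 0), mul_self_nonneg (y 1)]
  have hlim : Tendsto (fun s : ℝ => y + s • unitVec 0) (𝓝[≠] 0) (𝓝 y) :=
    (Continuous.tendsto' (by fun_prop) 0 y (by simp)).mono_left nhdsWithin_le_nhds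
  refine mem_closure_of_tendsto hlim ?_
  filter_upwards [self_mem_nhdsWithin] with s (hs : s ≠ 0)
  intro (hm : (y + s • unitVec 0) 2 = -‖y + s • unitVec 0‖)
  have e : (y + s • unitVec 0) 2 = y 2 := by simp [unitVec_apply]
  rw [e, hy2, neg_inj] at hm
  have h1 := norm_sq_eq_sum (y + s • unitVec 0)
  have h2 := norm_sq_eq_sum y
  rw [← hm, h2, Fin.sum_univ_three, Fin.sum_univ_three] at h1
  simp [unitVec_apply, h0, hs] at h1

/-- Where W ≥ 0 the blow-up makes W the minimum nearby; where W < 0 the function is zero nearby,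
whatever V does. In both cases the lower limit is a limit. -/
theorem liminf_eq_of_blowup {V W m : E3 → ℝ} {y : E3} (hy : y ∈ singularRay) (hW : Continuous W)
    (hm : ∀ x ∉ singularRay, m x = max (min (V x) (W x)) 0)
    (hblow : 0 ≤ W y → Tendsto (fun x => V x - W x) (𝓝[singularRayᶜ] y) atTop) :
    liminf m (𝓝[singularRayᶜ] y) = max (W y) 0 := by
  have := nhdsWithin_compl_singularRay_neBot hy
  have hlim : Tendsto (fun x => max (W x) 0) (𝓝[singularRayᶜ] y) (𝓝 (max (W y) 0)) :=
    ((hW.max continuous_const).tendsto y).mono_left nhdsWithin_le_nhds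
  refine (hlim.congr' ?_).liminf_eq
  rcases le_or_gt 0 (W y) with h | h
  · filter_upwards [tendsto_atTop.1 (hblow h) 0, self_mem_nhdsWithin] with x h1 h2
    rw [hm x h2, min_eq_right (by linarith)]
  · filter_upwards [nhdsWithin_le_nhds ((hW.tendsto y).eventually (gt_mem_nhds h)),
      self_mem_nhdsWithin] with x h1 h2
    rw [hm x h2, max_eq_right h1.le, max_eq_right ((min_le_right _ _).trans h1.le)]

/-- The coefficients of `w` before scaling. -/
def waveCoeff (z : ℝ) : ℕ → ℝ
  | 0 => 0.235 - 0.045 * z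
  | 1 => 0.965 + 0.066 * z
  | 2 => -0.37 * z
  | _ => 0.233 * z

theorem expo_zero (c : ℝ) : expo c 0 = 0 := by
  simp [expo]

theorem wPolar_eq (c L r t : ℝ) : wPolar c 3 (fun n => L * waveCoeff (c ^ 2 / (1 + c ^ 2)) n) r t =
    L * waveFn (c ^ 2 / (1 + c ^ 2)) (expo c 1) (expo c 2) (expo c 3) r t := by
  simp only [wPolar, Finset.sum_range_succ, Finset.range_zero, Finset.sum_empty, expo_zero,
    Real.rpow_zero, legendreP_zero, legendreP_one, legendreP_two, legendreP_three, waveCoeff,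
    waveFn, profileSum]
  ring

theorem two_div_eq (c : ℝ) : 2 / (1 + c ^ 2) = 2 * (1 - c ^ 2 / (1 + c ^ 2)) := by
  have : 1 + c ^ 2 ≠ 0 := by positivity
  field_simp
  ring

theorem gProfile_eq (c t : ℝ) : gProfile c t = profG (c ^ 2 / (1 + c ^ 2)) t := by
  have : 1 + c ^ 2 ≠ 0 := by positivity
  rw [gProfile, profG]
  congr 1
  field_simp
  ring

/-! ### The functions of the statement in terms of F, g and the factor L -/

section

variable {c t₀ : ℝ}

theorem tZero_eq (hz0 : 0 ≤ c ^ 2 / (1 + c ^ 2)) (hz1 : c ^ 2 / (1 + c ^ 2) ≤ 0.15605)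
    (h0 : profF (c ^ 2 / (1 + c ^ 2)) t₀ = 0) (h1 : -0.2 < t₀) (h2 : t₀ < 0.01) :
    tZero c = t₀ := by
  have hmem : t₀ ∈ Ioc (-1 : ℝ) 1 := ⟨by linarith, by linarith⟩
  have : {t : ℝ | t ∈ Ioo (-1 : ℝ) 1 ∧ legendreFn (2 / (1 + c ^ 2)) t = 0} = {t₀} := by
    ext t
    rw [two_div_eq]
    constructor
    · rintro ⟨ht, ht0⟩
      exact (strictMonoOn_profF hz0 hz1).injOn ⟨ht.1, ht.2.le⟩ hmem (ht0.trans h0.symm)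
    · rintro rfl
      exact ⟨⟨by linarith, by linarith⟩, h0⟩
  rw [tZero, this, csSup_singleton]

/-- The slope of `F` at its zero, with respect to the angle. -/
def zeroSlope (z t₀ : ℝ) : ℝ := Real.sqrt (1 - t₀ ^ 2) * profF' z t₀

theorem fProfile_eq (hz0 : 0 ≤ c ^ 2 / (1 + c ^ 2)) (hz1 : c ^ 2 / (1 + c ^ 2) ≤ 0.15605)
    (h0 : profF (c ^ 2 / (1 + c ^ 2)) t₀ = 0) (h1 : -0.2 < t₀) (h2 : t₀ < 0.01) (t : ℝ) :
    fProfile c t = (zeroSlope (c ^ 2 / (1 + c ^ 2)) t₀)⁻¹ * profF (c ^ 2 / (1 + c ^ 2)) t := by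
  rw [fProfile, tZero_eq hz0 hz1 h0 h1 h2, two_div_eq,
    (hasDerivAt_profF hz0 hz1 (by linarith) (by linarith)).deriv,
    abs_of_pos (profF'_pos hz1 hz0 (by linarith) (by linarith)), div_eq_inv_mul, zeroSlope]

theorem vPolar_eq (hz0 : 0 ≤ c ^ 2 / (1 + c ^ 2)) (hz1 : c ^ 2 / (1 + c ^ 2) ≤ 0.15605)
    (h0 : profF (c ^ 2 / (1 + c ^ 2)) t₀ = 0) (h1 : -0.2 < t₀) (h2 : t₀ < 0.01) (y : E3) :
    vPolar c ((zeroSlope (c ^ 2 / (1 + c ^ 2)) t₀)⁻¹ * (0.17 - 0.3 * (c ^ 2 / (1 + c ^ 2)))) ‖y‖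
      (cosAngle y) = bubbleCone (c ^ 2 / (1 + c ^ 2)) (zeroSlope (c ^ 2 / (1 + c ^ 2)) t₀)⁻¹ y := by
  rw [vPolar, fProfile_eq hz0 hz1 h0 h1 h2, gProfile_eq, bubbleCone_eq]
  ring

theorem isMinPair_pCone (hz0 : 0 ≤ c ^ 2 / (1 + c ^ 2)) (hz1 : c ^ 2 / (1 + c ^ 2) ≤ 0.15605)
    (h0 : profF (c ^ 2 / (1 + c ^ 2)) t₀ = 0) (h1 : -0.2 < t₀) (h2 : t₀ < 0.01)
    (hk : 0.9996 - 0.409 * (c ^ 2 / (1 + c ^ 2)) + 0.18 * (c ^ 2 / (1 + c ^ 2)) ^ 2 <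
      (1 - t₀ ^ 2) * profF' (c ^ 2 / (1 + c ^ 2)) t₀ ^ 2)
    {L : ℝ} (hL : L = (zeroSlope (c ^ 2 / (1 + c ^ 2)) t₀)⁻¹) :
    IsMinPair c (bubbleCone (c ^ 2 / (1 + c ^ 2)) L)
      (waveCone (c ^ 2 / (1 + c ^ 2)) L (expo c 1) (expo c 2) (expo c 3))
      (pCone c (L * (0.17 - 0.3 * (c ^ 2 / (1 + c ^ 2)))) 3
        (fun n => L * waveCoeff (c ^ 2 / (1 + c ^ 2)) n)) := by
  have e1 := isExponent_expo c 1
  have e2 := isExponent_expo c 2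
  have e3 := isExponent_expo c 3
  have hVeq := vPolar_eq hz0 hz1 h0 h1 h2
  rw [← hL] at hVeq
  have hsl : 0 < zeroSlope (c ^ 2 / (1 + c ^ 2)) t₀ := mul_pos (Real.sqrt_pos.2 (by nlinarith))
    (profF'_pos hz1 hz0 (by linarith) (by linarith))
  have hL0 : 0 < L := hL ▸ inv_pos.2 hsl
  have hLK : L ^ 2 * ((1 - t₀ ^ 2) * profF' (c ^ 2 / (1 + c ^ 2)) t₀ ^ 2) = 1 := by
    have hs := Real.sq_sqrt (show 0 ≤ 1 - t₀ ^ 2 by nlinarith)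
    rw [← hs, ← mul_pow, ← mul_pow, hL]
    exact (congrArg (· ^ 2) (inv_mul_cancel₀ hsl.ne')).trans (one_pow 2)
  have a1 := e1.one_le hz0 le_rfl
  have a2 := e2.one_le hz0 (by norm_num)
  have a3 := e3.one_le hz0 (by norm_num)
  have hraw : ∀ x, pRaw c (L * (0.17 - 0.3 * (c ^ 2 / (1 + c ^ 2)))) 3
      (fun n => L * waveCoeff (c ^ 2 / (1 + c ^ 2)) n) x =
      max (min (bubbleCone (c ^ 2 / (1 + c ^ 2)) L x)
        (waveCone (c ^ 2 / (1 + c ^ 2)) L (expo c 1) (expo c 2) (expo c 3) x)) 0 := fun x => by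
    rw [pRaw, hVeq, wPolar_eq, waveCone_eq]
  exact {
    contDiffAt_left := fun y hy => contDiffAt_bubbleCone hz0 hz1 hy
    harmonic_left := fun y hy => divergence_bubbleCone hz0 hz1 hy
    contDiffAt_right := fun y hy => contDiffAt_waveCone hy
    harmonic_right := fun y hy => divergence_waveCone e1 e2 e3 hy
    continuous_right := continuous_waveCone a1 a2 a3
    bounded_right := bound_fderiv_waveCone a1 a2 a3
    vertex_pos := by
      rw [waveCone_zero a1 a2 a3]
      exact mul_pos hL0 (by linarith)
    blowup := fun y hy hy1 hW => tendsto_sub_waveCone hz0 hz1 hL0 e1 e2 e3 hy hy1 hW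
    eq_off := fun y hy => by rw [pCone, if_neg hy, hraw]
    eq_on := fun y hy hy1 => by
      rw [pCone, if_pos hy]
      exact liminf_eq_of_blowup hy (continuous_waveCone a1 a2 a3) (fun x _ => hraw x)
        fun hW => tendsto_sub_waveCone hz0 hz1 hL0 e1 e2 e3 hy hy1 hW
    slope_left := fun y hy hy1 hV hW => (gradSq_bubbleCone_lt rfl hz0 hz1 hL0
      e1 e2 e3 h0 h1 h2 hk hy hy1 hV hW).trans_eq hLK
    slope_right := fun y hy hy1 hW => (gradSq_waveCone_lt rfl hz0 hz1 hL0
      e1 e2 e3 hk hy hy1 hW).trans_eq hLK }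

end

end ConeFB

end

theorem lemmal (c : ℝ) (hc0 : 0 ≤ c) (hc1 : c ≤ 0.43) :
    ∃ ε : ℝ, 0 < ε ∧ ∃ (N : ℕ) (a : ℕ → ℝ),
      (∀ t ∈ Set.Ioc (-1 : ℝ) 1, 0 ≤ ConeFB.fProfile c t → 0 < ConeFB.wPolar c N a 1 t) ∧
      (∀ t ∈ Set.Ioc (-1 : ℝ) 1, 0 < ConeFB.wPolar c N a 1 t →
        ConeFB.fProfile c t + ε * ConeFB.gProfile c t < ConeFB.wPolar c N a 1 t) ∧
      ConeFB.DistribSuperharmonicOn c (ConeFB.pCone c ε N a)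
        {y : ConeFB.E3 | ‖y‖ < 1 ∧ 0 < ConeFB.pCone c ε N a y} ∧
      (∀ x : ConeFB.E3, ‖x‖ < 1 → x ∈ frontier {y : ConeFB.E3 | 0 < ConeFB.pCone c ε N a y} →
        ConeFB.GradLimsupLtOne c (ConeFB.pCone c ε N a) x) := by
  have hz0 : 0 ≤ c ^ 2 / (1 + c ^ 2) := by positivity
  -- The limit 0.43 enters only here: 0.1849/1.1849 < 0.15605.
  have hz1 : c ^ 2 / (1 + c ^ 2) ≤ 0.15605 := by
    rw [div_le_iff₀ (by positivity)]
    nlinarith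
  obtain ⟨t₀, h0, h1, h2, hk⟩ := ConeFB.exists_zero_profF hz0 hz1
  have hf := ConeFB.fProfile_eq hz0 hz1 h0 h1 h2
  have hsl : 0 < ConeFB.zeroSlope (c ^ 2 / (1 + c ^ 2)) t₀ :=
    mul_pos (Real.sqrt_pos.2 (by nlinarith)) (ConeFB.profF'_pos hz1 hz0 (by linarith) (by linarith))
  have H := ConeFB.isMinPair_pCone hz0 hz1 h0 h1 h2 hk rfl
  set L := (ConeFB.zeroSlope (c ^ 2 / (1 + c ^ 2)) t₀)⁻¹ with hL
  have hL0 : 0 < L := inv_pos.2 hsl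
  refine ⟨L * (0.17 - 0.3 * (c ^ 2 / (1 + c ^ 2))), mul_pos hL0 (by linarith), 3,
    fun n => L * ConeFB.waveCoeff (c ^ 2 / (1 + c ^ 2)) n, ?_, ?_, H.distribSuperharmonicOn,
    fun x hx => H.gradLimsupLtOne hx⟩
  · intro t ht hft
    rw [hf] at hft
    have hF := nonneg_of_mul_nonneg_right hft hL0
    -- Since f increases, f(t) ≥ 0 means t ≥ t₀ > -0.2, the range where w(1, ·) is known to be
    -- positive.
    have htt : t₀ ≤ t := by
      by_contra! hlt
      have := ConeFB.strictMonoOn_profF hz0 hz1 ht ⟨by linarith, by linarith⟩ hlt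
      linarith
    rw [ConeFB.wPolar_eq, ConeFB.waveFn]
    simp only [Real.one_rpow]
    exact mul_pos hL0 (ConeFB.profileSum_pos hz0 hz1 (by linarith) ht.2)
  · intro t ht hw
    rw [ConeFB.wPolar_eq, ConeFB.waveFn] at hw ⊢
    simp only [Real.one_rpow] at hw ⊢
    rw [hf, ConeFB.gProfile_eq]
    have := mul_lt_mul_of_pos_left (ConeFB.lt_profileSum hz0 hz1 ht.1 ht.2
      (pos_of_mul_pos_right hw hL0.le).le) hL0
    linarith
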